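/- **Theorem 1.4.** Let $\sigma\in\{+1,-1\}$, $t_0>0$ and let $s\ge 1$ be an integer. For $s\in\mathbb N$, $p\in\{1,2\}$ let $W^{s,p}=\{f:\nabla^k f\in L^p(\mathbb R),\ 0\le k\le s\}$ (complex-valued functions, weak derivatives), with norm $\sum_{k\le s}\|\nabla^k f\|_{L^p}$, let $H^s=W^{s,2}$, and write $f\in\dot H^{-2}$ if $\hat f(\xi)/|\xi|^2\in L^2$, with the norm of this function in $L^2$. There exist $a_0>0$ and $\delta>0$, depending only on $t_0$ and $s$, such that for all $0<a<a_0$ and all $u_+\in \dot H^{-2}\cap H^s\cap W^{s,1}$ with $\|u_+\|_{\dot H^{-2}}+\|u_+\|_{H^s}+\|u_+\|_{W^{s,1}}<\delta$ the following holds. Put $$v_1(t,x)=a+e^{\sigma i a^2\log t}\,e^{it\partial_x^2}u_+(x).$$ Then the equation $$i v_t+v_{xx}+\frac{\sigma}{t}\,(|v|^2-a^2)\,v=0,\qquad t>t_0,\ x\in\mathbb R,$$ has a solution $v$ (in the sense of distributions in $x$ for every $t>t_0$) with $v-v_1\in C([t_0,\infty),H^s(\mathbb R))$ and, as $t\to\infty$,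 $$\|(v-v_1)(t)\|_{L^2}=O(t^{-1/2}),\qquad \|\nabla^k(v-v_1)(t)\|_{L^2}=O(t^{-1})\quad\text{for every integer } 0<k\le s,$$ and this solution is unique among all solutions $v$ with $v-v_1\in C([t_0,\infty),H^s(\mathbb R))$ that satisfy these decay rates. -/

import Mathlib

open MeasureTheory Filter Topology Set FourierTransform
open scoped ContDiff ENNReal

noncomputable section

namespace ModifiedWave

/-- `g` is the weak (distributional) derivative of order `k` of `f` on the real line;
`f` and `g` are locally integrable and the test functions are smooth and compactly supported. -/
structure HasWeakDeriv (k : ℕ) (f g : ℝ → ℂ) : Prop where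
  left_locallyIntegrable : LocallyIntegrable f volume
  right_locallyIntegrable : LocallyIntegrable g volume
  integral_eq : ∀ φ : ℝ → ℝ, ContDiff ℝ ∞ φ → HasCompactSupport φ →
    ∫ x, iteratedDeriv k φ x • f x = (-1 : ℂ) ^ k * ∫ x, φ x • g x

open Classical in
/-- The weak derivative `∇^k f`, a function determined up to null sets when it exists
(and `0` by convention when it does not). -/
def weakDeriv (k : ℕ) (f : ℝ → ℂ) : ℝ → ℂ :=
  if h : ∃ g, HasWeakDeriv k f g then h.choose else 0

/-- Weak derivatives are unique almost everywhere, so `weakDeriv` is well defined. -/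
theorem HasWeakDeriv.weakDeriv_ae_eq {k : ℕ} {f g : ℝ → ℂ} (h : HasWeakDeriv k f g) :
    weakDeriv k f =ᵐ[volume] g := by
  have hex : ∃ g, HasWeakDeriv k f g := ⟨g, h⟩
  have hc : HasWeakDeriv k f (weakDeriv k f) := by
    rw [weakDeriv, dif_pos hex]
    exact hex.choose_spec
  refine ae_eq_of_integral_contDiff_smul_eq hc.right_locallyIntegrable
    h.right_locallyIntegrable fun φ hφ hφc => ?_
  have h1 := hc.integral_eq φ hφ hφc
  rw [h.integral_eq φ hφ hφc] at h1
  exact (mul_left_cancel₀ (pow_ne_zero k (by norm_num)) h1).symm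

/-- Membership in `W^{s,p}(ℝ)`: all weak derivatives of order `0 ≤ k ≤ s` exist and lie in `L^p`.
The space `H^s` is the case `p = 2`. -/
def MemW (s : ℕ) (p : ℝ≥0∞) (f : ℝ → ℂ) : Prop :=
  ∀ k ≤ s, ∃ g, HasWeakDeriv k f g ∧ MemLp g p volume

/-- The norm `∑_{k ≤ s} ‖∇^k f‖_{L^p}` of a function of `W^{s,p}(ℝ)`. -/
def normW (s : ℕ) (p : ℝ≥0∞) (f : ℝ → ℂ) : ℝ≥0∞ :=
  ∑ k ∈ Finset.range (s + 1), eLpNorm (weakDeriv k f) p volume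

/-- The function `û(ξ) / |ξ|²`. Here `𝓕 u ξ = ∫ exp (-2 π i x ξ) u x dx`. -/
def fourierDivSq (u : ℝ → ℂ) (ξ : ℝ) : ℂ := 𝓕 u ξ / ((|ξ| ^ 2 : ℝ) : ℂ)

/-- `u` belongs to `Ḣ^{-2} ∩ H^s ∩ W^{s,1}`. As `u ∈ L¹`, its Fourier transform is the
Fourier integral; `u ∈ Ḣ^{-2}` means `û / |ξ|² ∈ L²`. -/
structure MemData (s : ℕ) (u : ℝ → ℂ) : Prop where
  memHNegTwo : MemLp (fourierDivSq u) 2 volume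
  memH : MemW s 2 u
  memW : MemW s 1 u

/-- The norm of `Ḣ^{-2} ∩ H^s ∩ W^{s,1}`. -/
def dataNorm (s : ℕ) (u : ℝ → ℂ) : ℝ≥0∞ :=
  eLpNorm (fourierDivSq u) 2 volume + normW s 2 u + normW s 1 u

/-- The free Schrödinger evolution `e^{it∂_x²} u`, the Fourier multiplier of symbol
`exp (-i t (2πξ)²)`. For `u ∈ L¹ ∩ H^1`, `û` is integrable and the inverse Fourier
integral converges absolutely. -/
def freeSchrodinger (t : ℝ) (u : ℝ → ℂ) : ℝ → ℂ :=
  𝓕⁻ (fun ξ : ℝ => Complex.exp (-Complex.I * t * (2 * Real.pi * ξ) ^ 2) * 𝓕 u ξ)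

/-- The profile `v₁(t,x) = a + e^{σ i a² log t} e^{it∂_x²} u(x)`, `σ = ±1`. -/
def profile (σ a : ℝ) (u : ℝ → ℂ) (t x : ℝ) : ℂ :=
  a + Complex.exp (σ * Complex.I * a ^ 2 * Real.log t) * freeSchrodinger t u x

/-- `v` solves `i v_t + v_xx + (σ/t) (|v|² - a²) v = 0` on `(t₀,∞) × ℝ`, the equation being
understood in the sense of distributions in `x` at every time `t > t₀`: for all test functions `φ`,
`d/dt ⟨v(t), φ⟩ = i (⟨v(t), φ''⟩ + (σ/t) ⟨(|v(t)|² - a²) v(t), φ⟩)`. -/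
def IsSolution (σ a t₀ : ℝ) (v : ℝ → ℝ → ℂ) : Prop :=
  ∀ φ : ℝ → ℝ, ContDiff ℝ ∞ φ → HasCompactSupport φ → ∀ t : ℝ, t₀ < t →
    HasDerivAt (fun τ : ℝ => ∫ x, φ x • v τ x)
      (Complex.I * ((∫ x, iteratedDeriv 2 φ x • v t x) +
        (σ / t : ℂ) * ∫ x, φ x • (((‖v t x‖ ^ 2 - a ^ 2 : ℝ) : ℂ) * v t x))) t

/-- `r ∈ C([t₀,∞), H^s(ℝ))`. -/
def IsContinuousInH (s : ℕ) (t₀ : ℝ) (r : ℝ → ℝ → ℂ) : Prop :=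
  ∀ t : ℝ, t₀ ≤ t → MemW s 2 (r t) ∧
    Tendsto (fun τ => normW s 2 (r τ - r t)) (𝓝[Ici t₀] t) (𝓝 0)

/-- As `t → ∞`, `‖r(t)‖_{L²} = O(t^{-1/2})` and `‖∇^k r(t)‖_{L²} = O(t^{-1})` for `0 < k ≤ s`. -/
def HasDecay (s : ℕ) (r : ℝ → ℝ → ℂ) : Prop :=
  ((fun t => (eLpNorm (r t) 2 volume).toReal) =O[atTop] fun t : ℝ => t ^ (-(1 / 2) : ℝ)) ∧
  ∀ k : ℕ, 0 < k → k ≤ s →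
    (fun t => (eLpNorm (weakDeriv k (r t)) 2 volume).toReal) =O[atTop] fun t : ℝ => t⁻¹

/-- `v` solves the equation, `v - v₁ ∈ C([t₀,∞), H^s)`, and `v - v₁` has the stated decay. -/
structure IsWaveSolution (σ a t₀ : ℝ) (s : ℕ) (u : ℝ → ℂ) (v : ℝ → ℝ → ℂ) : Prop where
  isSolution : IsSolution σ a t₀ v
  continuous_sub : IsContinuousInH s t₀ fun t x => v t x - profile σ a u t x
  decay : HasDecay s fun t x => v t x - profile σ a u t x

end ModifiedWave

end

/-! Write S(t) for the free Schrödinger group, β = σa², z(t) = e^{iβ log t} S(t)u and v = a + z + w.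
With F(y) = (|a+y|² - a²)(a+y) = a²(y + ȳ) + N(y), where N collects the quadratic and cubic terms,
the phase in z absorbs exactly the term a²z. The remainder therefore has to solve w(t) = -iσ S(t)
(K(t) + ∫_t^∞ τ⁻¹ S(-τ)[F(z+w) - F(z)] dτ), where K(t) is the integral over (t,∞) of τ⁻¹ S(-τ)(a² z̄
+ N(z)).

The decay of K comes from three mechanisms. The linear term is τ⁻¹ e^{-iβ log τ} S(-2τ)ū up to a
constant, which is not absolutely integrable. The hypothesis u ∈ Ḣ⁻² provides q₂ with q₂'' = u, so
that S(-2τ)ū is a time derivative, and one integration by parts gives O(1/t)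
(`Data.hasDerivAt_linPrim`, `hasDerivAt_byParts`). The dispersive estimate (`aebdd_schr`) together
with u ∈ W^{s,1} shows that multiplication by z on H^s has norm O(τ^{-1/2}); the quadratic terms are
then O(τ^{-3/2}) and the cubic one O(τ⁻²), whence the rate t^{-1/2}. For spatial derivatives the
rate 1/t comes from normal forms. In the interaction picture z² oscillates with frequency
proportional to 2ξ₁ξ₂ and |z|² with frequency proportional to 2ξξ₂, where ξ = ξ₁+ξ₂. So z² is a time
derivative after taking one primitive of each factor (`tail_quad_one`), whereas for |z|² this holds
only after one spatial derivative (`comp_tail_quad_neg`). This is why the L² norm itself has the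
slower rate.

The integral equation is solved by a contraction in the norm sup √t ‖w(t)‖_{H^s}; the bounds R'/t on
derivatives form a closed invariant condition (`Iteration.exists_solution`). The linear feedback
a²(w + w̄)/τ is as large as the weight permits, and is absorbed because a is small.

For uniqueness, a weak solution continuous in H^s satisfies the equation in the interaction picture
(`hasDerivAt_of_weakEq`). For large times the Duhamel formula from infinity halves any bound C/√t on
the difference of two solutions, so the difference vanishes; Gronwall's inequality carries this back
to t₀ (`eq_of_weakEq`). -/

noncomputable section

/-! ### Multiplication operators and Fourier multipliers on L². -/

namespace ModifiedWave

/-- The Hilbert space `L²(ℝ)`. -/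
abbrev L2 := Lp ℂ 2 (volume : Measure ℝ)

open Classical in
/-- Multiplication by an essentially bounded function on `L²`. -/
def bmul (m : ℝ → ℂ) : L2 →L[ℂ] L2 :=
  if h : MemLp m ∞ (volume : Measure ℝ) then
    (ContinuousLinearMap.mul ℂ ℂ).holderL volume ∞ 2 2 (h.toLp m) else 0

theorem coeFn_bmul {m : ℝ → ℂ} (hm : MemLp m ∞ (volume : Measure ℝ)) (f : L2) :
    bmul m f =ᵐ[volume] fun x => m x * f x := by
  rw [bmul, dif_pos hm, ContinuousLinearMap.holderL_apply_apply]
  filter_upwards [(ContinuousLinearMap.mul ℂ ℂ).coeFn_holder (r := 2) (hm.toLp m) f,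
    hm.coeFn_toLp] with x h1 h2
  rw [h1, h2]; rfl

theorem memLp_top_of_continuous {m : ℝ → ℂ} (hc : Continuous m) {C : ℝ} (hC : ∀ x, ‖m x‖ ≤ C) :
    MemLp m ∞ (volume : Measure ℝ) :=
  memLp_top_of_bound hc.aestronglyMeasurable C (Eventually.of_forall hC)

theorem L2.norm_le_of_ae_le {f g : L2} {C : ℝ}
    (h : ∀ᵐ x ∂(volume : Measure ℝ), ‖f x‖ ≤ C * ‖g x‖) : ‖f‖ ≤ C * ‖g‖ :=
  Lp.norm_le_mul_norm_of_ae_le_mul h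

theorem norm_bmul_le {m : ℝ → ℂ} {C : ℝ} (hC : 0 ≤ C) (h : ∀ᵐ x ∂(volume : Measure ℝ), ‖m x‖ ≤ C)
    (f : L2) : ‖bmul m f‖ ≤ C * ‖f‖ := by
  by_cases hm : MemLp m ∞ (volume : Measure ℝ)
  · refine L2.norm_le_of_ae_le ?_
    filter_upwards [coeFn_bmul hm f, h] with x h1 h2
    rw [h1, norm_mul]
    gcongr
  · rw [bmul, dif_neg hm]
    simp only [zero_apply, norm_zero]
    positivity

theorem bmul_bmul {m n : ℝ → ℂ} (hm : MemLp m ∞ (volume : Measure ℝ))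
    (hn : MemLp n ∞ (volume : Measure ℝ)) (f : L2) :
    bmul m (bmul n f) = bmul (fun x => m x * n x) f := by
  have hmn : MemLp (fun x => m x * n x) ∞ (volume : Measure ℝ) := hn.mul hm
  apply Lp.ext
  filter_upwards [coeFn_bmul hm (bmul n f), coeFn_bmul hn f, coeFn_bmul hmn f] with x h1 h2 h3
  rw [h1, h2, h3]; ring

theorem bmul_add_left {m n : ℝ → ℂ} (hm : MemLp m ∞ (volume : Measure ℝ))
    (hn : MemLp n ∞ (volume : Measure ℝ)) (f : L2) :
    bmul (fun x => m x + n x) f = bmul m f + bmul n f := by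
  have hmn : MemLp (fun x => m x + n x) ∞ (volume : Measure ℝ) := hm.add hn
  apply Lp.ext
  filter_upwards [coeFn_bmul hm f, coeFn_bmul hn f, coeFn_bmul hmn f,
    Lp.coeFn_add (bmul m f) (bmul n f)] with x h1 h2 h3 h4
  rw [h3, h4, Pi.add_apply, h1, h2]; ring

theorem bmul_const (c : ℂ) (f : L2) : bmul (fun _ => c) f = c • f := by
  have hm : MemLp (fun _ : ℝ => c) ∞ (volume : Measure ℝ) :=
    memLp_top_of_continuous continuous_const (fun _ => le_rfl)
  apply Lp.ext
  filter_upwards [coeFn_bmul hm f, Lp.coeFn_smul c f] with x h1 h2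
  rw [h1, h2]; rfl

/-- Dominated convergence for multiplication operators. -/
theorem tendsto_bmul {ι : Type*} {l : Filter ι} [l.IsCountablyGenerated] {m : ι → ℝ → ℂ}
    {n : ℝ → ℂ} {C : ℝ} (hm : ∀ i, AEStronglyMeasurable (m i) (volume : Measure ℝ))
    (hn : AEStronglyMeasurable n (volume : Measure ℝ))
    (hmC : ∀ᶠ i in l, ∀ x, ‖m i x‖ ≤ C) (hnC : ∀ x, ‖n x‖ ≤ C)
    (hlim : ∀ x, Tendsto (fun i => m i x) l (𝓝 (n x))) (f : L2) :
    Tendsto (fun i => bmul (m i) f) l (𝓝 (bmul n f)) := by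
  have hn' : MemLp n ∞ (volume : Measure ℝ) := memLp_top_of_bound hn C (Eventually.of_forall hnC)
  rw [tendsto_iff_norm_sub_tendsto_zero]
  have key : Tendsto (fun i => ∫ x, ‖m i x - n x‖ ^ 2 * ‖f x‖ ^ 2) l (𝓝 (∫ x : ℝ, (0 : ℝ))) := by
    refine tendsto_integral_filter_of_dominated_convergence
      (fun x => (2 * C) ^ 2 * ‖f x‖ ^ 2) ?_ ?_ ?_ ?_
    · refine Eventually.of_forall fun i => ?_
      exact (((hm i).sub hn).norm.pow 2).mul ((Lp.aestronglyMeasurable f).norm.pow 2)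
    · filter_upwards [hmC] with i hi
      refine Eventually.of_forall fun x => ?_
      rw [Real.norm_of_nonneg (by positivity)]
      gcongr
      calc ‖m i x - n x‖ ≤ ‖m i x‖ + ‖n x‖ := norm_sub_le _ _
        _ ≤ 2 * C := by linarith [hi x, hnC x]
    · exact ((memLp_two_iff_integrable_sq_norm (Lp.aestronglyMeasurable f)).1 (Lp.memLp f)).const_mul _
    · refine Eventually.of_forall fun x => ?_
      have := (((hlim x).sub_const (n x)).norm.pow 2).mul_const (‖f x‖ ^ 2)
      simpa using this
  have h2 : Tendsto (fun i => ‖bmul (m i) f - bmul n f‖ ^ 2) l (𝓝 0) := by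
    rw [integral_zero] at key
    refine key.congr' ?_
    filter_upwards [hmC] with i hi
    have hmi : MemLp (m i) ∞ (volume : Measure ℝ) :=
      memLp_top_of_bound (hm i) C (Eventually.of_forall hi)
    rw [← @inner_self_eq_norm_sq ℂ, L2.inner_def, ← integral_re]
    · refine integral_congr_ae ?_
      filter_upwards [coeFn_bmul hmi f, coeFn_bmul hn' f,
        Lp.coeFn_sub (bmul (m i) f) (bmul n f)] with x h1 h2 h3
      rw [inner_self_eq_norm_sq, h3, Pi.sub_apply, h1, h2, ← sub_mul, norm_mul, mul_pow]
    · exact L2.integrable_inner _ _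
  have h3 := (Real.continuous_sqrt.tendsto 0).comp h2
  rw [Real.sqrt_zero] at h3
  refine h3.congr fun i => ?_
  simp [Real.sqrt_sq]

/-- The Fourier multiplier of symbol `m` on `L²`. -/
def fmul (m : ℝ → ℂ) : L2 →L[ℂ] L2 :=
  (Lp.fourierTransformₗᵢ ℝ ℂ).symm.toContinuousLinearEquiv.toContinuousLinearMap ∘L bmul m ∘L
    (Lp.fourierTransformₗᵢ ℝ ℂ).toContinuousLinearEquiv.toContinuousLinearMap

theorem fmul_apply (m : ℝ → ℂ) (f : L2) : fmul m f = 𝓕⁻ (bmul m (𝓕 f)) := rfl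

theorem fourier_fmul (m : ℝ → ℂ) (f : L2) : 𝓕 (fmul m f) = bmul m (𝓕 f) := by
  rw [fmul_apply, fourier_fourierInv_eq]

theorem norm_fourierInv_L2 (f : L2) : ‖(𝓕⁻ f : L2)‖ = ‖f‖ :=
  (Lp.fourierTransformₗᵢ ℝ ℂ).symm.norm_map f

theorem norm_fmul_le {m : ℝ → ℂ} {C : ℝ} (hC : 0 ≤ C) (h : ∀ x, ‖m x‖ ≤ C) (f : L2) :
    ‖fmul m f‖ ≤ C * ‖f‖ := by
  rw [fmul_apply, norm_fourierInv_L2, ← Lp.norm_fourier_eq f]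
  exact norm_bmul_le hC (Eventually.of_forall h) _

theorem fmul_fmul {m n : ℝ → ℂ} (hm : MemLp m ∞ (volume : Measure ℝ))
    (hn : MemLp n ∞ (volume : Measure ℝ)) (f : L2) :
    fmul m (fmul n f) = fmul (fun x => m x * n x) f := by
  rw [fmul_apply, fourier_fmul, bmul_bmul hm hn, fmul_apply]

theorem fmul_comm {m n : ℝ → ℂ} (hm : MemLp m ∞ (volume : Measure ℝ))
    (hn : MemLp n ∞ (volume : Measure ℝ)) (f : L2) :
    fmul m (fmul n f) = fmul n (fmul m f) := by
  rw [fmul_fmul hm hn, fmul_fmul hn hm]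
  simp_rw [mul_comm]

theorem fmul_add_left {m n : ℝ → ℂ} (hm : MemLp m ∞ (volume : Measure ℝ))
    (hn : MemLp n ∞ (volume : Measure ℝ)) (f : L2) :
    fmul (fun x => m x + n x) f = fmul m f + fmul n f := by
  rw [fmul_apply, bmul_add_left hm hn, FourierTransform.fourierInv_add]; rfl

theorem fmul_const (c : ℂ) (f : L2) : fmul (fun _ => c) f = c • f := by
  rw [fmul_apply, bmul_const, FourierTransform.fourierInv_smul, fourierInv_fourier_eq]

theorem tendsto_fmul {ι : Type*} {l : Filter ι} [l.IsCountablyGenerated] {m : ι → ℝ → ℂ}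
    {n : ℝ → ℂ} {C : ℝ} (hm : ∀ i, AEStronglyMeasurable (m i) (volume : Measure ℝ))
    (hn : AEStronglyMeasurable n (volume : Measure ℝ))
    (hmC : ∀ᶠ i in l, ∀ x, ‖m i x‖ ≤ C) (hnC : ∀ x, ‖n x‖ ≤ C)
    (hlim : ∀ x, Tendsto (fun i => m i x) l (𝓝 (n x))) (f : L2) :
    Tendsto (fun i => fmul (m i) f) l (𝓝 (fmul n f)) :=
  ((Lp.fourierTransformₗᵢ ℝ ℂ).symm.continuous.tendsto _).comp
    (tendsto_bmul hm hn hmC hnC hlim (𝓕 f))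

end ModifiedWave

/-! ### Bilinear pairing, conjugation and reflection, and their relation to the Fourier transform.
-/

namespace ModifiedWave

/-- The bilinear pairing `∫ f g` on `L²`. -/
def pairing : L2 →L[ℂ] L2 →L[ℂ] ℂ := (ContinuousLinearMap.mul ℂ ℂ).lpPairing volume 2 2

theorem pairing_apply (f g : L2) : pairing f g = ∫ x, f x * g x :=
  ContinuousLinearMap.lpPairing_eq_integral _ f g

theorem pairing_bmul {m : ℝ → ℂ} (hm : MemLp m ∞ (volume : Measure ℝ)) (f g : L2) :
    pairing (bmul m f) g = pairing f (bmul m g) := by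
  rw [pairing_apply, pairing_apply]
  refine integral_congr_ae ?_
  filter_upwards [coeFn_bmul hm f, coeFn_bmul hm g] with x h1 h2
  rw [h1, h2]; ring

theorem denseRange_schwartz : DenseRange (fun h : SchwartzMap ℝ ℂ => (h.toLp 2 volume : L2)) :=
  SchwartzMap.denseRange_toLpCLM (E := ℝ) (F := ℂ) (p := 2) (μ := volume) ENNReal.ofNat_ne_top

theorem continuous_fourier_L2 : Continuous (fun f : L2 => (𝓕 f : L2)) :=
  (Lp.fourierTransformₗᵢ ℝ ℂ).continuous

theorem continuous_fourierInv_L2 : Continuous (fun f : L2 => (𝓕⁻ f : L2)) :=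
  (Lp.fourierTransformₗᵢ ℝ ℂ).symm.continuous

/-- Both sides are continuous in each variable, so the identity for Schwartz functions suffices. The
bilinear pairing is preferred to the inner product because it is what testing against φ produces,
without conjugations. -/
theorem pairing_fourier (f g : L2) : pairing (𝓕 f) g = pairing f (𝓕 g) := by
  refine DenseRange.induction_on denseRange_schwartz f (isClosed_eq ?_ ?_) fun a => ?_
  · exact (pairing.flip g).continuous.comp continuous_fourier_L2
  · exact (pairing.flip (𝓕 g)).continuous
  refine DenseRange.induction_on denseRange_schwartz g (isClosed_eq ?_ ?_) fun b => ?_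
  · exact (pairing _).continuous
  · exact (pairing _).continuous.comp continuous_fourier_L2
  rw [SchwartzMap.toLp_fourier_eq, SchwartzMap.toLp_fourier_eq, pairing_apply, pairing_apply]
  have h := SchwartzMap.integral_fourier_mul_eq a b
  refine (integral_congr_ae ?_).trans (h.trans (integral_congr_ae ?_))
  · filter_upwards [SchwartzMap.coeFn_toLp (𝓕 a) 2 volume, SchwartzMap.coeFn_toLp b 2 volume]
      with x h1 h2
    rw [h1, h2]
  · filter_upwards [SchwartzMap.coeFn_toLp a 2 volume, SchwartzMap.coeFn_toLp (𝓕 b) 2 volume]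
      with x h1 h2
    rw [h1, h2]

theorem pairing_fourierInv (f g : L2) : pairing (𝓕⁻ f) g = pairing f (𝓕⁻ g) := by
  have h := pairing_fourier (𝓕⁻ f) (𝓕⁻ g)
  rw [fourier_fourierInv_eq, fourier_fourierInv_eq] at h
  exact h.symm

/-- By density the hypothesis extends to every element of L²; testing with the conjugate of f - g
yields ‖f - g‖² = 0. -/
theorem ext_pairing {f g : L2} (h : ∀ k : SchwartzMap ℝ ℂ,
    pairing (k.toLp 2 volume) f = pairing (k.toLp 2 volume) g) : f = g := by
  have hall : ∀ k : L2, pairing k f = pairing k g := fun k => by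
    refine DenseRange.induction_on denseRange_schwartz k (isClosed_eq ?_ ?_) h
    · exact (pairing.flip f).continuous
    · exact (pairing.flip g).continuous
  have hc : MemLp (fun x => (starRingEnd ℂ) ((f - g : L2) x)) 2 (volume : Measure ℝ) :=
    (Lp.memLp (f - g)).star
  have h1 : pairing (hc.toLp _) (f - g) = 0 := by rw [map_sub, hall, sub_self]
  have h2 : inner ℂ (f - g) (f - g) = (0 : ℂ) := by
    rw [← h1, pairing_apply, L2.inner_def]
    refine integral_congr_ae ?_
    filter_upwards [hc.coeFn_toLp] with x hx
    rw [hx, RCLike.inner_apply, mul_comm]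
  exact sub_eq_zero.1 (inner_self_eq_zero.1 h2)

/-- Complex conjugation on `L²`. -/
def conjL2 : L2 →L[ℝ] L2 := (Complex.conjCLE : ℂ →L[ℝ] ℂ).compLpL 2 volume

theorem coeFn_conjL2 (f : L2) : conjL2 f =ᵐ[volume] fun x => (starRingEnd ℂ) (f x) :=
  ContinuousLinearMap.coeFn_compLpL _ f

theorem norm_conjL2 (f : L2) : ‖conjL2 f‖ = ‖f‖ := by
  rw [Lp.norm_def, Lp.norm_def]
  congr 1
  refine eLpNorm_congr_norm_ae ?_
  filter_upwards [coeFn_conjL2 f] with x hx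
  rw [hx, RCLike.norm_conj]

theorem conjL2_conjL2 (f : L2) : conjL2 (conjL2 f) = f := by
  apply Lp.ext
  filter_upwards [coeFn_conjL2 f, coeFn_conjL2 (conjL2 f)] with x h1 h2
  rw [h2, h1, Complex.conj_conj]

theorem conjL2_smul (c : ℂ) (f : L2) : conjL2 (c • f) = (starRingEnd ℂ) c • conjL2 f := by
  apply Lp.ext
  filter_upwards [coeFn_conjL2 f, coeFn_conjL2 (c • f), Lp.coeFn_smul c f,
    Lp.coeFn_smul ((starRingEnd ℂ) c) (conjL2 f)] with x h1 h2 h3 h4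
  rw [h2, h3, h4, Pi.smul_apply, Pi.smul_apply, h1, smul_eq_mul, smul_eq_mul, map_mul]

theorem pairing_conj_conj (f g : L2) :
    pairing (conjL2 f) (conjL2 g) = (starRingEnd ℂ) (pairing f g) := by
  rw [pairing_apply, pairing_apply, ← integral_conj]
  refine integral_congr_ae ?_
  filter_upwards [coeFn_conjL2 f, coeFn_conjL2 g] with x h1 h2
  rw [h1, h2, map_mul]

/-- The reflection `f ↦ f(-·)` on `L²`. -/
def reflL2 : L2 →L[ℂ] L2 :=
  (Lp.compMeasurePreservingₗᵢ ℂ (Neg.neg : ℝ → ℝ)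
    (Measure.measurePreserving_neg volume)).toContinuousLinearMap

theorem coeFn_reflL2 (f : L2) : reflL2 f =ᵐ[volume] fun x => f (-x) :=
  Lp.coeFn_compMeasurePreserving f (Measure.measurePreserving_neg volume)

theorem ae_neg {p : ℝ → Prop} (h : ∀ᵐ x ∂(volume : Measure ℝ), p x) :
    ∀ᵐ x ∂(volume : Measure ℝ), p (-x) :=
  (Measure.measurePreserving_neg volume).quasiMeasurePreserving.ae h

theorem reflL2_reflL2 (f : L2) : reflL2 (reflL2 f) = f := by
  apply Lp.ext
  filter_upwards [coeFn_reflL2 (reflL2 f), ae_neg (coeFn_reflL2 f)] with x h1 h2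
  rw [h1, h2, neg_neg]

theorem fourierInv_eq_refl_fourier (f : L2) : (𝓕⁻ f : L2) = reflL2 (𝓕 f) := by
  refine DenseRange.induction_on denseRange_schwartz f (isClosed_eq ?_ ?_) fun a => ?_
  · exact continuous_fourierInv_L2
  · exact reflL2.continuous.comp continuous_fourier_L2
  rw [SchwartzMap.toLp_fourier_eq, SchwartzMap.toLp_fourierInv_eq]
  apply Lp.ext
  filter_upwards [coeFn_reflL2 ((𝓕 a).toLp 2 volume), SchwartzMap.coeFn_toLp (𝓕⁻ a) 2 volume,
    ae_neg (SchwartzMap.coeFn_toLp (𝓕 a) 2 volume)] with x h1 h2 h3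
  rw [h1, h2, h3, SchwartzMap.fourierInv_apply_eq]
  simp

theorem fourier_eq_refl_fourierInv (f : L2) : (𝓕 f : L2) = reflL2 (𝓕⁻ f) := by
  rw [fourierInv_eq_refl_fourier, reflL2_reflL2]

theorem fourier_fourier_L2 (f : L2) : (𝓕 (𝓕 f : L2) : L2) = reflL2 f := by
  have h : (𝓕⁻ (𝓕 f : L2) : L2) = reflL2 (𝓕 (𝓕 f : L2)) := fourierInv_eq_refl_fourier (𝓕 f)
  rw [fourierInv_fourier_eq] at h
  conv_rhs => rw [h]
  rw [reflL2_reflL2]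

theorem fourier_refl (f : L2) : (𝓕 (reflL2 f) : L2) = 𝓕⁻ f := by
  rw [← fourier_fourier_L2, fourier_fourier_L2, fourierInv_eq_refl_fourier]

theorem refl_bmul {m : ℝ → ℂ} (hm : MemLp m ∞ (volume : Measure ℝ)) (f : L2) :
    reflL2 (bmul m f) = bmul (fun x => m (-x)) (reflL2 f) := by
  have hm' : MemLp (fun x => m (-x)) ∞ (volume : Measure ℝ) :=
    hm.comp_measurePreserving (Measure.measurePreserving_neg volume)
  apply Lp.ext
  filter_upwards [coeFn_reflL2 (bmul m f), coeFn_bmul hm' (reflL2 f), ae_neg (coeFn_bmul hm f),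
    coeFn_reflL2 f] with x h1 h2 h3 h4
  rw [h1, h2, h3, h4]

theorem conj_fourier (f : L2) : conjL2 (𝓕 f) = 𝓕⁻ (conjL2 f) := by
  refine ext_pairing fun k => ?_
  have hk : (k.toLp 2 volume : L2) = conjL2 (conjL2 (k.toLp 2 volume)) := (conjL2_conjL2 _).symm
  generalize (k.toLp 2 volume : L2) = k at *
  -- Every test element is a conjugate. In this form both transforms move onto the test element,
  -- where the claim is the explicit formula for Schwartz functions.
  suffices H : ∀ k : L2, pairing (conjL2 k) (conjL2 (𝓕 f)) = pairing (conjL2 k) (𝓕⁻ (conjL2 f)) by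
    rw [hk]; exact H _
  clear hk
  intro k
  refine DenseRange.induction_on denseRange_schwartz k (isClosed_eq ?_ ?_) fun a => ?_
  · exact (pairing.flip _).continuous.comp conjL2.continuous
  · exact (pairing.flip _).continuous.comp conjL2.continuous
  rw [pairing_conj_conj, ← pairing_fourier, ← pairing_conj_conj, ← pairing_fourierInv]
  congr 2
  rw [SchwartzMap.toLp_fourier_eq]
  let ac : SchwartzMap ℝ ℂ := SchwartzMap.postcompCLM (𝕜 := ℝ) (Complex.conjCLE : ℂ →L[ℝ] ℂ) a
  have hac : ∀ x, ac x = (starRingEnd ℂ) (a x) := fun x => by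
    simp [ac, SchwartzMap.postcompCLM_apply]
  have e1 : conjL2 (a.toLp 2 volume) = ac.toLp 2 volume := by
    apply Lp.ext
    filter_upwards [coeFn_conjL2 (a.toLp 2 volume), SchwartzMap.coeFn_toLp a 2 volume,
      SchwartzMap.coeFn_toLp ac 2 volume] with x h1 h2 h3
    rw [h1, h2, h3, hac]
  rw [e1, SchwartzMap.toLp_fourierInv_eq]
  apply Lp.ext
  filter_upwards [coeFn_conjL2 ((𝓕 a).toLp 2 volume), SchwartzMap.coeFn_toLp (𝓕 a) 2 volume,
    SchwartzMap.coeFn_toLp (𝓕⁻ ac) 2 volume] with x h1 h2 h3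
  rw [h1, h2, h3, SchwartzMap.fourierInv_coe, SchwartzMap.fourier_coe, Real.fourier_eq,
    Real.fourierInv_eq, ← integral_conj]
  refine integral_congr_ae (Eventually.of_forall fun y => ?_)
  simp only [Circle.smul_def, smul_eq_mul, map_mul, hac, Real.fourierChar_apply,
    ← Complex.exp_conj]
  simp [Complex.conj_ofNat]

theorem conj_fourierInv (f : L2) : conjL2 (𝓕⁻ f) = 𝓕 (conjL2 f) := by
  have h := conj_fourier (𝓕⁻ f)
  rw [fourier_fourierInv_eq] at h
  rw [h, fourier_fourierInv_eq]

theorem memLp_top_comp_neg {m : ℝ → ℂ} (hm : MemLp m ∞ (volume : Measure ℝ)) :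
    MemLp (fun x => m (-x)) ∞ (volume : Measure ℝ) :=
  hm.comp_measurePreserving (Measure.measurePreserving_neg volume)

/-- The transpose of 𝓕⁻¹ m 𝓕 for the bilinear pairing is 𝓕 m 𝓕⁻¹, and 𝓕 and 𝓕⁻¹ differ by the
reflection of ℝ. -/
theorem pairing_fmul {m : ℝ → ℂ} (hm : MemLp m ∞ (volume : Measure ℝ)) (f g : L2) :
    pairing (fmul m f) g = pairing f (fmul (fun x => m (-x)) g) := by
  rw [fmul_apply, pairing_fourierInv, pairing_bmul hm, pairing_fourier, fmul_apply,
    fourierInv_eq_refl_fourier g, fourierInv_eq_refl_fourier, fourier_eq_refl_fourierInv,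
    ← fourier_refl, refl_bmul hm, reflL2_reflL2]

theorem conj_bmul {m : ℝ → ℂ} (hm : MemLp m ∞ (volume : Measure ℝ)) (f : L2) :
    conjL2 (bmul m f) = bmul (fun x => (starRingEnd ℂ) (m x)) (conjL2 f) := by
  have hm' : MemLp (fun x => (starRingEnd ℂ) (m x)) ∞ (volume : Measure ℝ) := hm.star
  apply Lp.ext
  filter_upwards [coeFn_conjL2 (bmul m f), coeFn_bmul hm' (conjL2 f), coeFn_bmul hm f,
    coeFn_conjL2 f] with x h1 h2 h3 h4
  rw [h1, h2, h3, h4, map_mul]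

theorem conj_fmul {m : ℝ → ℂ} (hm : MemLp m ∞ (volume : Measure ℝ)) (f : L2) :
    conjL2 (fmul m f) = fmul (fun x => (starRingEnd ℂ) (m (-x))) (conjL2 f) := by
  have hm' : MemLp (fun x => (starRingEnd ℂ) (m x)) ∞ (volume : Measure ℝ) := hm.star
  rw [fmul_apply, conj_fourierInv, conj_bmul hm, conj_fourier, fmul_apply,
    fourierInv_eq_refl_fourier, ← fourier_refl, refl_bmul (memLp_top_comp_neg hm')]
  simp only [neg_neg]

end ModifiedWave

/-! ### The derivative as a closed relation on L², and density of test functions in its graph. -/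

namespace ModifiedWave

/-- The symbol `2πiξ` of the derivative. -/
def dsym (ξ : ℝ) : ℂ := 2 * Real.pi * ξ * Complex.I

/-- The bounded symbol `1 / (1 + 2πiξ)`. -/
def rsym (ξ : ℝ) : ℂ := (1 + dsym ξ)⁻¹

/-- The bounded symbol `2πiξ / (1 + 2πiξ)`. -/
def drsym (ξ : ℝ) : ℂ := dsym ξ * (1 + dsym ξ)⁻¹

theorem one_add_dsym_ne_zero (ξ : ℝ) : 1 + dsym ξ ≠ 0 := by
  intro h
  have := congrArg Complex.re h
  simp [dsym] at this

theorem normSq_one_add_dsym (ξ : ℝ) : ‖1 + dsym ξ‖ ^ 2 = 1 + (2 * Real.pi * ξ) ^ 2 := by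
  rw [← Complex.normSq_eq_norm_sq, Complex.normSq_apply]
  simp [dsym]; ring

theorem norm_dsym (ξ : ℝ) : ‖dsym ξ‖ = 2 * Real.pi * |ξ| := by
  simp [dsym, abs_of_pos Real.pi_pos]

theorem continuous_dsym : Continuous dsym := by unfold dsym; fun_prop

theorem continuous_rsym : Continuous rsym :=
  (continuous_const.add continuous_dsym).inv₀ one_add_dsym_ne_zero

theorem continuous_drsym : Continuous drsym := continuous_dsym.mul continuous_rsym

theorem one_le_norm_one_add_dsym (ξ : ℝ) : 1 ≤ ‖1 + dsym ξ‖ := by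
  have := normSq_one_add_dsym ξ
  nlinarith [norm_nonneg (1 + dsym ξ), sq_nonneg (2 * Real.pi * ξ)]

theorem norm_rsym_le (ξ : ℝ) : ‖rsym ξ‖ ≤ 1 := by
  rw [rsym, norm_inv]
  exact inv_le_one_of_one_le₀ (one_le_norm_one_add_dsym ξ)

theorem norm_drsym_le (ξ : ℝ) : ‖drsym ξ‖ ≤ 1 := by
  rw [drsym, ← div_eq_mul_inv, norm_div]
  refine div_le_one_of_le₀ ?_ (norm_nonneg _)
  rw [norm_dsym]
  refine abs_le_of_sq_le_sq' ?_ (norm_nonneg _) |>.2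
  rw [normSq_one_add_dsym, mul_pow, sq_abs, ← mul_pow]
  linarith

theorem memLp_rsym : MemLp rsym ∞ (volume : Measure ℝ) :=
  memLp_top_of_continuous continuous_rsym norm_rsym_le

theorem memLp_drsym : MemLp drsym ∞ (volume : Measure ℝ) :=
  memLp_top_of_continuous continuous_drsym norm_drsym_le

/-- `g` is the derivative of `f` in `L²`: `ĝ = 2πiξ f̂`, stated with bounded symbols. -/
def IsD (f g : L2) : Prop := fmul rsym g = fmul drsym f

/-- The symbol 1 + 2πiξ never vanishes, so dividing by it loses nothing. The divided form is an
equality of bounded operators, which makes the relation closed and compatible with limits, integrals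
and other multipliers. -/
theorem isD_iff {f g : L2} :
    IsD f g ↔ ∀ᵐ ξ ∂(volume : Measure ℝ), (𝓕 g : L2) ξ = dsym ξ * (𝓕 f : L2) ξ := by
  have h : IsD f g ↔ bmul rsym (𝓕 g) = bmul drsym (𝓕 f) := by
    rw [IsD, fmul_apply, fmul_apply]
    exact (Lp.fourierTransformₗᵢ ℝ ℂ).symm.injective.eq_iff
  rw [h, Lp.ext_iff]
  constructor
  · intro h
    filter_upwards [h, coeFn_bmul memLp_rsym (𝓕 g), coeFn_bmul memLp_drsym (𝓕 f)] with ξ h1 h2 h3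
    rw [h2, h3, rsym, drsym] at h1
    have h0 := one_add_dsym_ne_zero ξ
    field_simp at h1
    exact h1
  · intro h
    filter_upwards [h, coeFn_bmul memLp_rsym (𝓕 g), coeFn_bmul memLp_drsym (𝓕 f)] with ξ h1 h2 h3
    rw [h2, h3, rsym, drsym, h1]
    ring

theorem IsD.zero : IsD 0 0 := by simp [IsD]

theorem IsD.add {f g f' g' : L2} (h : IsD f g) (h' : IsD f' g') : IsD (f + f') (g + g') := by
  unfold IsD at *; rw [map_add, map_add, h, h']

theorem IsD.sub {f g f' g' : L2} (h : IsD f g) (h' : IsD f' g') : IsD (f - f') (g - g') := by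
  unfold IsD at *; rw [map_sub, map_sub, h, h']

theorem IsD.smul {f g : L2} (c : ℂ) (h : IsD f g) : IsD (c • f) (c • g) := by
  unfold IsD at *; rw [map_smul, map_smul, h]

theorem isClosed_isD : IsClosed {p : L2 × L2 | IsD p.1 p.2} :=
  isClosed_eq ((fmul rsym).continuous.comp continuous_snd)
    ((fmul drsym).continuous.comp continuous_fst)

theorem fmul_rsym_add_drsym (f : L2) : fmul rsym f + fmul drsym f = f := by
  rw [← fmul_add_left memLp_rsym memLp_drsym]
  have : (fun x => rsym x + drsym x) = fun _ => 1 := by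
    funext x
    have h0 := one_add_dsym_ne_zero x
    rw [rsym, drsym]; field_simp
  rw [this, fmul_const, one_smul]

/-- A pair (f, f') is the image of the single element f + f' under two bounded multipliers.
Statements about H¹ thus reduce to statements about an arbitrary element of L². -/
theorem IsD.eq_left {f g : L2} (h : IsD f g) : f = fmul rsym (f + g) := by
  rw [map_add, h, fmul_rsym_add_drsym]

theorem IsD.eq_right {f g : L2} (h : IsD f g) : g = fmul drsym (f + g) := by
  rw [map_add, ← h, fmul_rsym_add_drsym]

theorem isD_fmul_rsym (h : L2) : IsD (fmul rsym h) (fmul drsym h) := by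
  unfold IsD
  rw [fmul_comm memLp_rsym memLp_drsym]

theorem IsD.unique_right {f g g' : L2} (h : IsD f g) (h' : IsD f g') : g = g' := by
  have := h.sub h'
  rw [sub_self] at this
  have h2 := this.eq_right
  have h3 := this.eq_left
  rw [zero_add] at h2 h3
  have h4 := fmul_rsym_add_drsym (g - g')
  rw [← h2, ← h3, zero_add] at h4
  rw [isD_iff] at this
  have h5 : (𝓕 (g - g') : L2) = 0 := by
    apply Lp.ext
    have h0 : (𝓕 (0 : L2) : L2) = 0 := map_zero (Lp.fourierTransformₗᵢ ℝ ℂ)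
    rw [h0] at this
    filter_upwards [this, Lp.coeFn_zero ℂ 2 (volume : Measure ℝ)] with x hx h0
    rw [hx, h0]; simp
  exact sub_eq_zero.1 ((Lp.fourierTransformₗᵢ ℝ ℂ).map_eq_zero_iff.1 h5)

theorem IsD.multiplier {f g : L2} (h : IsD f g) {m : ℝ → ℂ} (hm : MemLp m ∞ (volume : Measure ℝ)) :
    IsD (fmul m f) (fmul m g) := by
  unfold IsD at *
  rw [fmul_comm memLp_rsym hm, h, fmul_comm memLp_drsym hm]

theorem conj_dsym (ξ : ℝ) : (starRingEnd ℂ) (dsym (-ξ)) = dsym ξ := by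
  simp [dsym, Complex.conj_ofNat]

theorem IsD.conj {f g : L2} (h : IsD f g) : IsD (conjL2 f) (conjL2 g) := by
  have h1 : (fun x => (starRingEnd ℂ) (rsym (-x))) = rsym := by
    funext x; rw [rsym, map_inv₀, map_add, conj_dsym, map_one, rsym]
  have h2 : (fun x => (starRingEnd ℂ) (drsym (-x))) = drsym := by
    funext x; rw [drsym, map_mul, map_inv₀, map_add, conj_dsym, map_one, drsym]
  unfold IsD at *
  have e1 := conj_fmul memLp_rsym g
  have e2 := conj_fmul memLp_drsym f
  rw [h1] at e1
  rw [h2] at e2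
  rw [← e1, ← e2, h]

/-- Integration by parts in `L²`. -/
theorem IsD.pairing_eq {f f' g g' : L2} (hf : IsD f f') (hg : IsD g g') :
    pairing f' g = -pairing f g' := by
  have hr := memLp_top_comp_neg memLp_rsym
  have hd := memLp_top_comp_neg memLp_drsym
  -- For pairs parametrized by L² elements, integration by parts is the oddness of the symbol 2πiξ.
  have key : ∀ h k : L2, pairing (fmul drsym h) (fmul rsym k) =
      -pairing (fmul rsym h) (fmul drsym k) := fun h k => by
    rw [pairing_fmul memLp_drsym, pairing_fmul memLp_rsym, ← map_neg, fmul_fmul hd memLp_rsym,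
      fmul_fmul hr memLp_drsym, ← neg_one_smul ℂ (fmul _ k), ← fmul_const, fmul_fmul]
    · congr 3
      funext x
      have h0 := one_add_dsym_ne_zero x
      have h1 := one_add_dsym_ne_zero (-x)
      have h2 : dsym (-x) = - dsym x := by simp [dsym]
      rw [h2] at h1
      simp only [drsym, rsym, h2]
      field_simp
    · exact memLp_top_of_continuous continuous_const (fun _ => le_rfl)
    · exact memLp_drsym.mul hr
  have := key (f + f') (g + g')
  rwa [← hf.eq_left, ← hf.eq_right, ← hg.eq_left, ← hg.eq_right] at this

theorem isD_schwartz (ψ : SchwartzMap ℝ ℂ) :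
    IsD (ψ.toLp 2 volume) ((SchwartzMap.derivCLM ℂ ℂ ψ).toLp 2 volume) := by
  rw [isD_iff, SchwartzMap.toLp_fourier_eq, SchwartzMap.toLp_fourier_eq]
  filter_upwards [SchwartzMap.coeFn_toLp (𝓕 ψ) 2 volume,
    SchwartzMap.coeFn_toLp (𝓕 (SchwartzMap.derivCLM ℂ ℂ ψ)) 2 volume] with ξ h1 h2
  rw [h1, h2, SchwartzMap.fourier_coe, SchwartzMap.fourier_coe]
  have h3 : (SchwartzMap.derivCLM ℂ ℂ ψ : ℝ → ℂ) = deriv ψ := by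
    funext x; exact SchwartzMap.derivCLM_apply ℂ ψ x
  rw [h3, Real.fourier_deriv ψ.integrable ψ.differentiable]
  · simp [dsym]; left; ring
  · rw [← h3]; exact (SchwartzMap.derivCLM ℂ ℂ ψ).integrable

/-- The graph of the derivative on compactly supported smooth functions. -/
def testGraph : Set (L2 × L2) :=
  {p | ∃ φ : SchwartzMap ℝ ℂ, HasCompactSupport φ ∧
    p = (φ.toLp 2 volume, (SchwartzMap.derivCLM ℂ ℂ φ).toLp 2 volume)}

/-- Cut off with a bump function of x/(n+1). The derivative of the cut-off has size O(1/n), so the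
extra term in the product rule disappears in the limit. -/
theorem schwartz_mem_closure_testGraph (ψ : SchwartzMap ℝ ℂ) :
    ((ψ.toLp 2 volume : L2), ((SchwartzMap.derivCLM ℂ ℂ ψ).toLp 2 volume : L2)) ∈
      closure testGraph := by
  let b : ContDiffBump (0 : ℝ) := ⟨1, 2, one_pos, one_lt_two⟩
  have hbs : ContDiff ℝ ∞ b := b.contDiff
  have hbc : HasCompactSupport b := b.hasCompactSupport
  obtain ⟨D, hD⟩ : ∃ D, ∀ x, ‖deriv (b : ℝ → ℝ) x‖ ≤ D := by
    have hc : Continuous (deriv (b : ℝ → ℝ)) := hbs.continuous_deriv (by simp)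
    exact hc.bounded_above_of_compact_support hbc.deriv |>.imp fun C h => h
  have hD0 : 0 ≤ D := (norm_nonneg _).trans (hD 0)
  let r : ℕ → ℝ := fun n => ((n : ℝ) + 1)⁻¹
  have hr0 : ∀ n, 0 < r n := fun n => by positivity
  have hr1 : ∀ n, r n ≤ 1 := fun n => inv_le_one_of_one_le₀ (by simp)
  have hrt : Tendsto r atTop (𝓝 0) := tendsto_inv_atTop_zero.comp
    (tendsto_atTop_add_const_right _ _ tendsto_natCast_atTop_atTop)
  let c : ℕ → ℝ → ℂ := fun n x => (b (r n * x) : ℂ)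
  let c' : ℕ → ℝ → ℂ := fun n x => (r n : ℂ) * ((deriv (b : ℝ → ℝ) (r n * x) : ℝ) : ℂ)
  have hcd : ∀ n x, HasDerivAt (c n) (c' n x) x := fun n x => by
    have h1 : HasDerivAt b (deriv (b : ℝ → ℝ) (r n * x)) (r n * x) :=
      ((hbs.differentiable (by simp)) _).hasDerivAt
    have h2 : HasDerivAt (fun y => r n * y) (r n) x := by
      simpa using (hasDerivAt_id x).const_mul (r n)
    have h3 := (h1.comp x h2).ofReal_comp
    have e : c' n x = ((deriv (b : ℝ → ℝ) (r n * x) * r n : ℝ) : ℂ) := by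
      simp only [c']; push_cast; ring
    rw [e]
    exact h3
  have hcs : ∀ n, ContDiff ℝ ∞ (c n) := fun n =>
    Complex.ofRealCLM.contDiff.comp (hbs.comp (contDiff_const.mul contDiff_id))
  have hcc : ∀ n, HasCompactSupport (fun x => c n x * ψ x) := fun n => by
    have h1 : HasCompactSupport (c n) := by
      have := hbc.comp_homeomorph (Homeomorph.mulLeft₀ (r n) (hr0 n).ne')
      exact this.comp_left (g := fun y : ℝ => (y : ℂ)) (by simp)
    exact h1.mul_right
  have hsm : ∀ n, ContDiff ℝ ∞ (fun x => c n x * ψ x) := fun n => (hcs n).mul (ψ.smooth _)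
  let φ : ℕ → SchwartzMap ℝ ℂ := fun n => (hcc n).toSchwartzMap (hsm n)
  have hφ : ∀ n x, φ n x = c n x * ψ x := fun n x => rfl
  have hc1 : ∀ n x, ‖c n x‖ ≤ 1 := fun n x => by
    simp only [c, Complex.norm_real, Real.norm_eq_abs, abs_of_nonneg b.nonneg]
    exact b.le_one
  have hc'1 : ∀ n x, ‖c' n x‖ ≤ D := fun n x => by
    simp only [c', norm_mul, Complex.norm_real, Real.norm_eq_abs, abs_of_pos (hr0 n)]
    calc r n * |deriv (b : ℝ → ℝ) (r n * x)| ≤ 1 * D := by gcongr; exacts [hr1 n, hD _]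
      _ = D := one_mul _
  have hcn : ∀ n, Continuous (c n) := fun n => (hcs n).continuous
  have hc'n : ∀ n, Continuous (c' n) := fun n => by
    have : Continuous (deriv (b : ℝ → ℝ)) := hbs.continuous_deriv (by simp)
    exact continuous_const.mul (Complex.continuous_ofReal.comp
      (this.comp (continuous_const.mul continuous_id)))
  have hlin : ∀ x : ℝ, Tendsto (fun n => r n * x) atTop (𝓝 0) := fun x => by
    simpa using hrt.mul_const x
  have ht1 : ∀ f : L2, Tendsto (fun n => bmul (c n) f) atTop (𝓝 f) := fun f => by
    have := tendsto_bmul (l := atTop) (m := c) (n := fun _ => 1) (C := 1)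
      (fun n => (hcn n).aestronglyMeasurable) aestronglyMeasurable_const
      (Eventually.of_forall hc1) (by simp) (fun x => ?_) f
    · rwa [bmul_const, one_smul] at this
    · have h1 : b (0 : ℝ) = 1 := b.one_of_mem_closedBall (by simpa using b.rIn_pos.le)
      have h2 := (Complex.continuous_ofReal.comp b.continuous).tendsto (0 : ℝ) |>.comp (hlin x)
      simpa [Function.comp_def, c, h1] using h2
  have ht2 : ∀ f : L2, Tendsto (fun n => bmul (c' n) f) atTop (𝓝 0) := fun f => by
    have := tendsto_bmul (l := atTop) (m := c') (n := fun _ => 0) (C := D)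
      (fun n => (hc'n n).aestronglyMeasurable) aestronglyMeasurable_const
      (Eventually.of_forall hc'1) (by simpa using hD0) (fun x => ?_) f
    · rwa [bmul_const, zero_smul] at this
    · refine squeeze_zero_norm (a := fun n => r n * D) (fun n => ?_) (by simpa using hrt.mul_const D)
      simp only [c', norm_mul, Complex.norm_real, Real.norm_eq_abs, abs_of_pos (hr0 n)]
      exact mul_le_mul_of_nonneg_left (hD _) (hr0 n).le
  have e1 : ∀ n, ((φ n).toLp 2 volume : L2) = bmul (c n) (ψ.toLp 2 volume) := fun n => by
    apply Lp.ext
    filter_upwards [SchwartzMap.coeFn_toLp (φ n) 2 volume, SchwartzMap.coeFn_toLp ψ 2 volume,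
      coeFn_bmul (memLp_top_of_continuous (hcn n) (hc1 n)) (ψ.toLp 2 volume)] with x h1 h2 h3
    rw [h1, h3, h2, hφ]
  have e2 : ∀ n, ((SchwartzMap.derivCLM ℂ ℂ (φ n)).toLp 2 volume : L2) =
      bmul (c' n) (ψ.toLp 2 volume) +
        bmul (c n) ((SchwartzMap.derivCLM ℂ ℂ ψ).toLp 2 volume) := fun n => by
    apply Lp.ext
    filter_upwards [SchwartzMap.coeFn_toLp (SchwartzMap.derivCLM ℂ ℂ (φ n)) 2 volume,
      SchwartzMap.coeFn_toLp ψ 2 volume,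
      SchwartzMap.coeFn_toLp (SchwartzMap.derivCLM ℂ ℂ ψ) 2 volume,
      coeFn_bmul (memLp_top_of_continuous (hcn n) (hc1 n))
        ((SchwartzMap.derivCLM ℂ ℂ ψ).toLp 2 volume),
      coeFn_bmul (memLp_top_of_continuous (hc'n n) (hc'1 n)) (ψ.toLp 2 volume),
      Lp.coeFn_add (bmul (c' n) (ψ.toLp 2 volume))
        (bmul (c n) ((SchwartzMap.derivCLM ℂ ℂ ψ).toLp 2 volume))] with x h1 h2 h3 h4 h5 h6
    rw [h1, h6, Pi.add_apply, h4, h5, h2, h3, SchwartzMap.derivCLM_apply,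
      SchwartzMap.derivCLM_apply]
    exact ((hcd n x).mul (ψ.hasDerivAt x)).deriv
  refine mem_closure_of_tendsto (b := atTop)
    (f := fun n => (((φ n).toLp 2 volume : L2),
      ((SchwartzMap.derivCLM ℂ ℂ (φ n)).toLp 2 volume : L2))) ?_
    (Eventually.of_forall fun n => ⟨φ n, hcc n, rfl⟩)
  refine Tendsto.prodMk_nhds ?_ ?_
  · simp_rw [e1]; exact ht1 _
  · simp_rw [e2]
    simpa using (ht2 (ψ.toLp 2 volume)).add (ht1 ((SchwartzMap.derivCLM ℂ ℂ ψ).toLp 2 volume))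

theorem denseRange_test : DenseRange (fun h : {h : SchwartzMap ℝ ℂ // HasCompactSupport h} =>
    (h.1.toLp 2 volume : L2)) := by
  intro f
  refine (mem_closure_iff_nhds_basis Metric.nhds_basis_closedBall).2 fun ε hε => ?_
  obtain ⟨g, hg₁, hg₂, hg₃⟩ := MemLp.exist_eLpNorm_sub_le (by norm_num) (by norm_num)
    (Lp.memLp f) hε
  refine ⟨_, ⟨⟨hg₁.toSchwartzMap hg₂, hg₁⟩, rfl⟩, ?_⟩
  have : (f : ℝ → ℂ) - (((hg₁.toSchwartzMap hg₂).toLp 2 volume : L2) : ℝ → ℂ) =ᵐ[volume] (f : ℝ → ℂ) - g := by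
    filter_upwards [(hg₁.toSchwartzMap hg₂).coeFn_toLp 2 volume] with x hx
    rw [Pi.sub_apply, Pi.sub_apply, hx]; rfl
  rw [Metric.mem_closedBall', Lp.dist_def, eLpNorm_congr_ae this]
  exact ENNReal.toReal_le_of_le_ofReal hε.le hg₃

/-- Test functions are dense in `H¹`, in the sense of graphs. -/
theorem IsD.mem_closure_testGraph {f g : L2} (h : IsD f g) : (f, g) ∈ closure testGraph := by
  -- It is enough to treat a dense set of k. For k smooth with compact support, `rsym` times k is
  -- again such a function, so the first component is a Schwartz function and the cut-off argument
  -- applies.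
  suffices H : ∀ k : L2, (fmul rsym (𝓕⁻ k), fmul drsym (𝓕⁻ k)) ∈ closure testGraph by
    have := H (𝓕 (f + g))
    rw [fourierInv_fourier_eq, ← h.eq_left, ← h.eq_right] at this
    exact this
  intro k
  refine DenseRange.induction_on denseRange_test k (IsClosed.preimage ?_ isClosed_closure) ?_
  · exact ((fmul rsym).continuous.comp continuous_fourierInv_L2).prodMk
      ((fmul drsym).continuous.comp continuous_fourierInv_L2)
  rintro ⟨χ, hχ⟩
  have hs : ContDiff ℝ ∞ (fun x => rsym x * χ x) := by
    refine ContDiff.mul (ContDiff.inv ?_ one_add_dsym_ne_zero) (χ.smooth _)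
    unfold dsym
    have : ContDiff ℝ ∞ (fun x : ℝ => (x : ℂ)) := Complex.ofRealCLM.contDiff
    fun_prop
  have hc : HasCompactSupport (fun x => rsym x * χ x) := hχ.mul_left
  let η : SchwartzMap ℝ ℂ := hc.toSchwartzMap hs
  have e1 : fmul rsym (𝓕⁻ (χ.toLp 2 volume : L2)) = (𝓕⁻ η).toLp 2 volume := by
    rw [fmul_apply, fourier_fourierInv_eq, ← SchwartzMap.toLp_fourierInv_eq]
    congr 1
    apply Lp.ext
    filter_upwards [coeFn_bmul memLp_rsym (χ.toLp 2 volume), SchwartzMap.coeFn_toLp χ 2 volume,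
      SchwartzMap.coeFn_toLp η 2 volume] with x h1 h2 h3
    rw [h1, h2, h3]; rfl
  have e2 : fmul drsym (𝓕⁻ (χ.toLp 2 volume : L2)) =
      (SchwartzMap.derivCLM ℂ ℂ (𝓕⁻ η)).toLp 2 volume := by
    refine (isD_fmul_rsym _).unique_right ?_
    rw [e1]
    exact isD_schwartz _
  rw [e1, e2]
  exact schwartz_mem_closure_testGraph _

end ModifiedWave

/-! ### Comparison with weak derivatives, and the Sobolev embedding. -/

namespace ModifiedWave

theorem IsD.exists_seq_test {f g : L2} (h : IsD f g) : ∃ φ : ℕ → SchwartzMap ℝ ℂ,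
    (∀ n, HasCompactSupport (φ n)) ∧
    Tendsto (fun n => ((φ n).toLp 2 volume : L2)) atTop (𝓝 f) ∧
    Tendsto (fun n => ((SchwartzMap.derivCLM ℂ ℂ (φ n)).toLp 2 volume : L2)) atTop (𝓝 g) := by
  obtain ⟨p, hp, hlim⟩ := mem_closure_iff_seq_limit.1 h.mem_closure_testGraph
  choose φ hφc hφ using hp
  refine ⟨φ, hφc, ?_, ?_⟩
  · have := (continuous_fst.tendsto _).comp hlim
    refine this.congr fun n => ?_
    rw [Function.comp_apply, hφ]
  · have := (continuous_snd.tendsto _).comp hlim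
    refine this.congr fun n => ?_
    rw [Function.comp_apply, hφ]

theorem pairing_eq_of_test {f g : L2} (h : ∀ φ : SchwartzMap ℝ ℂ, HasCompactSupport φ →
    pairing ((SchwartzMap.derivCLM ℂ ℂ φ).toLp 2 volume) f = -pairing (φ.toLp 2 volume) g)
    {ψ ψ' : L2} (hψ : IsD ψ ψ') : pairing ψ' f = -pairing ψ g := by
  obtain ⟨φ, hφc, h1, h2⟩ := hψ.exists_seq_test
  have c1 := ((pairing.flip f).continuous.tendsto ψ').comp h2
  have c2 := (((pairing.flip g).continuous.tendsto ψ).comp h1).neg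
  exact tendsto_nhds_unique (c1.congr fun n => h (φ n) (hφc n)) c2

/-- The hypothesis passes from test functions to all of H¹ by density of graphs. Inserting arbitrary
elements `fmul rsym k` gives the relation for the reflected symbols; the factor (1 - 2πiξ)/(1 +
2πiξ), of modulus one, turns these back into the original symbols. -/
theorem isD_of_pairing_test {f g : L2} (h : ∀ φ : SchwartzMap ℝ ℂ, HasCompactSupport φ →
    pairing ((SchwartzMap.derivCLM ℂ ℂ φ).toLp 2 volume) f = -pairing (φ.toLp 2 volume) g) :
    IsD f g := by
  have h2 : fmul (fun x => drsym (-x)) f = fmul (fun x => -rsym (-x)) g := by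
    refine ext_pairing fun k => ?_
    have e : fmul (fun x => -rsym (-x)) g = -fmul (fun x => rsym (-x)) g := by
      have e1 : (fun x => -rsym (-x)) = fun x => (-1 : ℂ) * rsym (-x) := by funext x; ring
      rw [e1, ← fmul_fmul (memLp_top_of_continuous continuous_const (fun _ => le_rfl))
        (memLp_top_comp_neg memLp_rsym), fmul_const, neg_one_smul]
    rw [e, map_neg, ← pairing_fmul memLp_drsym, ← pairing_fmul memLp_rsym]
    exact pairing_eq_of_test h (isD_fmul_rsym _)
  have hm : MemLp (fun x => (1 + dsym (-x)) * rsym x) ∞ (volume : Measure ℝ) := by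
    refine memLp_top_of_continuous (C := 1) ?_ fun x => ?_
    · exact (continuous_const.add (continuous_dsym.comp continuous_neg)).mul continuous_rsym
    · rw [rsym, ← div_eq_mul_inv, norm_div]
      have := normSq_one_add_dsym x
      have h3 := normSq_one_add_dsym (-x)
      have h4 : ‖1 + dsym (-x)‖ = ‖1 + dsym x‖ := by
        rw [← sq_eq_sq₀ (norm_nonneg _) (norm_nonneg _), this, h3]; ring
      rw [h4]
      exact div_self_le_one _
  have h3 := congrArg (fmul fun x => (1 + dsym (-x)) * rsym x) h2
  rw [fmul_fmul hm (memLp_top_comp_neg memLp_drsym),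
    fmul_fmul (n := fun x => -rsym (-x)) hm (memLp_top_comp_neg memLp_rsym).neg] at h3
  have e1 : (fun x => (1 + dsym (-x)) * rsym x * drsym (-x)) = fun x => (-1 : ℂ) * drsym x := by
    funext x
    have h0 := one_add_dsym_ne_zero x
    have h1 := one_add_dsym_ne_zero (-x)
    have h2 : dsym (-x) = - dsym x := by simp [dsym]
    rw [h2] at h1 ⊢
    simp only [drsym, rsym, h2]
    field_simp
  have e2 : (fun x => (1 + dsym (-x)) * rsym x * -rsym (-x)) = fun x => (-1 : ℂ) * rsym x := by
    funext x
    have h1 := one_add_dsym_ne_zero (-x)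
    rw [rsym, rsym]
    field_simp
  have hc : MemLp (fun _ : ℝ => (-1 : ℂ)) ∞ (volume : Measure ℝ) :=
    memLp_top_of_continuous continuous_const (fun _ => le_rfl)
  rw [e1, e2, ← fmul_fmul hc memLp_drsym, ← fmul_fmul hc memLp_rsym, fmul_const, fmul_const,
    neg_one_smul, neg_one_smul, neg_inj] at h3
  exact h3.symm

theorem HasWeakDeriv.congr {k : ℕ} {f g f' g' : ℝ → ℂ} (h : HasWeakDeriv k f g)
    (hf : f =ᵐ[volume] f') (hg : g =ᵐ[volume] g') : HasWeakDeriv k f' g' where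
  left_locallyIntegrable := h.left_locallyIntegrable.congr hf
  right_locallyIntegrable := h.right_locallyIntegrable.congr hg
  integral_eq φ hφ hc := by
    have e1 : ∫ x, iteratedDeriv k φ x • f' x = ∫ x, iteratedDeriv k φ x • f x :=
      integral_congr_ae (by filter_upwards [hf] with x hx; rw [hx])
    have e2 : ∫ x, φ x • g' x = ∫ x, φ x • g x :=
      integral_congr_ae (by filter_upwards [hg] with x hx; rw [hx])
    rw [e1, e2, h.integral_eq φ hφ hc]

theorem locallyIntegrable_L2 (f : L2) : LocallyIntegrable f (volume : Measure ℝ) :=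
  (Lp.memLp f).locallyIntegrable (by norm_num)

/-- The complex Schwartz function of a real test function. -/
def ofTest (φ : ℝ → ℝ) (hφ : ContDiff ℝ ∞ φ) (hc : HasCompactSupport φ) : SchwartzMap ℝ ℂ :=
  (hc.comp_left (g := fun y : ℝ => (y : ℂ)) (by simp)).toSchwartzMap
    (Complex.ofRealCLM.contDiff.comp hφ)

theorem ofTest_apply {φ : ℝ → ℝ} (hφ : ContDiff ℝ ∞ φ) (hc : HasCompactSupport φ) (x : ℝ) :
    ofTest φ hφ hc x = (φ x : ℂ) := rfl

theorem contDiff_deriv {φ : ℝ → ℝ} (hφ : ContDiff ℝ ∞ φ) : ContDiff ℝ ∞ (deriv φ) :=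
  ((contDiff_succ_iff_deriv (n := ∞)).1 hφ).2.2

theorem derivCLM_ofTest {φ : ℝ → ℝ} (hφ : ContDiff ℝ ∞ φ) (hc : HasCompactSupport φ) :
    SchwartzMap.derivCLM ℂ ℂ (ofTest φ hφ hc) = ofTest (deriv φ) (contDiff_deriv hφ) hc.deriv := by
  ext x
  rw [SchwartzMap.derivCLM_apply, ofTest_apply]
  exact ((hφ.differentiable (by simp)) x).hasDerivAt.ofReal_comp.deriv

theorem pairing_ofTest {φ : ℝ → ℝ} (hφ : ContDiff ℝ ∞ φ) (hc : HasCompactSupport φ) (f : L2) :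
    pairing ((ofTest φ hφ hc).toLp 2 volume) f = ∫ x, φ x • f x := by
  rw [pairing_apply]
  refine integral_congr_ae ?_
  filter_upwards [SchwartzMap.coeFn_toLp (ofTest φ hφ hc) 2 volume] with x hx
  rw [hx, ofTest_apply, Complex.real_smul]

theorem IsD.hasWeakDeriv {f g : L2} (h : IsD f g) : HasWeakDeriv 1 f g where
  left_locallyIntegrable := locallyIntegrable_L2 f
  right_locallyIntegrable := locallyIntegrable_L2 g
  integral_eq φ hφ hc := by
    have h1 := (isD_schwartz (ofTest φ hφ hc)).pairing_eq h
    rw [derivCLM_ofTest, pairing_ofTest, pairing_ofTest] at h1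
    rw [iteratedDeriv_one, h1]; ring

theorem integrable_test_smul {φ : ℝ → ℝ} (hφ : Continuous φ) (hc : HasCompactSupport φ)
    {f : ℝ → ℂ} (hf : LocallyIntegrable f volume) : Integrable (fun x => φ x • f x) :=
  hf.integrable_smul_left_of_hasCompactSupport hφ hc

theorem HasWeakDeriv.isD {f g : L2} (h : HasWeakDeriv 1 f g) : IsD f g := by
  refine isD_of_pairing_test fun φ hφ => ?_
  have hre : ContDiff ℝ ∞ (fun x => (φ x).re) := Complex.reCLM.contDiff.comp (φ.smooth _)
  have him : ContDiff ℝ ∞ (fun x => (φ x).im) := Complex.imCLM.contDiff.comp (φ.smooth _)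
  have cre : HasCompactSupport (fun x => (φ x).re) := hφ.comp_left (g := Complex.re) rfl
  have cim : HasCompactSupport (fun x => (φ x).im) := hφ.comp_left (g := Complex.im) rfl
  have e : φ = ofTest _ hre cre + Complex.I • ofTest _ him cim := by
    ext x
    simp only [add_apply, smul_apply, ofTest_apply, smul_eq_mul]
    rw [mul_comm, Complex.re_add_im]
  have key : ∀ (ψ : ℝ → ℝ) (h1 : ContDiff ℝ ∞ ψ) (h2 : HasCompactSupport ψ),
      pairing ((SchwartzMap.derivCLM ℂ ℂ (ofTest ψ h1 h2)).toLp 2 volume) f =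
      -pairing ((ofTest ψ h1 h2).toLp 2 volume) g := fun ψ h1 h2 => by
    rw [derivCLM_ofTest, pairing_ofTest, pairing_ofTest, ← iteratedDeriv_one,
      h.integral_eq ψ h1 h2]
    ring
  have toLp_lin : ∀ a b : SchwartzMap ℝ ℂ, ((a + Complex.I • b).toLp 2 volume : L2) =
      a.toLp 2 volume + Complex.I • (b.toLp 2 volume : L2) := fun a b => by
    have := (SchwartzMap.toLpCLM ℂ ℂ 2 (volume : Measure ℝ)).map_add a (Complex.I • b)
    rw [map_smul] at this
    exact this
  rw [e, map_add, map_smul, toLp_lin, toLp_lin, map_add, map_add, map_smul, map_smul,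
    add_apply, add_apply, smul_apply,
    smul_apply, key, key, smul_neg, neg_add]

theorem HasWeakDeriv.succ {k : ℕ} {f g g' : ℝ → ℂ} (h : HasWeakDeriv k f g)
    (h' : HasWeakDeriv 1 g g') : HasWeakDeriv (k + 1) f g' where
  left_locallyIntegrable := h.left_locallyIntegrable
  right_locallyIntegrable := h'.right_locallyIntegrable
  integral_eq φ hφ hc := by
    have h1 := h'.integral_eq φ hφ hc
    rw [iteratedDeriv_one] at h1
    rw [iteratedDeriv_succ', h.integral_eq _ (contDiff_deriv hφ) hc.deriv, h1]
    ring

/-- Testing the derivative of order k against φ' is, up to sign, testing that of order k + 1 against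
φ. The derivatives of a function of W^{s,2} thus form a chain of first derivatives. -/
theorem HasWeakDeriv.of_succ {k : ℕ} {f g g' : ℝ → ℂ} (h : HasWeakDeriv k f g)
    (h' : HasWeakDeriv (k + 1) f g') : HasWeakDeriv 1 g g' where
  left_locallyIntegrable := h.right_locallyIntegrable
  right_locallyIntegrable := h'.right_locallyIntegrable
  integral_eq φ hφ hc := by
    have h1 := h'.integral_eq φ hφ hc
    rw [iteratedDeriv_succ', h.integral_eq _ (contDiff_deriv hφ) hc.deriv, pow_succ, mul_assoc] at h1
    have h2 := mul_left_cancel₀ (pow_ne_zero k (by norm_num)) h1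
    rw [iteratedDeriv_one, h2, pow_one]

theorem hasWeakDeriv_zero {f g : ℝ → ℂ} (hf : LocallyIntegrable f volume) (h : f =ᵐ[volume] g) :
    HasWeakDeriv 0 f g where
  left_locallyIntegrable := hf
  right_locallyIntegrable := hf.congr h
  integral_eq φ hφ hc := by
    rw [pow_zero, one_mul, iteratedDeriv_zero]
    refine integral_congr_ae ?_
    filter_upwards [h] with x hx
    rw [hx]

theorem HasWeakDeriv.ae_eq_of_zero {f g : ℝ → ℂ} (h : HasWeakDeriv 0 f g) : f =ᵐ[volume] g := by
  refine ae_eq_of_integral_contDiff_smul_eq h.left_locallyIntegrable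
    h.right_locallyIntegrable fun φ hφ hφc => ?_
  have := h.integral_eq φ hφ hφc
  rwa [pow_zero, one_mul, iteratedDeriv_zero] at this

/-- One-dimensional Sobolev embedding. -/
theorem IsD.ae_norm_le {f f' : L2} (h : IsD f f') :
    ∀ᵐ x ∂(volume : Measure ℝ), ‖f x‖ ≤ ‖f‖ + ‖f'‖ := by
  obtain ⟨φ, hφc, hl1, hl2⟩ := h.exists_seq_test
  have bound : ∀ n x, ‖φ n x‖ ≤ ‖((φ n).toLp 2 volume : L2)‖ +
      ‖((SchwartzMap.derivCLM ℂ ℂ (φ n)).toLp 2 volume : L2)‖ := fun n x => by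
    set ψ := φ n
    set ψ' := SchwartzMap.derivCLM ℂ ℂ ψ
    -- The square ψ², rather than |ψ|², keeps the derivative free of conjugates; it gives |ψ(x)|² ≤
    -- 2 ‖ψ‖ ‖ψ'‖, which is at most (‖ψ‖ + ‖ψ'‖)².
    have hd : ∀ y, HasDerivAt (fun y => ψ y * ψ y) (2 * (ψ y * ψ' y)) y := fun y => by
      have h1 := (ψ.hasDerivAt y).mul (ψ.hasDerivAt y)
      rw [← SchwartzMap.derivCLM_apply ℂ ψ] at h1
      have e : 2 * (ψ y * ψ' y) = ψ' y * ψ y + ψ y * ψ' y := by ring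
      rw [e]
      exact h1
    have hcs : HasCompactSupport (fun y => ψ y * ψ y) := (hφc n).mul_right
    have hsm : ContDiff ℝ 1 (fun y => ψ y * ψ y) := (ψ.smooth 1).mul (ψ.smooth 1)
    have e1 := hcs.integral_Iic_deriv_eq hsm x
    have e2 : ∫ y in Iic x, deriv (fun y => ψ y * ψ y) y = ∫ y in Iic x, 2 * (ψ y * ψ' y) := by
      simp_rw [fun y => (hd y).deriv]
    have hint : Integrable (fun y => ‖ψ y‖ * ‖ψ' y‖) :=
      MemLp.integrable_mul (p := 2) (q := 2) (ψ.memLp 2 volume).norm (ψ'.memLp 2 volume).norm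
    have hCS : ∫ y, ‖ψ y‖ * ‖ψ' y‖ ≤ ‖(ψ.toLp 2 volume : L2)‖ * ‖(ψ'.toLp 2 volume : L2)‖ := by
      have h := integral_mul_norm_le_Lp_mul_Lq (p := 2) (q := 2) (μ := (volume : Measure ℝ))
        (f := ψ) (g := ψ') Real.HolderConjugate.two_two
        (by simpa using ψ.memLp 2 volume) (by simpa using ψ'.memLp 2 volume)
      rw [SchwartzMap.norm_toLp' (by norm_num) (by norm_num),
        SchwartzMap.norm_toLp' (by norm_num) (by norm_num)]
      simpa using h
    have h3 : ‖ψ x‖ ^ 2 ≤ 2 * (‖(ψ.toLp 2 volume : L2)‖ * ‖(ψ'.toLp 2 volume : L2)‖) := by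
      rw [pow_two, ← norm_mul, ← e1, e2]
      calc ‖∫ y in Iic x, 2 * (ψ y * ψ' y)‖ ≤ ∫ y in Iic x, ‖2 * (ψ y * ψ' y)‖ :=
            norm_integral_le_integral_norm _
        _ = 2 * ∫ y in Iic x, ‖ψ y‖ * ‖ψ' y‖ := by
            rw [← integral_const_mul]; simp
        _ ≤ 2 * ∫ y, ‖ψ y‖ * ‖ψ' y‖ := by
            refine mul_le_mul_of_nonneg_left ?_ zero_le_two
            exact setIntegral_le_integral hint (Eventually.of_forall fun y => by positivity)
        _ ≤ _ := by gcongr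
    refine abs_le_of_sq_le_sq' ?_ (by positivity) |>.2
    nlinarith [norm_nonneg (ψ.toLp 2 volume : L2), norm_nonneg (ψ'.toLp 2 volume : L2),
      sq_nonneg ‖(ψ.toLp 2 volume : L2)‖, sq_nonneg ‖(ψ'.toLp 2 volume : L2)‖]
  -- Convergence in L² gives convergence almost everywhere along a subsequence, so the pointwise
  -- bound survives the limit.
  obtain ⟨ns, hmono, hns⟩ := (tendstoInMeasure_of_tendsto_Lp hl1).exists_seq_tendsto_ae
  have hnt : Tendsto ns atTop atTop := hmono.tendsto_atTop
  have hall : ∀ᵐ x ∂(volume : Measure ℝ), ∀ n, ((φ n).toLp 2 volume : L2) x = φ n x :=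
    ae_all_iff.2 fun n => SchwartzMap.coeFn_toLp (φ n) 2 volume
  filter_upwards [hns, hall] with x hx hx2
  refine le_of_tendsto_of_tendsto hx.norm
    (((hl1.comp hnt).norm).add ((hl2.comp hnt).norm)) (Eventually.of_forall fun n => ?_)
  simp only [Function.comp_apply]
  rw [hx2]
  exact bound _ _

end ModifiedWave

/-! ### Pointwise products in L² and the product rule. -/

namespace ModifiedWave

open Classical in
/-- The class of a square integrable function (and `0` for other functions). -/
def classL2 (f : ℝ → ℂ) : L2 := if h : MemLp f 2 (volume : Measure ℝ) then h.toLp f else 0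

theorem coeFn_classL2 {f : ℝ → ℂ} (h : MemLp f 2 (volume : Measure ℝ)) :
    classL2 f =ᵐ[volume] f := by
  rw [classL2, dif_pos h]; exact h.coeFn_toLp

/-- The pointwise product of two `L²` functions, when it lies in `L²` (and `0` otherwise). -/
def mulL2 (f g : L2) : L2 := classL2 fun x => f x * g x

theorem mulL2_comm (f g : L2) : mulL2 f g = mulL2 g f := by
  unfold mulL2
  simp only [mul_comm]

/-- `f` is bounded by `C` almost everywhere. -/
def AEBdd (C : ℝ) (f : L2) : Prop := ∀ᵐ x ∂(volume : Measure ℝ), ‖f x‖ ≤ C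

theorem AEBdd.memLp {C : ℝ} {f : L2} (h : AEBdd C f) : MemLp f ∞ (volume : Measure ℝ) :=
  memLp_top_of_bound (Lp.aestronglyMeasurable f) C h

theorem AEBdd.mono {C D : ℝ} {f : L2} (h : AEBdd C f) (hCD : C ≤ D) : AEBdd D f :=
  Eventually.mono h fun _ hx => hx.trans hCD

theorem AEBdd.smul {C : ℝ} {f : L2} (h : AEBdd C f) (c : ℂ) : AEBdd (‖c‖ * C) (c • f) := by
  filter_upwards [h, Lp.coeFn_smul c f] with x h1 h2
  rw [h2, Pi.smul_apply, norm_smul]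
  gcongr

theorem AEBdd.conj {C : ℝ} {f : L2} (h : AEBdd C f) : AEBdd C (conjL2 f) := by
  filter_upwards [h, coeFn_conjL2 f] with x h1 h2
  rwa [h2, RCLike.norm_conj]

theorem AEBdd.mulL2_eq {C : ℝ} {f : L2} (h : AEBdd C f) (g : L2) : mulL2 f g = bmul f g := by
  have hm : MemLp (fun x => f x * g x) 2 (volume : Measure ℝ) := (Lp.memLp g).mul h.memLp
  apply Lp.ext
  filter_upwards [coeFn_classL2 hm, coeFn_bmul h.memLp g] with x h1 h2
  rw [mulL2, h1, h2]

theorem AEBdd.coeFn_mulL2 {C : ℝ} {f : L2} (h : AEBdd C f) (g : L2) :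
    mulL2 f g =ᵐ[volume] fun x => f x * g x := by
  rw [h.mulL2_eq]; exact coeFn_bmul h.memLp g

theorem AEBdd.norm_mulL2_le {C : ℝ} {f : L2} (h : AEBdd C f) (hC : 0 ≤ C) (g : L2) :
    ‖mulL2 f g‖ ≤ C * ‖g‖ := by
  rw [h.mulL2_eq]; exact norm_bmul_le hC h g

theorem IsD.aebdd {f f' : L2} (h : IsD f f') : AEBdd (‖f‖ + ‖f'‖) f := h.ae_norm_le

/-- The product rule in `L²`. -/
theorem IsD.mulL2 {f f' g g' : L2} (hf : IsD f f') (hg : IsD g g') :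
    IsD (mulL2 f g) (mulL2 f' g + mulL2 f g') := by
  have bf := hf.aebdd
  have bg := hg.aebdd
  refine isD_of_pairing_test fun φ hφ => ?_
  set φ' := SchwartzMap.derivCLM ℂ ℂ φ
  have mφ : MemLp φ ∞ (volume : Measure ℝ) := φ.memLp_top volume
  have mφ' : MemLp φ' ∞ (volume : Measure ℝ) := φ'.memLp_top volume
  -- For f a test function, φf is again a test function and integration by parts against g applies.
  -- All terms are continuous in (f, f'), so approximation in the graph norm suffices.
  have key : pairing f (bmul φ' g) = -pairing f (bmul φ g') - pairing f' (bmul φ g) := by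
    obtain ⟨ψ, hψc, hl1, hl2⟩ := hf.exists_seq_test
    have c1 := ((pairing.flip (bmul φ' g)).continuous.tendsto _).comp hl1
    have c2 := (((pairing.flip (bmul φ g')).continuous.tendsto _).comp hl1).neg.sub
      (((pairing.flip (bmul φ g)).continuous.tendsto _).comp hl2)
    refine tendsto_nhds_unique (c1.congr fun n => ?_) c2
    simp only [Function.comp_apply, ContinuousLinearMap.flip_apply]
    set χ := ψ n
    set χ' := SchwartzMap.derivCLM ℂ ℂ χ
    let η : SchwartzMap ℝ ℂ := (hφ.mul_right (f' := χ)).toSchwartzMap ((φ.smooth _).mul (χ.smooth _))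
    have hη : ∀ x, η x = φ x * χ x := fun x => rfl
    have hη' : ∀ x, SchwartzMap.derivCLM ℂ ℂ η x = φ' x * χ x + φ x * χ' x := fun x => by
      rw [SchwartzMap.derivCLM_apply, SchwartzMap.derivCLM_apply, SchwartzMap.derivCLM_apply]
      exact ((φ.hasDerivAt x).mul (χ.hasDerivAt x)).deriv
    have h1 := (isD_schwartz η).pairing_eq hg
    have e1 : pairing (η.toLp 2 volume) g' = pairing (χ.toLp 2 volume) (bmul φ g') := by
      rw [pairing_apply, pairing_apply]
      refine integral_congr_ae ?_
      filter_upwards [SchwartzMap.coeFn_toLp η 2 volume, SchwartzMap.coeFn_toLp χ 2 volume,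
        coeFn_bmul mφ g'] with x h1 h2 h3
      rw [h1, h2, h3, hη]; ring
    have e2 : ((SchwartzMap.derivCLM ℂ ℂ η).toLp 2 volume : L2) =
        bmul φ' (χ.toLp 2 volume) + bmul φ (χ'.toLp 2 volume) := by
      apply Lp.ext
      filter_upwards [SchwartzMap.coeFn_toLp (SchwartzMap.derivCLM ℂ ℂ η) 2 volume,
        SchwartzMap.coeFn_toLp χ 2 volume, SchwartzMap.coeFn_toLp χ' 2 volume,
        coeFn_bmul mφ' (χ.toLp 2 volume), coeFn_bmul mφ (χ'.toLp 2 volume),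
        Lp.coeFn_add (bmul φ' (χ.toLp 2 volume)) (bmul φ (χ'.toLp 2 volume))]
        with x h1 h2 h3 h4 h5 h6
      rw [h1, h6, Pi.add_apply, h4, h5, h2, h3, hη']
    rw [e1, e2, map_add, add_apply, pairing_bmul mφ', pairing_bmul mφ] at h1
    rw [← h1]; ring
  have a1 : pairing (φ'.toLp 2 volume) (ModifiedWave.mulL2 f g) = pairing f (bmul φ' g) := by
    rw [pairing_apply, pairing_apply]
    refine integral_congr_ae ?_
    filter_upwards [SchwartzMap.coeFn_toLp φ' 2 volume, bf.coeFn_mulL2 g, coeFn_bmul mφ' g]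
      with x h1 h2 h3
    rw [h1, h2, h3]; ring
  have a2 : pairing (φ.toLp 2 volume) (ModifiedWave.mulL2 f g') = pairing f (bmul φ g') := by
    rw [pairing_apply, pairing_apply]
    refine integral_congr_ae ?_
    filter_upwards [SchwartzMap.coeFn_toLp φ 2 volume, bf.coeFn_mulL2 g', coeFn_bmul mφ g']
      with x h1 h2 h3
    rw [h1, h2, h3]; ring
  have a3 : pairing (φ.toLp 2 volume) (ModifiedWave.mulL2 f' g) = pairing f' (bmul φ g) := by
    rw [pairing_apply, pairing_apply, mulL2_comm]
    refine integral_congr_ae ?_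
    filter_upwards [SchwartzMap.coeFn_toLp φ 2 volume, bg.coeFn_mulL2 f', coeFn_bmul mφ g]
      with x h1 h2 h3
    rw [h1, h2, h3]; ring
  rw [a1, map_add, a2, a3, key]; ring

/-- The product takes the value 0 when it leaves L², hence is additive only when some bounded factor
keeps every product in L²: either the common factor, or both summands. -/
theorem mulL2_add_right {C D : ℝ} {f g g' : L2} (h : AEBdd C f ∨ (AEBdd C g ∧ AEBdd D g')) :
    mulL2 f (g + g') = mulL2 f g + mulL2 f g' := by
  rcases h with h | ⟨h1, h2⟩
  · rw [h.mulL2_eq, h.mulL2_eq, h.mulL2_eq, map_add]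
  · have h3 : AEBdd (C + D) (g + g') := by
      filter_upwards [h1, h2, Lp.coeFn_add g g'] with x a b c
      rw [c]; exact (norm_add_le _ _).trans (add_le_add a b)
    apply Lp.ext
    rw [mulL2_comm f, mulL2_comm f, mulL2_comm f]
    filter_upwards [h1.coeFn_mulL2 f, h2.coeFn_mulL2 f, h3.coeFn_mulL2 f, Lp.coeFn_add g g',
      Lp.coeFn_add (mulL2 g f) (mulL2 g' f)] with x a b c d e
    rw [c, d, e, Pi.add_apply, Pi.add_apply, a, b]; ring

theorem mulL2_smul_right {C : ℝ} {f g : L2} (c : ℂ) (h : AEBdd C f ∨ AEBdd C g) :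
    mulL2 f (c • g) = c • mulL2 f g := by
  rcases h with h | h
  · rw [h.mulL2_eq, h.mulL2_eq, map_smul]
  · apply Lp.ext
    rw [mulL2_comm f, mulL2_comm f]
    filter_upwards [h.coeFn_mulL2 f, (h.smul c).coeFn_mulL2 f, Lp.coeFn_smul c g,
      Lp.coeFn_smul c (mulL2 g f)] with x a b d e
    rw [b, e, d, Pi.smul_apply, Pi.smul_apply, a, smul_eq_mul, smul_eq_mul, mul_assoc]

theorem conj_mulL2 {C : ℝ} {f : L2} (h : AEBdd C f) (g : L2) :
    conjL2 (mulL2 f g) = mulL2 (conjL2 f) (conjL2 g) := by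
  apply Lp.ext
  filter_upwards [h.coeFn_mulL2 g, h.conj.coeFn_mulL2 (conjL2 g), coeFn_conjL2 f, coeFn_conjL2 g,
    coeFn_conjL2 (mulL2 f g)] with x h1 h2 h3 h4 h5
  rw [h5, h1, h2, h3, h4, map_mul]

end ModifiedWave

/-! ### The space H^s, s ≥ 1, as an algebra. -/

namespace ModifiedWave

/-- The chains `(f, f', …, f^(s))` of weak derivatives in `L²`. -/
def derivChains (s : ℕ) : Submodule ℂ (Fin (s + 1) → L2) where
  carrier := {f | ∀ k : Fin s, IsD (f k.castSucc) (f k.succ)}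
  add_mem' hf hg k := (hf k).add (hg k)
  zero_mem' _ := IsD.zero
  smul_mem' c _ hf k := (hf k).smul c

theorem isClosed_derivChains (s : ℕ) : IsClosed (derivChains s : Set (Fin (s + 1) → L2)) := by
  have : (derivChains s : Set (Fin (s + 1) → L2)) =
      ⋂ k : Fin s, {f | IsD (f k.castSucc) (f k.succ)} := by
    ext f; simp [derivChains]
  rw [this]
  refine isClosed_iInter fun k => ?_
  have hc : Continuous fun f : Fin (s + 1) → L2 => (f k.castSucc, f k.succ) := by fun_prop
  exact isClosed_isD.preimage hc

/-- The Sobolev space `H^s`, as the space of chains of weak derivatives, with the maximum norm. -/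
def Hs (s : ℕ) : Type := derivChains s

instance (s : ℕ) : NormedAddCommGroup (Hs s) := inferInstanceAs (NormedAddCommGroup (derivChains s))

instance (s : ℕ) : NormedSpace ℂ (Hs s) := inferInstanceAs (NormedSpace ℂ (derivChains s))

instance (s : ℕ) : CompleteSpace (Hs s) := (isClosed_derivChains s).completeSpace_coe

variable {s : ℕ}

/-- The chain of derivatives of an element of `H^s`. -/
def Hs.chain : Hs s →L[ℂ] (Fin (s + 1) → L2) := (derivChains s).subtypeL

theorem Hs.norm_chain (f : Hs s) : ‖Hs.chain f‖ = ‖f‖ := rfl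

/-- The `k`-th derivative of an element of `H^s`, `k ≤ s` (and `0` for larger `k`). -/
def comp (k : ℕ) : Hs s →L[ℂ] L2 :=
  if h : k < s + 1 then
    (ContinuousLinearMap.proj (R := ℂ) (φ := fun _ : Fin (s + 1) => L2) ⟨k, h⟩) ∘L Hs.chain
  else 0

theorem comp_of_lt {k : ℕ} (h : k < s + 1) (f : Hs s) : comp k f = Hs.chain f ⟨k, h⟩ := by
  rw [comp, dif_pos h]; rfl

theorem norm_comp_le (k : ℕ) (f : Hs s) : ‖comp k f‖ ≤ ‖f‖ := by
  by_cases h : k < s + 1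
  · rw [comp_of_lt h]; exact norm_le_pi_norm (Hs.chain f) _
  · rw [comp, dif_neg h]; simp

theorem Hs.norm_le {f : Hs s} {C : ℝ} (hC : 0 ≤ C) (h : ∀ k ≤ s, ‖comp k f‖ ≤ C) : ‖f‖ ≤ C := by
  rw [← Hs.norm_chain]
  refine (pi_norm_le_iff_of_nonneg hC).2 fun k => ?_
  have := h k (Nat.lt_succ_iff.1 k.2)
  rwa [comp_of_lt k.2] at this

theorem isD_comp {k : ℕ} (hk : k < s) (f : Hs s) : IsD (comp k f) (comp (k + 1) f) := by
  rw [comp_of_lt (by omega), comp_of_lt (by omega)]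
  exact f.2 ⟨k, hk⟩

theorem Hs.ext_comp {f g : Hs s} (h : ∀ k ≤ s, comp k f = comp k g) : f = g := by
  apply Subtype.ext
  funext k
  have := h k (Nat.lt_succ_iff.1 k.2)
  rwa [comp_of_lt k.2, comp_of_lt k.2] at this

/-- The derivative is unique, so the function determines its chain. Algebraic identities in H^s need
only be verified for the functions themselves. -/
theorem Hs.ext_zero {f g : Hs s} (h : comp 0 f = comp 0 g) : f = g := by
  refine Hs.ext_comp fun k hk => ?_
  induction k with
  | zero => exact h
  | succ k ih =>
    have h1 := isD_comp (k := k) (by omega) f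
    rw [ih (by omega)] at h1
    exact h1.unique_right (isD_comp (k := k) (by omega) g)

/-- The element of `H^s` of a chain of derivatives. -/
def Hs.mk (F : ℕ → L2) (h : ∀ k < s, IsD (F k) (F (k + 1))) : Hs s :=
  ⟨fun k => F k, fun k => h k k.2⟩

theorem comp_mk {F : ℕ → L2} (h : ∀ k < s, IsD (F k) (F (k + 1))) {k : ℕ} (hk : k ≤ s) :
    comp k (Hs.mk F h) = F k := by
  rw [comp_of_lt (by omega)]; rfl

/-- The action on `H^s` of an operator commuting with the derivative. -/
def Hs.map (T : L2 →L[ℝ] L2) (hT : ∀ f g, IsD f g → IsD (T f) (T g)) : Hs s →L[ℝ] Hs s :=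
  LinearMap.mkContinuous
    { toFun := fun f => Hs.mk (fun k => T (comp k f)) fun _ hk => hT _ _ (isD_comp hk f)
      map_add' := fun f g => Hs.ext_comp fun k hk => by
        rw [comp_mk _ hk, map_add, map_add, map_add, comp_mk _ hk, comp_mk _ hk]
      map_smul' := fun c f => Hs.ext_comp fun k hk => by
        rw [comp_mk _ hk, RingHom.id_apply, (comp k).map_smul_of_tower, (comp k).map_smul_of_tower,
          comp_mk _ hk, map_smul] } ‖T‖
    fun f => Hs.norm_le (by positivity) fun k hk => by
      rw [LinearMap.coe_mk, AddHom.coe_mk, comp_mk _ hk]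
      exact (T.le_opNorm _).trans (by gcongr; exact norm_comp_le k f)

theorem comp_map {T : L2 →L[ℝ] L2} (hT : ∀ f g, IsD f g → IsD (T f) (T g)) (k : ℕ) (f : Hs s) :
    comp k (Hs.map T hT f) = T (comp k f) := by
  by_cases hk : k ≤ s
  · exact comp_mk (F := fun k => T (comp k f)) (fun k hk => hT _ _ (isD_comp hk f)) hk
  · rw [comp, dif_neg (by omega)]; simp

theorem Hs.norm_map_le {T : L2 →L[ℝ] L2} (hT : ∀ f g, IsD f g → IsD (T f) (T g))
    (h : ∀ f, ‖T f‖ ≤ ‖f‖) (f : Hs s) : ‖Hs.map T hT f‖ ≤ ‖f‖ :=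
  Hs.norm_le (norm_nonneg _) fun k _ => by
    rw [comp_map]; exact (h _).trans (norm_comp_le k f)

/-- Complex conjugation on `H^s`. -/
def conjH : Hs s →L[ℝ] Hs s := Hs.map conjL2 fun _ _ h => h.conj

theorem comp_conjH (k : ℕ) (f : Hs s) : comp k (conjH f) = conjL2 (comp k f) := comp_map _ k f

theorem conjH_conjH (f : Hs s) : conjH (conjH f) = f :=
  Hs.ext_comp fun k _ => by rw [comp_conjH, comp_conjH, conjL2_conjL2]

theorem norm_conjH (f : Hs s) : ‖conjH f‖ = ‖f‖ := by
  refine le_antisymm (Hs.norm_map_le _ (fun f => (norm_conjL2 f).le) f) ?_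
  conv_lhs => rw [← conjH_conjH f]
  exact Hs.norm_map_le _ (fun f => (norm_conjL2 f).le) _

theorem conjH_smul (c : ℂ) (f : Hs s) : conjH (c • f) = (starRingEnd ℂ) c • conjH f :=
  Hs.ext_comp fun k _ => by
    rw [comp_conjH, (comp k).map_smul, (comp k).map_smul, comp_conjH, conjL2_smul]

theorem aebdd_comp {k : ℕ} (hk : k < s) (f : Hs s) : AEBdd (2 * ‖f‖) (comp k f) :=
  (isD_comp hk f).aebdd.mono (by linarith [norm_comp_le k f, norm_comp_le (k + 1) f])

/-- The Leibniz formula for the `k`-th derivative of a product. -/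
def leibniz (f g : Hs s) (k : ℕ) : L2 :=
  ∑ ij ∈ Finset.HasAntidiagonal.antidiagonal k, k.choose ij.1 • mulL2 (comp ij.1 f) (comp ij.2 g)

/-- The factor 2^k is the sum of the binomial coefficients. -/
theorem norm_leibniz_le {f g : Hs s} {k : ℕ} {C : ℝ}
    (h : ∀ i j, i + j = k → ‖mulL2 (comp i f) (comp j g)‖ ≤ C) :
    ‖leibniz f g k‖ ≤ 2 ^ k * C := by
  refine (norm_sum_le _ _).trans ?_
  have e : (2 : ℝ) ^ k * C = ∑ ij ∈ Finset.HasAntidiagonal.antidiagonal k, (k.choose ij.1 : ℝ) * C := by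
    rw [← Finset.sum_mul, Finset.Nat.sum_antidiagonal_eq_sum_range_succ_mk]
    congr 1
    exact_mod_cast (Nat.sum_range_choose k).symm
  rw [e]
  refine Finset.sum_le_sum fun ij hij => ?_
  rw [← Nat.cast_smul_eq_nsmul ℝ, norm_smul, Real.norm_natCast]
  gcongr
  exact h _ _ (Finset.HasAntidiagonal.mem_antidiagonal.1 hij)

theorem isD_nsmul {f g : L2} (n : ℕ) (h : IsD f g) : IsD (n • f) (n • g) := by
  rw [← Nat.cast_smul_eq_nsmul ℂ, ← Nat.cast_smul_eq_nsmul ℂ]; exact h.smul _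

theorem isD_sum {ι : Type*} (t : Finset ι) {f g : ι → L2} (h : ∀ i ∈ t, IsD (f i) (g i)) :
    IsD (∑ i ∈ t, f i) (∑ i ∈ t, g i) := by
  unfold IsD
  rw [map_sum, map_sum]
  exact Finset.sum_congr rfl h

theorem isD_leibniz (f g : Hs s) {k : ℕ} (hk : k < s) :
    IsD (leibniz f g k) (leibniz f g (k + 1)) := by
  have e : leibniz f g (k + 1) = ∑ ij ∈ Finset.HasAntidiagonal.antidiagonal k, k.choose ij.1 •
      (mulL2 (comp (ij.1 + 1) f) (comp ij.2 g) + mulL2 (comp ij.1 f) (comp (ij.2 + 1) g)) := by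
    rw [leibniz, Finset.sum_antidiagonal_choose_succ_nsmul
      (fun i j => mulL2 (comp i f) (comp j g)) k]
    simp only [nsmul_add, Finset.sum_add_distrib]
    rw [add_comm, add_left_inj]
    refine Finset.sum_congr rfl fun ij hij => ?_
    rw [Nat.choose_symm_of_eq_add (Finset.HasAntidiagonal.mem_antidiagonal.1 hij).symm]
  rw [e, leibniz]
  refine isD_sum _ fun ij hij => isD_nsmul _ ?_
  have := Finset.HasAntidiagonal.mem_antidiagonal.1 hij
  exact (isD_comp (by omega) f).mulL2 (isD_comp (by omega) g)

/-- Of two components of total order at most `s` one is bounded. -/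
theorem aebdd_or [NeZero s] {i j : ℕ} (hij : i + j ≤ s) (f g : Hs s) :
    AEBdd (2 * ‖f‖) (comp i f) ∨ AEBdd (2 * ‖g‖) (comp j g) := by
  have := NeZero.ne s
  by_cases hi : i < s
  · exact Or.inl (aebdd_comp hi f)
  · exact Or.inr (aebdd_comp (by omega) g)

theorem norm_mulL2_comp_le [NeZero s] {i j : ℕ} (hij : i + j ≤ s) (f g : Hs s) :
    ‖mulL2 (comp i f) (comp j g)‖ ≤ 2 * ‖f‖ * ‖g‖ := by
  rcases aebdd_or hij f g with h | h
  · refine (h.norm_mulL2_le (by positivity) _).trans ?_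
    gcongr; exact norm_comp_le j g
  · rw [mulL2_comm]
    refine (h.norm_mulL2_le (by positivity) _).trans ?_
    rw [mul_right_comm]
    gcongr; exact norm_comp_le i f

/-- The product of two elements of `H^s`. -/
def prodH (f g : Hs s) : Hs s := Hs.mk (leibniz f g) fun _ hk => isD_leibniz f g hk

theorem comp_prodH (f g : Hs s) {k : ℕ} (hk : k ≤ s) : comp k (prodH f g) = leibniz f g k :=
  comp_mk _ hk

theorem comp_zero_prodH (f g : Hs s) : comp 0 (prodH f g) = mulL2 (comp 0 f) (comp 0 g) := by
  rw [comp_prodH f g (Nat.zero_le s), leibniz]; simp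

theorem prodH_comm (f g : Hs s) : prodH f g = prodH g f :=
  Hs.ext_zero (by rw [comp_zero_prodH, comp_zero_prodH, mulL2_comm])

theorem norm_prodH_le [NeZero s] (f g : Hs s) : ‖prodH f g‖ ≤ 2 ^ (s + 1) * ‖f‖ * ‖g‖ := by
  refine Hs.norm_le (by positivity) fun k hk => ?_
  rw [comp_prodH f g hk]
  refine (norm_leibniz_le fun i j hij => norm_mulL2_comp_le (by omega) f g).trans ?_
  rw [pow_succ, mul_assoc, mul_assoc, mul_assoc]
  gcongr
  exact one_le_two

theorem prodH_add_right [NeZero s] (f g g' : Hs s) :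
    prodH f (g + g') = prodH f g + prodH f g' := by
  refine Hs.ext_zero ?_
  have hs := NeZero.pos s
  rw [map_add, comp_zero_prodH, comp_zero_prodH, comp_zero_prodH, map_add]
  exact mulL2_add_right (D := 0) (Or.inl (aebdd_comp hs f))

theorem prodH_smul_right [NeZero s] (c : ℂ) (f g : Hs s) :
    prodH f (c • g) = c • prodH f g := by
  refine Hs.ext_zero ?_
  have hs := NeZero.pos s
  rw [map_smul, comp_zero_prodH, comp_zero_prodH, map_smul]
  exact mulL2_smul_right c (Or.inl (aebdd_comp hs f))

/-- Multiplication on `H^s`, `s ≥ 1`, as a bounded bilinear map. -/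
def mulH [NeZero s] : Hs s →L[ℂ] Hs s →L[ℂ] Hs s :=
  LinearMap.mkContinuous₂
    (LinearMap.mk₂ ℂ prodH
      (fun f f' g => by rw [prodH_comm, prodH_add_right, prodH_comm g, prodH_comm g])
      (fun c f g => by rw [prodH_comm, prodH_smul_right, prodH_comm g])
      prodH_add_right (fun c f g => prodH_smul_right c f g)) (2 ^ (s + 1)) norm_prodH_le

theorem mulH_apply [NeZero s] (f g : Hs s) : mulH f g = prodH f g := rfl

theorem mulH_comm [NeZero s] (f g : Hs s) : mulH f g = mulH g f := prodH_comm f g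

theorem norm_mulH_le [NeZero s] (f g : Hs s) : ‖mulH f g‖ ≤ 2 ^ (s + 1) * ‖f‖ * ‖g‖ :=
  norm_prodH_le f g

theorem comp_zero_mulH [NeZero s] (f g : Hs s) :
    comp 0 (mulH f g) = mulL2 (comp 0 f) (comp 0 g) := comp_zero_prodH f g

theorem coeFn_mulH [NeZero s] (f g : Hs s) :
    comp 0 (mulH f g) =ᵐ[volume] fun x => comp 0 f x * comp 0 g x := by
  rw [comp_zero_mulH]
  exact (aebdd_comp (NeZero.pos s) f).coeFn_mulL2 _

theorem conjH_mulH [NeZero s] (f g : Hs s) : conjH (mulH f g) = mulH (conjH f) (conjH g) := by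
  refine Hs.ext_zero ?_
  rw [comp_conjH, comp_zero_mulH, comp_zero_mulH, comp_conjH, comp_conjH,
    conj_mulL2 (aebdd_comp (NeZero.pos s) f)]

/-- Multiplication by an element whose derivatives up to order `s` are all bounded by `ε`. -/
theorem norm_mulH_le_of_aebdd [NeZero s] {f : Hs s} {ε : ℝ} (hε : 0 ≤ ε)
    (h : ∀ k ≤ s, AEBdd ε (comp k f)) (g : Hs s) : ‖mulH f g‖ ≤ 2 ^ s * ε * ‖g‖ := by
  refine Hs.norm_le (by positivity) fun k hk => ?_
  rw [mulH_apply, comp_prodH f g hk, mul_assoc]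
  refine (norm_leibniz_le (C := ε * ‖g‖) fun i j hij => ?_).trans ?_
  · refine ((h i (by omega)).norm_mulL2_le hε _).trans ?_
    gcongr; exact norm_comp_le j g
  · gcongr
    exact one_le_two

end ModifiedWave

/-! ### The free Schrödinger group on L² and time derivatives in the interaction picture. -/

namespace ModifiedWave

/-- The symbol of the free Schrödinger evolution. -/
def esym (t ξ : ℝ) : ℂ := Complex.exp (-Complex.I * t * (2 * Real.pi * ξ) ^ 2)

theorem esym_eq (t ξ : ℝ) :
    esym t ξ = Complex.exp (Complex.I * ((-t * (2 * Real.pi * ξ) ^ 2 : ℝ) : ℂ)) := by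
  rw [esym]; congr 1; push_cast; ring

theorem norm_esym (t ξ : ℝ) : ‖esym t ξ‖ = 1 := by
  rw [esym_eq, Complex.norm_exp_I_mul_ofReal]

theorem continuous_esym (t : ℝ) : Continuous (esym t) := by unfold esym; fun_prop

theorem memLp_esym (t : ℝ) : MemLp (esym t) ∞ (volume : Measure ℝ) :=
  memLp_top_of_continuous (continuous_esym t) fun ξ => (norm_esym t ξ).le

/-- The free Schrödinger group on `L²`. -/
def schr (t : ℝ) : L2 →L[ℂ] L2 := fmul (esym t)

theorem schr_add (t r : ℝ) (f : L2) : schr (t + r) f = schr t (schr r f) := by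
  rw [schr, schr, schr, fmul_fmul (memLp_esym t) (memLp_esym r)]
  congr 2
  funext ξ
  rw [esym, esym, esym, ← Complex.exp_add]; congr 1; push_cast; ring

theorem schr_zero (f : L2) : schr 0 f = f := by
  have : esym 0 = fun _ => 1 := by funext ξ; simp [esym]
  rw [schr, this, fmul_const, one_smul]

theorem schr_neg_schr (t : ℝ) (f : L2) : schr (-t) (schr t f) = f := by
  rw [← schr_add, neg_add_cancel, schr_zero]

theorem schr_schr_neg (t : ℝ) (f : L2) : schr t (schr (-t) f) = f := by
  rw [← schr_add, add_neg_cancel, schr_zero]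

theorem norm_schr_le (t : ℝ) (f : L2) : ‖schr t f‖ ≤ ‖f‖ := by
  simpa [schr] using norm_fmul_le zero_le_one (fun ξ => (norm_esym t ξ).le) f

theorem norm_schr (t : ℝ) (f : L2) : ‖schr t f‖ = ‖f‖ := by
  refine le_antisymm (norm_schr_le t f) ?_
  conv_lhs => rw [← schr_neg_schr t f]
  exact norm_schr_le _ _

theorem continuous_schr_apply (f : L2) : Continuous fun t => schr t f := by
  rw [continuous_iff_continuousAt]
  intro t
  refine tendsto_fmul (C := 1) (fun i => (continuous_esym i).aestronglyMeasurable)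
    (continuous_esym t).aestronglyMeasurable (Eventually.of_forall fun i ξ => (norm_esym i ξ).le)
    (fun ξ => (norm_esym t ξ).le) (fun ξ => ?_) f
  have : Continuous fun τ => esym τ ξ := by unfold esym; fun_prop
  exact this.tendsto t

theorem IsD.schr {f g : L2} (h : IsD f g) (t : ℝ) : IsD (schr t f) (schr t g) :=
  h.multiplier (memLp_esym t)

theorem conj_schr (t : ℝ) (f : L2) : conjL2 (schr t f) = schr (-t) (conjL2 f) := by
  rw [schr, conj_fmul (memLp_esym t), schr]
  congr 2
  funext ξ
  rw [esym, esym, ← Complex.exp_conj]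
  congr 1
  simp [Complex.conj_ofNat]

theorem pairing_schr (t : ℝ) (f g : L2) : pairing (schr t f) g = pairing f (schr t g) := by
  rw [schr, pairing_fmul (memLp_esym t)]
  congr 3
  funext ξ
  rw [esym, esym]; congr 1; push_cast; ring

/-- Writing h ∈ H² as the squared resolvent multiplier applied to some k ∈ L², the difference
quotient becomes a multiplier acting on k. Its symbol is bounded by (2πξ)²|1 + 2πiξ|⁻² ≤ 1 uniformly
in τ and converges pointwise, so dominated convergence applies. -/
theorem hasDerivAt_schr_zero {h h₁ h₂ : L2} (h01 : IsD h h₁) (h12 : IsD h₁ h₂) :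
    HasDerivAt (fun t => schr t h) (Complex.I • h₂) 0 := by
  have hadd := h01.add h12
  set k := (h + h₁) + (h₁ + h₂)
  have e0 : h = fmul rsym (fmul rsym k) := by rw [← hadd.eq_left, ← h01.eq_left]
  have e2 : h₂ = fmul drsym (fmul drsym k) := by rw [← hadd.eq_right, ← h12.eq_right]
  have hrr : MemLp (fun x => rsym x * rsym x) ∞ (volume : Measure ℝ) := memLp_rsym.mul memLp_rsym
  have hdd : MemLp (fun x => drsym x * drsym x) ∞ (volume : Measure ℝ) :=
    memLp_drsym.mul memLp_drsym
  have hc : ∀ c : ℂ, MemLp (fun _ : ℝ => c) ∞ (volume : Measure ℝ) := fun c =>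
    memLp_top_of_continuous continuous_const (fun _ => le_rfl)
  rw [hasDerivAt_iff_tendsto_slope_zero]
  let m : ℝ → ℝ → ℂ := fun τ ξ => ((τ⁻¹ : ℝ) : ℂ) * (esym τ ξ + -1) * (rsym ξ * rsym ξ)
  have hsub : ∀ τ, MemLp (fun ξ => esym τ ξ + (-1 : ℂ)) ∞ (volume : Measure ℝ) := fun τ =>
    (memLp_esym τ).add (hc _)
  have hsub2 : ∀ τ : ℝ, MemLp (fun ξ => ((τ⁻¹ : ℝ) : ℂ) * (esym τ ξ + (-1 : ℂ))) ∞
      (volume : Measure ℝ) := fun τ => (hsub τ).const_mul _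
  have e : ∀ τ : ℝ, τ⁻¹ • (schr (0 + τ) h - schr 0 h) = fmul (m τ) k := fun τ => by
    rw [zero_add, schr_zero, ← fmul_fmul (hsub2 τ) hrr, ← fmul_fmul memLp_rsym memLp_rsym, ← e0,
      ← fmul_fmul (hc _) (hsub τ), fmul_const, fmul_add_left (memLp_esym τ) (hc _), fmul_const,
      neg_one_smul, ← sub_eq_add_neg, Complex.coe_smul]
    rfl
  have e' : Complex.I • h₂ = fmul (fun ξ => Complex.I * (drsym ξ * drsym ξ)) k := by
    rw [← fmul_fmul (hc _) hdd, fmul_const, ← fmul_fmul memLp_drsym memLp_drsym, ← e2]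
  simp_rw [e, e']
  have hsq : ∀ ξ, (((2 * Real.pi * ξ) ^ 2 : ℝ) : ℂ) = - (dsym ξ * dsym ξ) := fun ξ => by
    rw [dsym]; push_cast
    linear_combination (2 * Real.pi * ξ : ℂ) ^ 2 * Complex.I_mul_I
  have hbd : ∀ ξ, ‖(((2 * Real.pi * ξ) ^ 2 : ℝ) : ℂ) * (rsym ξ * rsym ξ)‖ ≤ 1 := fun ξ => by
    have : (((2 * Real.pi * ξ) ^ 2 : ℝ) : ℂ) * (rsym ξ * rsym ξ) = -(drsym ξ * drsym ξ) := by
      rw [hsq, drsym, rsym]; ring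
    rw [this, norm_neg, norm_mul]
    exact mul_le_one₀ (norm_drsym_le ξ) (norm_nonneg _) (norm_drsym_le ξ)
  refine tendsto_fmul (C := 1) (fun τ => ?_) ?_ ?_ ?_ (fun ξ => ?_) k
  · exact ((continuous_const.mul ((continuous_esym τ).add continuous_const)).mul
      (continuous_rsym.mul continuous_rsym)).aestronglyMeasurable
  · exact (continuous_const.mul (continuous_drsym.mul continuous_drsym)).aestronglyMeasurable
  · refine eventually_nhdsWithin_of_forall fun τ hτ ξ => ?_
    refine le_trans ?_ (hbd ξ)
    rw [norm_mul, norm_mul (((2 * Real.pi * ξ) ^ 2 : ℝ) : ℂ)]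
    refine mul_le_mul_of_nonneg_right ?_ (norm_nonneg _)
    rw [norm_mul, ← sub_eq_add_neg, esym_eq]
    have h1 := Real.norm_exp_I_mul_ofReal_sub_one_le (x := -τ * (2 * Real.pi * ξ) ^ 2)
    have hτ' : |τ| ≠ 0 := abs_ne_zero.2 hτ
    rw [Complex.norm_real, Complex.norm_real, norm_inv, Real.norm_eq_abs]
    calc |τ|⁻¹ * _ ≤ |τ|⁻¹ * ‖-τ * (2 * Real.pi * ξ) ^ 2‖ := by gcongr
      _ = ‖(2 * Real.pi * ξ) ^ 2‖ := by
        rw [norm_mul, norm_neg, Real.norm_eq_abs τ]; field_simp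
  · intro ξ
    rw [norm_mul, norm_mul, Complex.norm_I, one_mul]
    exact mul_le_one₀ (norm_drsym_le ξ) (norm_nonneg _) (norm_drsym_le ξ)
  · have hd : HasDerivAt (fun τ : ℝ => esym τ ξ) (-Complex.I * (2 * Real.pi * ξ) ^ 2) 0 := by
      have h1 : HasDerivAt (fun τ : ℝ => -Complex.I * (τ : ℂ) * (2 * Real.pi * ξ : ℂ) ^ 2)
          (-Complex.I * 1 * (2 * Real.pi * ξ) ^ 2) 0 :=
        ((HasDerivAt.ofReal_comp (hasDerivAt_id (0 : ℝ))).const_mul _).mul_const _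
      have h2 := h1.cexp
      simpa [esym] using h2
    have h1 := (hasDerivAt_iff_tendsto_slope_zero.1 hd).mul_const (rsym ξ * rsym ξ)
    have h2 : -Complex.I * (2 * Real.pi * ξ) ^ 2 * (rsym ξ * rsym ξ) =
        Complex.I * (drsym ξ * drsym ξ) := by
      have := hsq ξ
      push_cast at this
      rw [this, drsym, rsym]; ring
    rw [h2] at h1
    refine h1.congr fun τ => ?_
    have h0 : esym 0 ξ = 1 := by simp [esym]
    rw [zero_add, h0, Complex.real_smul, sub_eq_add_neg]

theorem hasDerivAt_schr {h h₁ h₂ : L2} (h01 : IsD h h₁) (h12 : IsD h₁ h₂) (t : ℝ) :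
    HasDerivAt (fun τ => schr τ h) (Complex.I • schr t h₂) t := by
  have h1 : HasDerivAt (fun τ : ℝ => schr (τ - t) h) (Complex.I • h₂) t := by
    have h0 := hasDerivAt_schr_zero h01 h12
    rw [← sub_self t] at h0
    exact HasDerivAt.comp_sub_const t t h0
  have h2 := ((schr t).restrictScalars ℝ).hasFDerivAt.comp_hasDerivAt t h1
  rw [ContinuousLinearMap.coe_restrictScalars', map_smul] at h2
  refine h2.congr_of_eventuallyEq (Eventually.of_forall fun τ => ?_)
  simp only [Function.comp_apply]
  rw [← schr_add]; congr 2; ring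

/-- Product rule for a strongly differentiable family of operators. -/
theorem hasDerivAt_family {X Y : Type*} [NormedAddCommGroup X] [NormedSpace ℝ X]
    [NormedAddCommGroup Y] [NormedSpace ℝ Y] {Φ : ℝ → X →L[ℝ] Y} {M : ℝ → X} {M' : X} {D : Y}
    {t C : ℝ} (hC : ∀ᶠ τ in 𝓝 t, ∀ x, ‖Φ τ x‖ ≤ C * ‖x‖)
    (hΦ : Tendsto (fun τ => Φ τ M') (𝓝 t) (𝓝 (Φ t M')))
    (hD : HasDerivAt (fun τ => Φ τ (M t)) D t) (hM : HasDerivAt M M' t) :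
    HasDerivAt (fun τ => Φ τ (M τ)) (Φ t M' + D) t := by
  -- Split Φ(τ)M(τ) into Φ(τ)(M(τ) - M(t)) and Φ(τ)M(t). A uniform bound on Φ near t and strong
  -- continuity on the vector M' alone control the first part; continuity in operator norm is not
  -- available for the group.
  have h1 : HasDerivAt (fun τ => Φ τ (M τ - M t)) (Φ t M') t := by
    rw [hasDerivAt_iff_tendsto_slope]
    have hs := hasDerivAt_iff_tendsto_slope.1 hM
    have hΦ' := hΦ.mono_left (nhdsWithin_le_nhds (s := {t}ᶜ))
    have hz : Tendsto (fun τ => Φ τ (slope M t τ - M')) (𝓝[≠] t) (𝓝 0) := by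
      have hb : Tendsto (fun τ => C * ‖slope M t τ - M'‖) (𝓝[≠] t) (𝓝 0) := by
        have := ((hs.sub_const M').norm.const_mul C)
        simpa using this
      refine squeeze_zero_norm' ?_ hb
      filter_upwards [hC.filter_mono nhdsWithin_le_nhds] with τ hτ
      exact hτ _
    have := hz.add hΦ'
    rw [zero_add] at this
    refine this.congr fun τ => ?_
    rw [← map_add, sub_add_cancel, slope_def_module, slope_def_module, map_smul, sub_self, map_zero,
      sub_zero]
  have h2 := h1.add hD
  refine h2.congr_of_eventuallyEq (Eventually.of_forall fun τ => ?_)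
  simp

theorem tendsto_schr {ι : Type*} {l : Filter ι} {τ : ι → ℝ} {t : ℝ} {x : ι → L2} {y : L2}
    (hτ : Tendsto τ l (𝓝 t)) (hx : Tendsto x l (𝓝 y)) :
    Tendsto (fun i => schr (τ i) (x i)) l (𝓝 (schr t y)) := by
  have h1 : Tendsto (fun i => schr (τ i) y) l (𝓝 (schr t y)) :=
    ((continuous_schr_apply y).tendsto t).comp hτ
  have h2 : Tendsto (fun i => schr (τ i) (x i - y)) l (𝓝 0) := by
    rw [tendsto_zero_iff_norm_tendsto_zero]
    simp_rw [norm_schr]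
    exact tendsto_iff_norm_sub_tendsto_zero.1 hx
  have := h2.add h1
  rw [zero_add] at this
  refine this.congr fun i => ?_
  rw [← map_add, sub_add_cancel]

theorem hasDerivAt_schr_neg_apply {M : ℝ → L2} {M' m₁ m₂ : L2} {t : ℝ} (hM : HasDerivAt M M' t)
    (h1 : IsD (M t) m₁) (h2 : IsD m₁ m₂) :
    HasDerivAt (fun τ => schr (-τ) (M τ)) (schr (-t) (M' - Complex.I • m₂)) t := by
  have hD : HasDerivAt (fun τ => schr (-τ) (M t)) (-(Complex.I • schr (-t) m₂)) t := by
    have := (hasDerivAt_schr h1 h2 (-t)).scomp t (hasDerivAt_neg t)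
    simpa [Function.comp_def] using this
  have := hasDerivAt_family (Φ := fun τ => (schr (-τ)).restrictScalars ℝ) (C := 1)
    (Eventually.of_forall fun τ x => by simp [norm_schr])
    (tendsto_schr (continuous_neg.tendsto t) tendsto_const_nhds) hD hM
  rw [map_sub, map_smul, sub_eq_add_neg]
  exact this

/-- Multiplication by A(τ) is regarded as a family of operators. Continuity of the spatial
derivative of A at t controls the sup norm of A(τ) - A(t) through the Sobolev embedding; B needs a
spatial derivative at the time t only. -/
theorem hasDerivAt_mulL2 {A A₁ B B₁ : ℝ → L2} {A' B' : L2} {t : ℝ} (hA : HasDerivAt A A' t)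
    (hB : HasDerivAt B B' t) (hA₁ : ∀ τ, IsD (A τ) (A₁ τ)) (hB₁ : IsD (B t) (B₁ t))
    (hc : ContinuousAt A₁ t) :
    HasDerivAt (fun τ => mulL2 (A τ) (B τ)) (mulL2 A' (B t) + mulL2 (A t) B') t := by
  have bA : ∀ τ, AEBdd (‖A τ‖ + ‖A₁ τ‖) (A τ) := fun τ => (hA₁ τ).aebdd
  have bB : AEBdd (‖B t‖ + ‖B₁ t‖) (B t) := hB₁.aebdd
  have hcA : ContinuousAt A t := hA.continuousAt
  have hlim : Tendsto (fun τ => ‖A τ‖ + ‖A₁ τ‖) (𝓝 t) (𝓝 (‖A t‖ + ‖A₁ t‖)) :=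
    hcA.norm.add hc.norm
  have hev : ∀ᶠ τ in 𝓝 t, ‖A τ‖ + ‖A₁ τ‖ ≤ ‖A t‖ + ‖A₁ t‖ + 1 :=
    hlim.eventually (eventually_le_nhds (by linarith))
  have hD : HasDerivAt (fun τ => bmul (A τ) (B t)) (mulL2 A' (B t)) t := by
    have h1 := ((bmul (B t)).restrictScalars ℝ).hasFDerivAt.comp_hasDerivAt t hA
    rw [ContinuousLinearMap.coe_restrictScalars', ← bB.mulL2_eq, mulL2_comm] at h1
    refine h1.congr_of_eventuallyEq (Eventually.of_forall fun τ => ?_)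
    simp only [Function.comp_apply]
    rw [← (bA τ).mulL2_eq, mulL2_comm, bB.mulL2_eq]
  have hΦ : Tendsto (fun τ => bmul (A τ) B') (𝓝 t) (𝓝 (bmul (A t) B')) := by
    rw [tendsto_iff_norm_sub_tendsto_zero]
    have hz : Tendsto (fun τ => (‖A τ - A t‖ + ‖A₁ τ - A₁ t‖) * ‖B'‖) (𝓝 t) (𝓝 0) := by
      have h1 := tendsto_iff_norm_sub_tendsto_zero.1 hcA
      have h2 := tendsto_iff_norm_sub_tendsto_zero.1 hc
      simpa using (h1.add h2).mul_const ‖B'‖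
    refine squeeze_zero (fun _ => norm_nonneg _) (fun τ => ?_) hz
    have hb : AEBdd (‖A τ - A t‖ + ‖A₁ τ - A₁ t‖) (A τ - A t) := ((hA₁ τ).sub (hA₁ t)).aebdd
    refine L2.norm_le_of_ae_le ?_
    filter_upwards [coeFn_bmul (bA τ).memLp B', coeFn_bmul (bA t).memLp B', hb,
      Lp.coeFn_sub (A τ) (A t), Lp.coeFn_sub (bmul (A τ) B') (bmul (A t) B')] with x h1 h2 h3 h4 h5
    rw [h5, Pi.sub_apply, h1, h2, ← sub_mul, norm_mul]
    rw [h4, Pi.sub_apply] at h3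
    gcongr
  have := hasDerivAt_family (Φ := fun τ => (bmul (A τ)).restrictScalars ℝ)
    (C := ‖A t‖ + ‖A₁ t‖ + 1) ?_ hΦ hD hB
  · rw [(bA t).mulL2_eq, add_comm]
    refine this.congr_of_eventuallyEq (Eventually.of_forall fun τ => ?_)
    exact (bA τ).mulL2_eq _
  · filter_upwards [hev] with τ hτ x
    exact norm_bmul_le (by positivity) ((bA τ).mono hτ) x

/-- The evolution of a product of two free waves, in the interaction picture. -/
theorem hasDerivAt_schr_neg_mulL2 {f f₁ f₂ g g₁ g₂ : L2} (hf : IsD f f₁) (hf₁ : IsD f₁ f₂)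
    (hg : IsD g g₁) (hg₁ : IsD g₁ g₂) (η t : ℝ) :
    HasDerivAt (fun τ => schr (-τ) (mulL2 (schr τ f) (schr (η * τ) g)))
      (-Complex.I • schr (-t) ((2 : ℂ) • mulL2 (schr t f₁) (schr (η * t) g₁) +
        (1 - η : ℂ) • mulL2 (schr t f) (schr (η * t) g₂))) t := by
  have hA := hasDerivAt_schr hf hf₁ t
  have hB : HasDerivAt (fun τ => schr (η * τ) g) (((η : ℂ) * Complex.I) • schr (η * t) g₂) t := by
    have h1 : HasDerivAt (fun τ : ℝ => η * τ) η t := by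
      simpa using (hasDerivAt_id t).const_mul η
    rw [mul_smul, Complex.coe_smul]
    exact (hasDerivAt_schr hg hg₁ (η * t)).scomp t h1
  have hM := hasDerivAt_mulL2 (A₁ := fun τ => schr τ f₁) (B₁ := fun τ => schr (η * τ) g₁) hA hB
    (fun τ => hf.schr τ) (hg.schr _) (continuous_schr_apply f₁).continuousAt
  have d1 := (hf.schr t).mulL2 (hg.schr (η * t))
  have d2 := ((hf₁.schr t).mulL2 (hg.schr (η * t))).add ((hf.schr t).mulL2 (hg₁.schr (η * t)))
  have key := hasDerivAt_schr_neg_apply hM d1 d2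
  -- The time derivative contributes i(f₂g + ηfg₂), and i∂_x² of the product contributes i(f₂g +
  -- 2f₁g₁ + fg₂). The terms with f₂ cancel. For η = 1 only f₁g₁ remains; for η = -1 the rest is the
  -- total derivative 2∂_x(fg₁).
  convert key using 1
  rw [← map_smul]
  congr 1
  have bB := (hg.schr (η * t)).aebdd
  have bA := (hf.schr t).aebdd
  rw [mulL2_comm (Complex.I • _), mulL2_smul_right _ (Or.inl bB), mulL2_comm _ (schr t f₂),
    mulL2_smul_right _ (Or.inl bA)]
  simp only [smul_add, smul_smul]
  module

end ModifiedWave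

/-! ### The free Schrödinger group on H^s. -/

namespace ModifiedWave

variable {s : ℕ}

theorem Hs.tendsto_iff {ι : Type*} {l : Filter ι} {F : ι → Hs s} {f : Hs s} :
    Tendsto F l (𝓝 f) ↔ ∀ k ≤ s, Tendsto (fun i => comp k (F i)) l (𝓝 (comp k f)) := by
  constructor
  · exact fun h k _ => ((comp k).continuous.tendsto f).comp h
  · intro h
    rw [tendsto_iff_norm_sub_tendsto_zero]
    have h1 : Tendsto (fun i => Hs.chain (F i)) l (𝓝 (Hs.chain f)) := by
      rw [tendsto_pi_nhds]
      intro k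
      have := h k (Nat.lt_succ_iff.1 k.2)
      rw [comp_of_lt k.2] at this
      refine this.congr fun i => ?_
      rw [comp_of_lt k.2]
    rw [tendsto_iff_norm_sub_tendsto_zero] at h1
    refine h1.congr fun i => ?_
    rw [← map_sub, Hs.norm_chain]

/-- The free Schrödinger group on `H^s`. -/
def schrH (t : ℝ) : Hs s →L[ℝ] Hs s :=
  Hs.map ((schr t).restrictScalars ℝ) fun _ _ h => h.schr t

theorem comp_schrH (t : ℝ) (k : ℕ) (f : Hs s) : comp k (schrH t f) = schr t (comp k f) :=
  comp_map _ k f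

theorem schrH_add (t r : ℝ) (f : Hs s) : schrH (t + r) f = schrH t (schrH r f) :=
  Hs.ext_comp fun k _ => by rw [comp_schrH, comp_schrH, comp_schrH, schr_add]

theorem schrH_zero (f : Hs s) : schrH 0 f = f :=
  Hs.ext_comp fun k _ => by rw [comp_schrH, schr_zero]

theorem schrH_neg_schrH (t : ℝ) (f : Hs s) : schrH (-t) (schrH t f) = f := by
  rw [← schrH_add, neg_add_cancel, schrH_zero]

theorem schrH_schrH_neg (t : ℝ) (f : Hs s) : schrH t (schrH (-t) f) = f := by
  rw [← schrH_add, add_neg_cancel, schrH_zero]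

theorem norm_schrH (t : ℝ) (f : Hs s) : ‖schrH t f‖ = ‖f‖ := by
  have h : ∀ t (f : Hs s), ‖schrH t f‖ ≤ ‖f‖ := fun t f =>
    Hs.norm_le (norm_nonneg _) fun k _ => by
      rw [comp_schrH, norm_schr]; exact norm_comp_le k f
  refine le_antisymm (h t f) ?_
  conv_lhs => rw [← schrH_neg_schrH t f]
  exact h _ _

theorem schrH_smul (t : ℝ) (c : ℂ) (f : Hs s) : schrH t (c • f) = c • schrH t f :=
  Hs.ext_comp fun k _ => by
    rw [comp_schrH, (comp k).map_smul, (comp k).map_smul, comp_schrH, map_smul]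

theorem conjH_schrH (t : ℝ) (f : Hs s) : conjH (schrH t f) = schrH (-t) (conjH f) :=
  Hs.ext_comp fun k _ => by rw [comp_conjH, comp_schrH, comp_schrH, comp_conjH, conj_schr]

theorem tendsto_schrH {ι : Type*} {l : Filter ι} {τ : ι → ℝ} {t : ℝ} {x : ι → Hs s} {y : Hs s}
    (hτ : Tendsto τ l (𝓝 t)) (hx : Tendsto x l (𝓝 y)) :
    Tendsto (fun i => schrH (τ i) (x i)) l (𝓝 (schrH t y)) := by
  rw [Hs.tendsto_iff] at hx ⊢
  intro k hk
  simp_rw [comp_schrH]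
  exact tendsto_schr hτ (hx k hk)

theorem continuous_schrH {X : Type*} [TopologicalSpace X] {τ : X → ℝ} {x : X → Hs s}
    (hτ : Continuous τ) (hx : Continuous x) : Continuous fun i => schrH (τ i) (x i) :=
  continuous_iff_continuousAt.2 fun i => tendsto_schrH (hτ.tendsto i) (hx.tendsto i)

theorem continuousOn_schrH {X : Type*} [TopologicalSpace X] {S : Set X} {τ : X → ℝ} {x : X → Hs s}
    (hτ : ContinuousOn τ S) (hx : ContinuousOn x S) : ContinuousOn (fun i => schrH (τ i) (x i)) S :=
  fun i hi => tendsto_schrH (hτ i hi) (hx i hi)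

end ModifiedWave

/-! ### Fourier integrals and the dispersive estimate. -/

namespace ModifiedWave

theorem integral_fourier_mul_eq {f g : ℝ → ℂ} (hf : Integrable f) (hg : Integrable g) :
    ∫ ξ, 𝓕 f ξ * g ξ = ∫ x, f x * 𝓕 g x := by
  simpa using! (VectorFourier.integral_fourierIntegral_smul_eq_flip (L := innerₗ ℝ)
    Real.continuous_fourierChar continuous_inner hf hg)

theorem continuous_fourier {f : ℝ → ℂ} (hf : Integrable f) : Continuous (𝓕 f) :=
  VectorFourier.fourierIntegral_continuous (L := innerₗ ℝ) Real.continuous_fourierChar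
    continuous_inner hf

theorem norm_fourier_le (f : ℝ → ℂ) (ξ : ℝ) : ‖𝓕 f ξ‖ ≤ ∫ x, ‖f x‖ :=
  VectorFourier.norm_fourierIntegral_le_integral_norm _ _ _ _ _

/-- The Plancherel transform and the Fourier integral satisfy the same duality with test functions,
hence agree almost everywhere. -/
theorem L2.fourier_ae_eq (f : L2) (hf : Integrable (f : ℝ → ℂ)) :
    (𝓕 f : L2) =ᵐ[volume] 𝓕 (f : ℝ → ℂ) := by
  refine ae_eq_of_integral_contDiff_smul_eq (locallyIntegrable_L2 _)
    (continuous_fourier hf).locallyIntegrable fun φ hφ hc => ?_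
  rw [← pairing_ofTest hφ hc, ← pairing_fourier, SchwartzMap.toLp_fourier_eq, pairing_apply]
  have h := integral_fourier_mul_eq hf (ofTest φ hφ hc).integrable
  calc _ = ∫ x, f x * 𝓕 (ofTest φ hφ hc : ℝ → ℂ) x := by
        refine integral_congr_ae ?_
        filter_upwards [SchwartzMap.coeFn_toLp (𝓕 (ofTest φ hφ hc)) 2 volume] with x h1
        rw [h1, SchwartzMap.fourier_coe, mul_comm]
    _ = _ := by
        rw [← h]
        refine integral_congr_ae (Eventually.of_forall fun x => ?_)
        simp only [ofTest_apply, Complex.real_smul]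
        rw [mul_comm]

theorem fourierInv_eq_fourier_neg' (f : ℝ → ℂ) (x : ℝ) : 𝓕⁻ f x = 𝓕 f (-x) := by
  rw [Real.fourierInv_eq_fourier_neg]

theorem L2.fourierInv_ae_eq (f : L2) (hf : Integrable (f : ℝ → ℂ)) :
    (𝓕⁻ f : L2) =ᵐ[volume] 𝓕⁻ (f : ℝ → ℂ) := by
  rw [fourierInv_eq_refl_fourier]
  filter_upwards [coeFn_reflL2 (𝓕 f), ae_neg (L2.fourier_ae_eq f hf)] with x h1 h2
  rw [h1, h2, fourierInv_eq_fourier_neg']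

theorem fourier_congr_ae {f g : ℝ → ℂ} (h : f =ᵐ[volume] g) : 𝓕 f = 𝓕 g := by
  funext ξ
  rw [Real.fourier_eq, Real.fourier_eq]
  exact integral_congr_ae (h.mono fun x hx => by simp only [hx])

theorem fourierInv_congr_ae {f g : ℝ → ℂ} (h : f =ᵐ[volume] g) : 𝓕⁻ f = 𝓕⁻ g := by
  funext ξ
  rw [fourierInv_eq_fourier_neg', fourierInv_eq_fourier_neg', fourier_congr_ae h]

theorem fourier_classL2 {f : ℝ → ℂ} (h1 : Integrable f) (h2 : MemLp f 2 (volume : Measure ℝ)) :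
    (𝓕 (classL2 f) : L2) =ᵐ[volume] 𝓕 f := by
  have h := coeFn_classL2 h2
  rw [← fourier_congr_ae h]
  exact L2.fourier_ae_eq _ (h1.congr h.symm)

theorem memLp_two_rsym : MemLp rsym 2 (volume : Measure ℝ) := by
  rw [memLp_two_iff_integrable_sq_norm continuous_rsym.aestronglyMeasurable]
  have h := integrable_inv_one_add_sq.comp_mul_left' (g := fun x : ℝ => (1 + x ^ 2)⁻¹)
    (R := 2 * Real.pi) (by positivity)
  refine h.congr (Eventually.of_forall fun ξ => ?_)
  simp only [rsym]
  rw [norm_inv, inv_pow, normSq_one_add_dsym]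

/-- The Fourier transform of a function of `H^1` is integrable. -/
theorem IsD.integrable_fourier {f g : L2} (h : IsD f g) : Integrable ((𝓕 f : L2) : ℝ → ℂ) := by
  have h1 := (Lp.memLp (𝓕 (f + g) : L2)).mul memLp_two_rsym (r := 1)
  rw [memLp_one_iff_integrable] at h1
  refine h1.congr ?_
  have e : (𝓕 f : L2) = bmul rsym (𝓕 (f + g)) := by
    conv_lhs => rw [h.eq_left, fourier_fmul]
  rw [e]
  filter_upwards [coeFn_bmul memLp_rsym (𝓕 (f + g))] with ξ h2
  rw [h2]; rfl

/-- One derivative in L² makes the multiplied transform integrable, so the inverse Fourier integral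
in the definition of the profile represents the L² group. -/
theorem freeSchrodinger_ae_eq {u : ℝ → ℂ} (h1 : Integrable u) (h2 : MemLp u 2 (volume : Measure ℝ))
    {u' : L2} (hu : IsD (classL2 u) u') (t : ℝ) :
    freeSchrodinger t u =ᵐ[volume] schr t (classL2 u) := by
  have hm : bmul (esym t) (𝓕 (classL2 u)) =ᵐ[volume]
      fun ξ : ℝ => Complex.exp (-Complex.I * t * (2 * Real.pi * ξ) ^ 2) * 𝓕 u ξ := by
    filter_upwards [coeFn_bmul (memLp_esym t) (𝓕 (classL2 u)), fourier_classL2 h1 h2] with ξ h3 h4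
    rw [h3, h4, esym]
  have hi : Integrable (bmul (esym t) (𝓕 (classL2 u)) : ℝ → ℂ) := by
    rw [← fourier_fmul]
    exact (hu.schr t).integrable_fourier
  rw [schr, fmul_apply, freeSchrodinger, ← fourierInv_congr_ae hm]
  exact (L2.fourierInv_ae_eq _ hi).symm

theorem AEBdd.of_tendsto {C : ℝ} {f : ℕ → L2} {g : L2} (h : ∀ n, AEBdd C (f n))
    (hf : Tendsto f atTop (𝓝 g)) : AEBdd C g := by
  obtain ⟨ns, -, hns⟩ := (tendstoInMeasure_of_tendsto_Lp hf).exists_seq_tendsto_ae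
  have hall : ∀ᵐ x ∂(volume : Measure ℝ), ∀ n, ‖f n x‖ ≤ C := ae_all_iff.2 h
  filter_upwards [hns, hall] with x h1 h2
  exact le_of_tendsto h1.norm (Eventually.of_forall fun n => h2 _)

/-- The Gaussian regularization of the symbol of the Schrödinger evolution. -/
def gsym (ε t ξ : ℝ) : ℂ := Complex.exp (-Real.pi * (4 * Real.pi * (ε + Complex.I * t)) * ξ ^ 2)

theorem gsym_eq (ε t ξ : ℝ) : gsym ε t ξ = Real.exp (-ε * (2 * Real.pi * ξ) ^ 2) * esym t ξ := by
  rw [gsym, esym, Complex.ofReal_exp, ← Complex.exp_add]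
  congr 1; push_cast; ring

theorem norm_gsym (ε t ξ : ℝ) : ‖gsym ε t ξ‖ = Real.exp (-ε * (2 * Real.pi * ξ) ^ 2) := by
  rw [gsym_eq, norm_mul, norm_esym, mul_one, Complex.norm_real, Real.norm_eq_abs, Real.abs_exp]

theorem continuous_gsym (ε t : ℝ) : Continuous (gsym ε t) := by unfold gsym; fun_prop

theorem norm_gsym_le {ε : ℝ} (hε : 0 ≤ ε) (t ξ : ℝ) : ‖gsym ε t ξ‖ ≤ 1 := by
  rw [norm_gsym, Real.exp_le_one_iff]
  nlinarith [mul_nonneg hε (sq_nonneg (2 * Real.pi * ξ))]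

theorem integrable_gsym {ε : ℝ} (hε : 0 < ε) (t : ℝ) : Integrable (gsym ε t) := by
  have h := integrable_exp_neg_mul_sq (b := ε * (2 * Real.pi) ^ 2) (by positivity)
  refine h.mono' (continuous_gsym ε t).aestronglyMeasurable (Eventually.of_forall fun ξ => ?_)
  rw [norm_gsym]
  apply le_of_eq; congr 1; ring

/-- With the regularization the convolution kernel is an explicit Gaussian with parameter b = 4π(ε +
it). Its exponential factor has modulus at most 1 because Re(1/b) ≥ 0, and |b| ≥ 4πt bounds the
prefactor by 1/√t, uniformly in ε. -/
theorem aebdd_fmul_gsym {ε t : ℝ} (hε : 0 < ε) (ht : 0 < t) {g : L2}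
    (hg : Integrable (g : ℝ → ℂ)) :
    AEBdd ((∫ x, ‖g x‖) / √t) (fmul (gsym ε t) g) := by
  have hmem : MemLp (gsym ε t) ∞ (volume : Measure ℝ) :=
    memLp_top_of_continuous (continuous_gsym ε t) (norm_gsym_le hε.le t)
  have hm : bmul (gsym ε t) (𝓕 g) =ᵐ[volume] fun ξ => gsym ε t ξ * 𝓕 (g : ℝ → ℂ) ξ := by
    filter_upwards [coeFn_bmul hmem (𝓕 g), L2.fourier_ae_eq g hg] with ξ h3 h4
    rw [h3, h4]
  have hi : Integrable (fun ξ => gsym ε t ξ * 𝓕 (g : ℝ → ℂ) ξ) :=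
    (integrable_gsym hε t).mul_bdd (c := ∫ x, ‖g x‖) (continuous_fourier hg).aestronglyMeasurable
      (Eventually.of_forall (norm_fourier_le _))
  have hae := L2.fourierInv_ae_eq _ (hi.congr hm.symm)
  rw [fourierInv_congr_ae hm] at hae
  filter_upwards [hae] with x hx
  rw [fmul_apply, hx]
  set b : ℂ := 4 * Real.pi * (ε + Complex.I * t) with hb
  have hbre : b.re = 4 * Real.pi * ε := by simp [hb]
  have hbim : b.im = 4 * Real.pi * t := by simp [hb]
  have hpos : 0 < b.re := by rw [hbre]; positivity
  -- This is the regularized symbol times the character e^{2πixξ}. Moving the transform from g onto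
  -- h turns the multiplier evaluated at x into the integral of g against the kernel 𝓕h.
  let h : ℝ → ℂ := fun ξ => Complex.exp (-Real.pi * b * ξ ^ 2 + 2 * Real.pi * (Complex.I * x) * ξ)
  have hfou : 𝓕 h = fun y : ℝ => 1 / b ^ (1 / 2 : ℂ) *
      Complex.exp (-Real.pi / b * (y + Complex.I * (Complex.I * x)) ^ 2) :=
    fourier_gaussian_pi' hpos _
  have hh : ∀ ξ, h ξ = Complex.exp (((2 * Real.pi * x * ξ : ℝ) : ℂ) * Complex.I) * gsym ε t ξ := by
    intro ξ
    simp only [h, gsym, ← Complex.exp_add]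
    congr 1; push_cast; ring
  have hhn : ∀ ξ, ‖h ξ‖ = ‖gsym ε t ξ‖ := fun ξ => by
    rw [hh, norm_mul, Complex.norm_exp_ofReal_mul_I, one_mul]
  have hhi : Integrable h := by
    refine (integrable_gsym hε t).norm.mono' ?_ (Eventually.of_forall fun ξ => (hhn ξ).le)
    exact Continuous.aestronglyMeasurable (by fun_prop)
  have e : 𝓕⁻ (fun ξ => gsym ε t ξ * 𝓕 (g : ℝ → ℂ) ξ) x = ∫ y, g y * 𝓕 h y := by
    rw [← integral_fourier_mul_eq hg hhi, Real.fourierInv_eq']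
    refine integral_congr_ae (Eventually.of_forall fun ξ => ?_)
    simp only [hh, smul_eq_mul]
    have : inner ℝ ξ x = x * ξ := by simp
    rw [this]
    ring_nf
  have hk : ∀ y, ‖𝓕 h y‖ ≤ 1 / √t := by
    intro y
    have e1 : -Real.pi / b * ((y : ℂ) + Complex.I * (Complex.I * x)) ^ 2 =
        ((-(Real.pi * (y - x) ^ 2) : ℝ) : ℂ) * b⁻¹ := by
      rw [← mul_assoc Complex.I, Complex.I_mul_I, div_eq_mul_inv]; push_cast; ring
    rw [hfou]
    simp only
    rw [norm_mul, e1, Complex.norm_exp, Complex.re_ofReal_mul, norm_div, norm_one]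
    have h1 : Real.exp (-(Real.pi * (y - x) ^ 2) * (b⁻¹).re) ≤ 1 := by
      rw [Real.exp_le_one_iff, Complex.inv_re]
      have : 0 ≤ b.re / Complex.normSq b := div_nonneg hpos.le (Complex.normSq_nonneg b)
      have h2 : 0 ≤ Real.pi * (y - x) ^ 2 := by positivity
      nlinarith [mul_nonneg h2 this]
    have h3 : √t ≤ ‖b ^ (1 / 2 : ℂ)‖ := by
      have e2 : (1 / 2 : ℂ) = ((1 / 2 : ℝ) : ℂ) := by push_cast; ring
      rw [e2, Complex.norm_cpow_real, ← Real.sqrt_eq_rpow]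
      apply Real.sqrt_le_sqrt
      refine le_trans ?_ (Complex.abs_im_le_norm b)
      rw [hbim, abs_of_pos (by positivity)]
      nlinarith [Real.pi_gt_three]
    have h4 : 0 < √t := Real.sqrt_pos.2 ht
    calc _ ≤ 1 / ‖b ^ (1 / 2 : ℂ)‖ * 1 := by gcongr
      _ ≤ 1 / √t := by rw [mul_one]; exact one_div_le_one_div_of_le h4 h3
  rw [e]
  calc _ ≤ ∫ y, ‖g y * 𝓕 h y‖ := norm_integral_le_integral_norm _
    _ ≤ ∫ y, ‖g y‖ * (1 / √t) := by
      refine integral_mono_of_nonneg (Eventually.of_forall fun _ => norm_nonneg _)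
        (hg.norm.mul_const _) (Eventually.of_forall fun y => ?_)
      simp only [norm_mul]
      gcongr
      exact hk y
    _ = _ := by rw [integral_mul_const]; ring

/-- The dispersive estimate for the free Schrödinger group. -/
theorem aebdd_schr {t : ℝ} (ht : 0 < t) {g : L2} (hg : Integrable (g : ℝ → ℂ)) :
    AEBdd ((∫ x, ‖g x‖) / √t) (schr t g) := by
  have hpos : ∀ n : ℕ, (0 : ℝ) < 1 / ((n : ℝ) + 1) := fun n => Nat.one_div_pos_of_nat
  refine AEBdd.of_tendsto (f := fun n : ℕ => fmul (gsym (1 / ((n : ℝ) + 1)) t) g)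
    (fun n => aebdd_fmul_gsym (hpos n) ht hg) ?_
  refine tendsto_fmul (C := 1) (fun n => (continuous_gsym _ t).aestronglyMeasurable)
    (continuous_esym t).aestronglyMeasurable
    (Eventually.of_forall fun n => norm_gsym_le (hpos n).le t) (fun ξ => (norm_esym t ξ).le)
    (fun ξ => ?_) g
  have hc : Continuous fun ε : ℝ => gsym ε t ξ := by unfold gsym; fun_prop
  have h0 : gsym 0 t ξ = esym t ξ := by simp [gsym_eq]
  rw [← h0]
  exact (hc.tendsto 0).comp tendsto_one_div_add_atTop_nhds_zero_nat

end ModifiedWave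

/-! ### Passage between functions and elements of H^s; primitives of the data. -/

namespace ModifiedWave

variable {s : ℕ}

theorem classL2_congr {f : ℝ → ℂ} {g : L2} (h : f =ᵐ[volume] g) : classL2 f = g :=
  Lp.ext ((coeFn_classL2 ((memLp_congr_ae h).2 (Lp.memLp g))).trans h)

theorem MemW.hasWeakDeriv {p : ℝ≥0∞} {r : ℝ → ℂ} (h : MemW s p r) {k : ℕ} (hk : k ≤ s) :
    HasWeakDeriv k r (weakDeriv k r) ∧ MemLp (weakDeriv k r) p volume := by
  obtain ⟨g, hg, hp⟩ := h k hk
  have e := hg.weakDeriv_ae_eq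
  exact ⟨hg.congr EventuallyEq.rfl e.symm, (memLp_congr_ae e).2 hp⟩

theorem Hs.hasWeakDeriv (f : Hs s) {r : ℝ → ℂ} (h : r =ᵐ[volume] comp 0 f) {k : ℕ} (hk : k ≤ s) :
    HasWeakDeriv k r (comp k f) := by
  induction k with
  | zero =>
    exact (hasWeakDeriv_zero (locallyIntegrable_L2 (comp 0 f)) EventuallyEq.rfl).congr
      h.symm EventuallyEq.rfl
  | succ k ih => exact (ih (by omega)).succ (isD_comp (by omega) f).hasWeakDeriv

theorem Hs.weakDeriv_ae_eq (f : Hs s) {r : ℝ → ℂ} (h : r =ᵐ[volume] comp 0 f) {k : ℕ}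
    (hk : k ≤ s) : weakDeriv k r =ᵐ[volume] comp k f :=
  (Hs.hasWeakDeriv f h hk).weakDeriv_ae_eq

theorem Hs.memW (f : Hs s) {r : ℝ → ℂ} (h : r =ᵐ[volume] comp 0 f) : MemW s 2 r :=
  fun k hk => ⟨comp k f, Hs.hasWeakDeriv f h hk, Lp.memLp _⟩

theorem MemW.exists_Hs {r : ℝ → ℂ} (h : MemW s 2 r) : ∃ f : Hs s, r =ᵐ[volume] comp 0 f := by
  have hc : ∀ k ≤ s, HasWeakDeriv k r (classL2 (weakDeriv k r)) := fun k hk =>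
    (h.hasWeakDeriv hk).1.congr EventuallyEq.rfl (coeFn_classL2 (h.hasWeakDeriv hk).2).symm
  refine ⟨Hs.mk (fun k => classL2 (weakDeriv k r)) fun k hk => ?_, ?_⟩
  · exact ((hc k (by omega)).of_succ (hc (k + 1) (by omega))).isD
  · rw [comp_mk _ (Nat.zero_le s)]
    exact (hc 0 (Nat.zero_le s)).ae_eq_of_zero

open Classical in
/-- The element of `H^s` of a function of `W^{s,2}`. -/
def toHs (s : ℕ) (r : ℝ → ℂ) : Hs s := if h : MemW s 2 r then h.exists_Hs.choose else 0

theorem norm_fourier_L2 (f : L2) : ‖(𝓕 f : L2)‖ = ‖f‖ := by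
  have h : (𝓕⁻ (𝓕 f : L2) : L2) = f := fourierInv_fourier_eq f
  conv_rhs => rw [← h, norm_fourierInv_L2]

theorem MemW.ae_eq_toHs {r : ℝ → ℂ} (h : MemW s 2 r) : r =ᵐ[volume] comp 0 (toHs s r) := by
  rw [toHs, dif_pos h]; exact h.exists_Hs.choose_spec

theorem eLpNorm_L2 (f : L2) : eLpNorm f 2 volume = ENNReal.ofReal ‖f‖ := by
  rw [Lp.norm_def, ENNReal.ofReal_toReal (Lp.eLpNorm_ne_top f)]

theorem Hs.eLpNorm_weakDeriv (f : Hs s) {r : ℝ → ℂ} (h : r =ᵐ[volume] comp 0 f) {k : ℕ}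
    (hk : k ≤ s) : eLpNorm (weakDeriv k r) 2 volume = ENNReal.ofReal ‖comp k f‖ := by
  rw [eLpNorm_congr_ae (Hs.weakDeriv_ae_eq f h hk), eLpNorm_L2]

theorem Hs.normW_eq (f : Hs s) {r : ℝ → ℂ} (h : r =ᵐ[volume] comp 0 f) :
    normW s 2 r = ENNReal.ofReal (∑ k ∈ Finset.range (s + 1), ‖comp k f‖) := by
  rw [normW, ENNReal.ofReal_sum_of_nonneg fun _ _ => norm_nonneg _]
  refine Finset.sum_congr rfl fun k hk => Hs.eLpNorm_weakDeriv f h ?_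
  exact Nat.lt_succ_iff.1 (Finset.mem_range.1 hk)

theorem Hs.norm_le_sum (f : Hs s) : ‖f‖ ≤ ∑ k ∈ Finset.range (s + 1), ‖comp k f‖ :=
  Hs.norm_le (Finset.sum_nonneg fun _ _ => norm_nonneg _) fun _ hk =>
    Finset.single_le_sum (f := fun k => ‖comp k f‖) (fun _ _ => norm_nonneg _)
      (Finset.mem_range.2 (Nat.lt_succ_iff.2 hk))

theorem Hs.sum_le_norm (f : Hs s) : ∑ k ∈ Finset.range (s + 1), ‖comp k f‖ ≤ (s + 1) * ‖f‖ := by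
  refine (Finset.sum_le_card_nsmul _ _ ‖f‖ fun k _ => norm_comp_le k f).trans ?_
  rw [Finset.card_range, nsmul_eq_mul]; push_cast; rfl

/-- A primitive in `H^s` of an element of `H^s`. -/
theorem Hs.exists_primitive (f : Hs s) {p₀ : L2} (h : IsD p₀ (comp 0 f)) :
    ∃ p : Hs s, comp 0 p = p₀ ∧ (∀ k ≤ s, IsD (comp k p) (comp k f)) ∧ ‖p‖ ≤ ‖p₀‖ + ‖f‖ := by
  let F : ℕ → L2 := fun k => Nat.casesOn k p₀ fun j => comp j f
  have hF : ∀ k < s, IsD (F k) (F (k + 1)) := fun k hk => by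
    cases k with
    | zero => exact h
    | succ k => exact isD_comp (by omega) f
  refine ⟨Hs.mk F hF, comp_mk hF (Nat.zero_le s), fun k hk => ?_,
    Hs.norm_le (by positivity) fun k hk => ?_⟩
  · rw [comp_mk hF hk]
    cases k with
    | zero => exact h
    | succ k => exact isD_comp (by omega) f
  · rw [comp_mk hF hk]
    cases k with
    | zero => exact le_add_of_nonneg_right (norm_nonneg _)
    | succ k => exact (norm_comp_le k f).trans (le_add_of_nonneg_left (norm_nonneg _))

/-- Interpolation: if `f''` exists in the Fourier sense then so does `f'`. -/
theorem exists_isD_of_fourier {f g : L2}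
    (h : ∀ᵐ ξ ∂(volume : Measure ℝ), (𝓕 g : L2) ξ = dsym ξ * dsym ξ * (𝓕 f : L2) ξ) :
    ∃ k : L2, IsD f k ∧ IsD k g ∧ ‖k‖ ≤ ‖f‖ + ‖g‖ := by
  have hm : MemLp (fun ξ => dsym ξ * (𝓕 f : L2) ξ) 2 (volume : Measure ℝ) := by
    refine MemLp.of_le ((Lp.memLp (𝓕 f : L2)).norm.add (Lp.memLp (𝓕 g : L2)).norm)
      (continuous_dsym.aestronglyMeasurable.mul (Lp.aestronglyMeasurable _)) ?_
    filter_upwards [h] with ξ hξ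
    rw [Pi.add_apply, hξ, norm_mul, norm_mul, norm_mul, Real.norm_of_nonneg (by positivity)]
    nlinarith [sq_nonneg (‖dsym ξ‖ - 1), norm_nonneg ((𝓕 f : L2) ξ), norm_nonneg (dsym ξ),
      mul_nonneg (sq_nonneg (‖dsym ξ‖ - 1)) (norm_nonneg ((𝓕 f : L2) ξ))]
  have hc := coeFn_classL2 hm
  have e : (𝓕 (𝓕⁻ (classL2 fun ξ => dsym ξ * (𝓕 f : L2) ξ) : L2) : L2) =
      classL2 fun ξ => dsym ξ * (𝓕 f : L2) ξ := fourier_fourierInv_eq _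
  refine ⟨𝓕⁻ (classL2 fun ξ => dsym ξ * (𝓕 f : L2) ξ), isD_iff.2 ?_, isD_iff.2 ?_, ?_⟩
  · rw [e]; exact hc
  · rw [e]
    filter_upwards [hc, h] with ξ h1 h2
    rw [h1, h2]; ring
  · rw [norm_fourierInv_L2, ← norm_fourier_L2 f, ← norm_fourier_L2 g]
    have h2 : ‖classL2 fun ξ => dsym ξ * (𝓕 f : L2) ξ‖ ≤
        ‖(Lp.memLp (𝓕 f : L2)).norm.toLp _ + (Lp.memLp (𝓕 g : L2)).norm.toLp _‖ := by
      refine Lp.norm_le_norm_of_ae_le ?_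
      filter_upwards [hc, h, Lp.coeFn_add ((Lp.memLp (𝓕 f : L2)).norm.toLp _)
        ((Lp.memLp (𝓕 g : L2)).norm.toLp _), (Lp.memLp (𝓕 f : L2)).norm.coeFn_toLp,
        (Lp.memLp (𝓕 g : L2)).norm.coeFn_toLp] with ξ h1 hξ h3 h4 h5
      rw [h1, h3, Pi.add_apply, h4, h5, hξ, norm_mul, norm_mul, norm_mul,
        Real.norm_of_nonneg (by positivity)]
      nlinarith [sq_nonneg (‖dsym ξ‖ - 1), norm_nonneg ((𝓕 f : L2) ξ), norm_nonneg (dsym ξ),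
        mul_nonneg (sq_nonneg (‖dsym ξ‖ - 1)) (norm_nonneg ((𝓕 f : L2) ξ))]
    refine h2.trans ((norm_add_le _ _).trans (le_of_eq ?_))
    rw [Lp.norm_toLp, Lp.norm_toLp, eLpNorm_norm, eLpNorm_norm, Lp.norm_def, Lp.norm_def]

/-- What the hypotheses on the data provide: the free wave and two primitives of it in `H^s`. -/
structure Data (s : ℕ) (u : ℝ → ℂ) (δ : ℝ) where
  U : Hs s
  q : Hs s
  q₂ : Hs s
  ae_eq : u =ᵐ[volume] comp 0 U
  integrable_u : Integrable u
  isD_q : ∀ k ≤ s, IsD (comp k q) (comp k U)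
  isD_q₂ : ∀ k ≤ s, IsD (comp k q₂) (comp k q)
  integrable : ∀ k ≤ s, Integrable (comp k U : ℝ → ℂ)
  integral_le : ∀ k ≤ s, ∫ x, ‖comp k U x‖ ≤ δ
  norm_U : ‖U‖ ≤ δ
  norm_q₂ : ‖q₂‖ ≤ 8 * δ

/-- The condition û/|ξ|² ∈ L² says that u is the second derivative of an L² function. Interpolation
between that function and u supplies the first primitive, and both primitives lie in H^s because
their derivatives do. -/
theorem MemData.exists_data {u : ℝ → ℂ} {δ : ℝ} (hδ : 0 < δ) (h : MemData s u)
    (hn : dataNorm s u < ENNReal.ofReal δ) : Nonempty (Data s u δ) := by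
  have hle : ∀ {x : ℝ≥0∞}, x ≤ dataNorm s u → x.toReal ≤ δ := fun hx =>
    ENNReal.toReal_le_of_le_ofReal hδ.le (hx.trans hn.le)
  set U := toHs s u
  have hU := h.memH.ae_eq_toHs
  have nU : ‖U‖ ≤ δ := by
    have h1 : normW s 2 u ≤ dataNorm s u := le_add_right le_add_self
    have h2 := hle h1
    rw [Hs.normW_eq U hU, ENNReal.toReal_ofReal (Finset.sum_nonneg fun _ _ => norm_nonneg _)] at h2
    exact (Hs.norm_le_sum U).trans h2
  have hae1 : ∀ k ≤ s, weakDeriv k u =ᵐ[volume] comp k U := fun k hk => Hs.weakDeriv_ae_eq U hU hk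
  have hi : ∀ k ≤ s, Integrable (comp k U : ℝ → ℂ) := fun k hk => by
    rw [← memLp_one_iff_integrable]
    exact (memLp_congr_ae (hae1 k hk)).1 (h.memW.hasWeakDeriv hk).2
  have hint : ∀ k ≤ s, ∫ x, ‖comp k U x‖ ≤ δ := fun k hk => by
    rw [integral_norm_eq_lintegral_enorm (hi k hk).1, ← eLpNorm_one_eq_lintegral_enorm, ← eLpNorm_congr_ae (hae1 k hk)]
    refine hle (le_trans ?_ (le_add_self : normW s 1 u ≤ dataNorm s u))
    exact Finset.single_le_sum (f := fun k => eLpNorm (weakDeriv k u) 1 volume)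
      (fun _ _ => zero_le) (Finset.mem_range.2 (Nat.lt_succ_iff.2 hk))
  have hu : Integrable u := (hi 0 (Nat.zero_le s)).congr hU.symm
  have hu2 : MemLp u 2 volume := (memLp_congr_ae hU).2 (Lp.memLp _)
  have hfu : (𝓕 (comp 0 U) : L2) =ᵐ[volume] 𝓕 u := by
    rw [← classL2_congr hU]; exact fourier_classL2 hu hu2
  -- The constant satisfies (2πiξ)² c = |ξ|², so c û/|ξ|² is the transform of the second primitive.
  set c : ℂ := -(1 / (2 * Real.pi) ^ 2 : ℝ) with hc
  have hcn : ‖c‖ ≤ 1 := by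
    rw [hc, norm_neg, Complex.norm_real, Real.norm_of_nonneg (by positivity)]
    rw [div_le_one (by positivity)]
    nlinarith [Real.pi_gt_three]
  set p₂ : L2 := 𝓕⁻ (c • classL2 (fourierDivSq u)) with hp₂
  have np₂ : ‖p₂‖ ≤ δ := by
    rw [hp₂, norm_fourierInv_L2, norm_smul]
    have h1 : ‖classL2 (fourierDivSq u)‖ ≤ δ := by
      rw [Lp.norm_def, eLpNorm_congr_ae (coeFn_classL2 h.memHNegTwo)]
      exact hle (le_add_right le_self_add)
    nlinarith [norm_nonneg (classL2 (fourierDivSq u))]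
  have hfp : ∀ᵐ ξ ∂(volume : Measure ℝ),
      (𝓕 (comp 0 U) : L2) ξ = dsym ξ * dsym ξ * (𝓕 p₂ : L2) ξ := by
    have e : (𝓕 p₂ : L2) = c • classL2 (fourierDivSq u) := by rw [hp₂, fourier_fourierInv_eq]
    rw [e]
    have h0 : ∀ᵐ ξ ∂(volume : Measure ℝ), ξ ≠ 0 := by
      rw [ae_iff]; simp
    filter_upwards [hfu, Lp.coeFn_smul c (classL2 (fourierDivSq u)), coeFn_classL2 h.memHNegTwo,
      h0] with ξ h1 h2 h3 hξ
    have hξ' : (ξ : ℂ) ≠ 0 := by exact_mod_cast hξ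
    have hπ : (Real.pi : ℂ) ≠ 0 := by exact_mod_cast Real.pi_ne_zero
    rw [h1, h2, Pi.smul_apply, h3, fourierDivSq, hc, dsym, smul_eq_mul, sq_abs]
    push_cast
    field_simp
    rw [Complex.I_sq]; ring
  obtain ⟨p₁, h21, h10, n1⟩ := exists_isD_of_fourier hfp
  have nU0 := norm_comp_le 0 U
  obtain ⟨q, hq0, hq, nq⟩ := Hs.exists_primitive U h10
  rw [← hq0] at h21
  obtain ⟨q₂, hq₂0, hq₂, nq₂⟩ := Hs.exists_primitive q h21
  -- Successive bounds are ‖p₂‖ ≤ δ, ‖p₁‖ ≤ 2δ, ‖q‖ ≤ 3δ and ‖q₂‖ ≤ 4δ; the recorded 8δ leaves room.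
  exact ⟨⟨U, q, q₂, hU, hu, hq, hq₂, hi, hint, nU, by linarith⟩⟩

end ModifiedWave

/-! ### The nonlinearity on H^s and its Lipschitz estimates. -/

namespace ModifiedWave

variable {s : ℕ} [NeZero s]

theorem continuous_mulH {X : Type*} [TopologicalSpace X] {f g : X → Hs s}
    (hf : Continuous f) (hg : Continuous g) : Continuous fun x => mulH (f x) (g x) :=
  (mulH.continuous.comp hf).clm_apply hg

theorem mulH_assoc (f g h : Hs s) : mulH (mulH f g) h = mulH f (mulH g h) := by
  refine Hs.ext_zero (Lp.ext ?_)
  filter_upwards [coeFn_mulH (mulH f g) h, coeFn_mulH f g, coeFn_mulH f (mulH g h),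
    coeFn_mulH g h] with x h1 h2 h3 h4
  rw [h1, h2, h3, h4, mul_assoc]

/-- Multiplication by `y` has norm at most `ε` on `H^s`. -/
def MulBdd (ε : ℝ) (y : Hs s) : Prop := ∀ f : Hs s, ‖mulH y f‖ ≤ ε * ‖f‖

theorem mulBdd_norm (y : Hs s) : MulBdd (2 ^ (s + 1) * ‖y‖) y := fun f => norm_mulH_le y f

theorem MulBdd.mono {ε ε' : ℝ} {y : Hs s} (h : MulBdd ε y) (hε : ε ≤ ε') : MulBdd ε' y :=
  fun f => (h f).trans (by gcongr)

theorem MulBdd.add {ε ε' : ℝ} {y y' : Hs s} (h : MulBdd ε y) (h' : MulBdd ε' y') :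
    MulBdd (ε + ε') (y + y') := fun f => by
  rw [map_add, add_apply, add_mul]
  exact (norm_add_le _ _).trans (add_le_add (h f) (h' f))

theorem MulBdd.conj {ε : ℝ} {y : Hs s} (h : MulBdd ε y) : MulBdd ε (conjH y) := fun f => by
  have := h (conjH f)
  rwa [← norm_conjH, conjH_mulH, conjH_conjH, norm_conjH] at this

theorem MulBdd.smul {ε : ℝ} {y : Hs s} (h : MulBdd ε y) {c : ℂ} (hc : ‖c‖ ≤ 1) :
    MulBdd ε (c • y) := fun f => by
  rw [map_smul, smul_apply, norm_smul]
  exact (mul_le_of_le_one_left (norm_nonneg _) hc).trans (h f)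

/-- The part of order at least two in `y` of `(|a + y|² - a²) (a + y)`. -/
def nonlin (a : ℝ) (y : Hs s) : Hs s :=
  (2 * a : ℂ) • mulH y (conjH y) + (a : ℂ) • mulH y y + mulH y (mulH y (conjH y))

/-- `(|a + y|² - a²) (a + y)`. -/
def fullNonlin (a : ℝ) (y : Hs s) : Hs s := (a ^ 2 : ℂ) • (y + conjH y) + nonlin a y

theorem nonlin_zero (a : ℝ) : nonlin a (0 : Hs s) = 0 := by simp [nonlin]

theorem continuous_nonlin (a : ℝ) : Continuous (nonlin a : Hs s → Hs s) := by
  have h1 : Continuous fun y : Hs s => mulH y (conjH y) :=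
    continuous_mulH continuous_id conjH.continuous
  have h2 : Continuous fun y : Hs s => mulH y y := continuous_mulH continuous_id continuous_id
  have h3 : Continuous fun y : Hs s => mulH y (mulH y (conjH y)) := continuous_mulH continuous_id h1
  exact (((continuous_const_smul (2 * a : ℂ)).comp h1).add
    ((continuous_const_smul (a : ℂ)).comp h2)).add h3

theorem continuous_fullNonlin (a : ℝ) : Continuous (fullNonlin a : Hs s → Hs s) :=
  ((continuous_const_smul (a ^ 2 : ℂ)).comp (continuous_id.add conjH.continuous)).add
    (continuous_nonlin a)

theorem coeFn_fullNonlin (a : ℝ) (y : Hs s) : comp 0 (fullNonlin a y) =ᵐ[volume]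
    fun x => ((‖(a : ℂ) + comp 0 y x‖ ^ 2 - a ^ 2 : ℝ) : ℂ) * (a + comp 0 y x) := by
  rw [fullNonlin, nonlin]
  simp only [map_add, map_smul]
  filter_upwards [Lp.coeFn_add ((a ^ 2 : ℂ) • (comp 0 y + comp 0 (conjH y)))
      ((2 * a : ℂ) • comp 0 (mulH y (conjH y)) + (a : ℂ) • comp 0 (mulH y y) +
        comp 0 (mulH y (mulH y (conjH y)))),
    Lp.coeFn_smul (a ^ 2 : ℂ) (comp 0 y + comp 0 (conjH y)),
    Lp.coeFn_add (comp 0 y) (comp 0 (conjH y)),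
    Lp.coeFn_add ((2 * a : ℂ) • comp 0 (mulH y (conjH y)) + (a : ℂ) • comp 0 (mulH y y))
      (comp 0 (mulH y (mulH y (conjH y)))),
    Lp.coeFn_add ((2 * a : ℂ) • comp 0 (mulH y (conjH y))) ((a : ℂ) • comp 0 (mulH y y)),
    Lp.coeFn_smul (2 * a : ℂ) (comp 0 (mulH y (conjH y))), Lp.coeFn_smul (a : ℂ) (comp 0 (mulH y y)),
    coeFn_mulH y (conjH y), coeFn_mulH y y, coeFn_mulH y (mulH y (conjH y)),
    coeFn_conjL2 (comp 0 y)] with x h1 h2 h3 h4 h5 h6 h7 h8 h9 h10 h11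
  rw [h1, Pi.add_apply, h2, Pi.smul_apply, h3, Pi.add_apply, h4, Pi.add_apply, h5, Pi.add_apply, h6,
    h7, Pi.smul_apply, Pi.smul_apply, h8, h9, h10, h8, comp_conjH, h11]
  generalize comp 0 y x = w
  have e : ((‖(a : ℂ) + w‖ ^ 2 : ℝ) : ℂ) = (a + w) * (a + (starRingEnd ℂ) w) := by
    have := Complex.mul_conj' ((a : ℂ) + w)
    rw [map_add, Complex.conj_ofReal] at this
    rw [this]; push_cast; rfl
  rw [Complex.ofReal_sub, e]
  simp only [smul_eq_mul]
  push_cast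
  ring

/-- The free wave keeps its H^s norm and decays only as a multiplication operator, so smallness is
measured in the operator norm. Telescoping each monomial leaves one factor y - y' and costs ε for
every other factor: 2a·2ε + a·2ε from the quadratic terms and 3ε² from the cubic one. -/
theorem norm_nonlin_sub_le {a ε : ℝ} (ha : 0 ≤ a) (hε : 0 ≤ ε) {y y' : Hs s} (h : MulBdd ε y)
    (h' : MulBdd ε y') :
    ‖nonlin a y - nonlin a y'‖ ≤ (6 * a * ε + 3 * ε ^ 2) * ‖y - y'‖ := by
  set d := y - y' with hd
  have hdc : conjH y - conjH y' = conjH d := by rw [hd, map_sub]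
  have e1 : mulH y (conjH y) - mulH y' (conjH y') = mulH y (conjH d) + mulH (conjH y') d := by
    rw [← hdc, mulH_comm (conjH y') d, hd]; simp only [map_sub, sub_apply]; abel
  have e2 : mulH y y - mulH y' y' = mulH y d + mulH y' d := by
    have := mulH_comm y y'
    rw [hd]; simp only [map_sub]; rw [this]; abel
  have e3 : mulH y (mulH y (conjH y)) - mulH y' (mulH y' (conjH y')) =
      mulH y (mulH y (conjH y) - mulH y' (conjH y')) + mulH y' (mulH (conjH y') d) := by
    have : mulH y' (mulH (conjH y') d) = mulH d (mulH y' (conjH y')) := by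
      rw [← mulH_assoc, mulH_comm]
    rw [this, hd]; simp only [map_sub, sub_apply]; abel
  have n1 : ‖mulH y (conjH y) - mulH y' (conjH y')‖ ≤ 2 * ε * ‖d‖ := by
    rw [e1]
    have h1 := h (conjH d)
    rw [norm_conjH] at h1
    linarith [norm_add_le (mulH y (conjH d)) (mulH (conjH y') d), h'.conj d]
  have n2 : ‖mulH y y - mulH y' y'‖ ≤ 2 * ε * ‖d‖ := by
    rw [e2]
    linarith [norm_add_le (mulH y d) (mulH y' d), h d, h' d]
  have n3 : ‖mulH y (mulH y (conjH y)) - mulH y' (mulH y' (conjH y'))‖ ≤ 3 * ε ^ 2 * ‖d‖ := by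
    rw [e3]
    have h1 := h (mulH y (conjH y) - mulH y' (conjH y'))
    have h2 := h' (mulH (conjH y') d)
    have h3 := mul_le_mul_of_nonneg_left n1 hε
    have h4 := mul_le_mul_of_nonneg_left (h'.conj d) hε
    linarith [norm_add_le (mulH y (mulH y (conjH y) - mulH y' (conjH y')))
      (mulH y' (mulH (conjH y') d))]
  have e : nonlin a y - nonlin a y' = (2 * a : ℂ) • (mulH y (conjH y) - mulH y' (conjH y')) +
      (a : ℂ) • (mulH y y - mulH y' y') +
      (mulH y (mulH y (conjH y)) - mulH y' (mulH y' (conjH y'))) := by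
    rw [nonlin, nonlin, smul_sub, smul_sub]; abel
  rw [e]
  have c1 : ‖(2 * a : ℂ)‖ = 2 * a := by
    rw [norm_mul, Complex.norm_real, Real.norm_of_nonneg ha]; simp
  have c2 : ‖(a : ℂ)‖ = a := by rw [Complex.norm_real, Real.norm_of_nonneg ha]
  refine (norm_add₃_le).trans ?_
  rw [norm_smul, norm_smul, c1, c2]
  have m1 := mul_le_mul_of_nonneg_left n1 (by positivity : 0 ≤ 2 * a)
  have m2 := mul_le_mul_of_nonneg_left n2 ha
  linarith

theorem norm_nonlin_le {a ε : ℝ} (ha : 0 ≤ a) (hε : 0 ≤ ε) {y : Hs s} (h : MulBdd ε y) :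
    ‖nonlin a y‖ ≤ (6 * a * ε + 3 * ε ^ 2) * ‖y‖ := by
  have h0 : MulBdd ε (0 : Hs s) := fun f => by
    rw [map_zero, zero_apply, norm_zero]; positivity
  simpa [nonlin_zero] using norm_nonlin_sub_le ha hε h h0

theorem norm_fullNonlin_sub_le {a ε : ℝ} (ha : 0 ≤ a) (hε : 0 ≤ ε) {y y' : Hs s} (h : MulBdd ε y)
    (h' : MulBdd ε y') :
    ‖fullNonlin a y - fullNonlin a y'‖ ≤ (2 * a ^ 2 + (6 * a * ε + 3 * ε ^ 2)) * ‖y - y'‖ := by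
  have e : fullNonlin a y - fullNonlin a y' = (a ^ 2 : ℂ) • ((y - y') + conjH (y - y')) +
      (nonlin a y - nonlin a y') := by
    rw [fullNonlin, fullNonlin, map_sub, ← sub_add_sub_comm, ← smul_sub]
    congr 2; abel
  rw [e]
  refine (norm_add_le _ _).trans ?_
  have h1 : ‖(a ^ 2 : ℂ) • ((y - y') + conjH (y - y'))‖ ≤ a ^ 2 * (2 * ‖y - y'‖) := by
    rw [norm_smul, norm_pow, Complex.norm_real, Real.norm_of_nonneg ha]
    gcongr
    linarith [norm_add_le (y - y') (conjH (y - y')), norm_conjH (y - y')]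
  linarith [norm_nonlin_sub_le ha hε h h']

end ModifiedWave

/-! ### Integrals over (t,∞) and integration by parts against the oscillating weight. -/

namespace ModifiedWave

theorem inv_mul_sqrt_eq_rpow {τ : ℝ} (h : 0 < τ) : 1 / (τ * √τ) = τ ^ (-(3 / 2) : ℝ) := by
  rw [Real.rpow_neg h.le, one_div, Real.sqrt_eq_rpow]
  congr 1
  nth_rewrite 1 [← Real.rpow_one τ]
  rw [← Real.rpow_add h]; norm_num

theorem inv_sq_eq_rpow {τ : ℝ} (h : 0 < τ) : 1 / τ ^ 2 = τ ^ (-2 : ℝ) := by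
  rw [Real.rpow_neg h.le, one_div]
  norm_cast

theorem integrableOn_inv_mul_sqrt {t : ℝ} (ht : 0 < t) :
    IntegrableOn (fun τ : ℝ => 1 / (τ * √τ)) (Ioi t) :=
  (integrableOn_Ioi_rpow_of_lt (a := -(3 / 2)) (by norm_num) ht).congr_fun
    (fun _ hτ => (inv_mul_sqrt_eq_rpow (ht.trans hτ)).symm) measurableSet_Ioi

theorem integrableOn_inv_sq {t : ℝ} (ht : 0 < t) :
    IntegrableOn (fun τ : ℝ => 1 / τ ^ 2) (Ioi t) :=
  (integrableOn_Ioi_rpow_of_lt (a := -2) (by norm_num) ht).congr_fun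
    (fun _ hτ => (inv_sq_eq_rpow (ht.trans hτ)).symm) measurableSet_Ioi

theorem integral_inv_mul_sqrt {t : ℝ} (ht : 0 < t) : ∫ τ in Ioi t, 1 / (τ * √τ) = 2 / √t := by
  rw [setIntegral_congr_fun measurableSet_Ioi fun τ hτ => inv_mul_sqrt_eq_rpow (ht.trans hτ),
    integral_Ioi_rpow_of_lt (by norm_num) ht, Real.sqrt_eq_rpow,
    show (-(3 / 2) + 1 : ℝ) = -(1 / 2) by norm_num, Real.rpow_neg ht.le]
  field_simp

theorem integral_inv_sq {t : ℝ} (ht : 0 < t) : ∫ τ in Ioi t, 1 / τ ^ 2 = 1 / t := by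
  rw [setIntegral_congr_fun measurableSet_Ioi fun τ hτ => inv_sq_eq_rpow (ht.trans hτ),
    integral_Ioi_rpow_of_lt (by norm_num) ht,
    show (-2 + 1 : ℝ) = -1 by norm_num, Real.rpow_neg_one]
  field_simp

theorem integrableOn_of_norm_le {X : Type*} [NormedAddCommGroup X] {H : ℝ → X} {g : ℝ → ℝ} {t : ℝ} (hc : ContinuousOn H (Ioi t))
    (hg : IntegrableOn g (Ioi t)) (hb : ∀ τ > t, ‖H τ‖ ≤ g τ) : IntegrableOn H (Ioi t) :=
  hg.mono' (hc.aestronglyMeasurable measurableSet_Ioi)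
    ((ae_restrict_iff' measurableSet_Ioi).2 (Eventually.of_forall hb))

theorem integrableOn_of_le_sqrt {X : Type*} [NormedAddCommGroup X] {H : ℝ → X} {t C : ℝ} (ht : 0 < t)
    (hc : ContinuousOn H (Ioi t)) (hb : ∀ τ > t, ‖H τ‖ ≤ C * (1 / (τ * √τ))) :
    IntegrableOn H (Ioi t) :=
  integrableOn_of_norm_le hc ((integrableOn_inv_mul_sqrt ht).const_mul C) hb

theorem integrableOn_of_le_sq {X : Type*} [NormedAddCommGroup X] {H : ℝ → X} {t C : ℝ} (ht : 0 < t)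
    (hc : ContinuousOn H (Ioi t)) (hb : ∀ τ > t, ‖H τ‖ ≤ C * (1 / τ ^ 2)) :
    IntegrableOn H (Ioi t) :=
  integrableOn_of_norm_le hc ((integrableOn_inv_sq ht).const_mul C) hb

section Tail

variable {X : Type*} [NormedAddCommGroup X] [NormedSpace ℝ X]

/-- The integral over `(t, ∞)`. -/
def tail (H : ℝ → X) (t : ℝ) : X := ∫ τ in Ioi t, H τ

theorem norm_tail_le_sqrt {H : ℝ → X} {t C : ℝ} (ht : 0 < t)
    (hb : ∀ τ > t, ‖H τ‖ ≤ C * (1 / (τ * √τ))) : ‖tail H t‖ ≤ 2 * C / √t := by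
  have := norm_integral_le_of_norm_le ((integrableOn_inv_mul_sqrt ht).const_mul C)
    ((ae_restrict_iff' measurableSet_Ioi).2 (Eventually.of_forall hb))
  rw [integral_const_mul, integral_inv_mul_sqrt ht] at this
  exact this.trans (le_of_eq (by ring))

theorem norm_tail_le_sq {H : ℝ → X} {t C : ℝ} (ht : 0 < t)
    (hb : ∀ τ > t, ‖H τ‖ ≤ C * (1 / τ ^ 2)) : ‖tail H t‖ ≤ C / t := by
  have := norm_integral_le_of_norm_le ((integrableOn_inv_sq ht).const_mul C)
    ((ae_restrict_iff' measurableSet_Ioi).2 (Eventually.of_forall hb))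
  rw [integral_const_mul, integral_inv_sq ht] at this
  exact this.trans (le_of_eq (by ring))

theorem tail_eq_sub {H : ℝ → X} {t₀ t : ℝ} (hi : IntegrableOn H (Ioi t₀)) (h : t₀ ≤ t) :
    tail H t = tail H t₀ - ∫ τ in t₀..t, H τ := by
  rw [tail, tail, ← intervalIntegral.integral_interval_add_Ioi hi (hi.mono_set (Ioi_subset_Ioi h)),
    add_sub_cancel_left]

theorem continuousOn_tail {H : ℝ → X} {t₀ : ℝ} (hi : IntegrableOn H (Ioi t₀)) :
    ContinuousOn (tail H) (Ici t₀) := by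
  have hI : Integrable ((Ioi t₀).indicator H) := (integrable_indicator_iff measurableSet_Ioi).2 hi
  have hc : Continuous fun t => tail H t₀ - ∫ τ in t₀..t, (Ioi t₀).indicator H τ :=
    continuous_const.sub (intervalIntegral.continuous_primitive
      (fun a b => hI.intervalIntegrable) t₀)
  refine hc.continuousOn.congr fun t ht => ?_
  simp only
  rw [tail_eq_sub hi ht, intervalIntegral.integral_of_le ht, intervalIntegral.integral_of_le ht]
  congr 1
  refine setIntegral_congr_fun measurableSet_Ioc fun τ hτ => ?_
  rw [indicator_of_mem (show τ ∈ Ioi t₀ from hτ.1)]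

theorem hasDerivAt_tail [CompleteSpace X] {H : ℝ → X} {t₀ t : ℝ} (hi : IntegrableOn H (Ioi t₀))
    (hc : ContinuousOn H (Ioi t₀)) (h : t₀ < t) : HasDerivAt (tail H) (-H t) t := by
  have hint : IntervalIntegrable H volume t₀ t := by
    rw [intervalIntegrable_iff_integrableOn_Ioc_of_le h.le]
    exact hi.mono_set Ioc_subset_Ioi_self
  have h1 := intervalIntegral.integral_hasDerivAt_right hint
    (hc.stronglyMeasurableAtFilter isOpen_Ioi t h) (hc.continuousAt (Ioi_mem_nhds h))
  have h2 := h1.const_sub (tail H t₀)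
  refine h2.congr_of_eventuallyEq ?_
  filter_upwards [Ioi_mem_nhds h] with τ hτ
  exact tail_eq_sub hi (le_of_lt hτ)

end Tail

/-- The phase `e^{iβ log τ}`. -/
def phase (β τ : ℝ) : ℂ := Complex.exp (((β * Real.log τ : ℝ) : ℂ) * Complex.I)

theorem norm_phase (β τ : ℝ) : ‖phase β τ‖ = 1 := Complex.norm_exp_ofReal_mul_I _

theorem conj_phase (β τ : ℝ) : (starRingEnd ℂ) (phase β τ) = phase (-β) τ := by
  rw [phase, phase, ← Complex.exp_conj]
  congr 1
  rw [map_mul, Complex.conj_ofReal, Complex.conj_I]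
  push_cast; ring

theorem phase_mul (β γ τ : ℝ) : phase β τ * phase γ τ = phase (β + γ) τ := by
  rw [phase, phase, phase, ← Complex.exp_add]; congr 1; push_cast; ring

theorem phase_zero (τ : ℝ) : phase 0 τ = 1 := by simp [phase]

theorem hasDerivAt_phase (β : ℝ) {τ : ℝ} (h : 0 < τ) :
    HasDerivAt (phase β) (β * Complex.I / τ * phase β τ) τ := by
  have h1 : HasDerivAt (fun τ : ℝ => ((β * Real.log τ : ℝ) : ℂ) * Complex.I)
      (((β * τ⁻¹ : ℝ) : ℂ) * Complex.I) τ :=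
    (((Real.hasDerivAt_log h.ne').const_mul β).ofReal_comp).mul_const _
  refine HasDerivAt.congr_deriv (f := phase β) h1.cexp ?_
  rw [phase]; push_cast; ring

theorem continuousOn_phase (β : ℝ) : ContinuousOn (phase β) (Ioi 0) := fun _ h =>
  (hasDerivAt_phase β h).continuousAt.continuousWithinAt

/-- The weight `τ⁻¹ e^{iβ log τ}`. -/
def weight (β τ : ℝ) : ℂ := (τ : ℂ)⁻¹ * phase β τ

theorem norm_weight (β : ℝ) {τ : ℝ} (h : 0 < τ) : ‖weight β τ‖ = 1 / τ := by
  rw [weight, norm_mul, norm_phase, norm_inv, Complex.norm_real, Real.norm_of_nonneg h.le]; simp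

/-- The derivative of the weight. -/
def weightDeriv (β τ : ℝ) : ℂ := (β * Complex.I - 1) / (τ : ℂ) ^ 2 * phase β τ

theorem hasDerivAt_weight (β : ℝ) {τ : ℝ} (h : 0 < τ) :
    HasDerivAt (weight β) (weightDeriv β τ) τ := by
  have h0 : (τ : ℂ) ≠ 0 := by exact_mod_cast h.ne'
  have h1 : HasDerivAt (fun τ : ℝ => (τ : ℂ)⁻¹) (-1 / (τ : ℂ) ^ 2) τ :=
    (HasDerivAt.ofReal_comp (hasDerivAt_id τ)).fun_inv h0
  refine HasDerivAt.congr_deriv (f := weight β) (h1.mul (hasDerivAt_phase β h)) ?_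
  rw [weightDeriv]; field_simp; ring

theorem continuousOn_weight (β : ℝ) : ContinuousOn (weight β) (Ioi 0) := fun _ h =>
  (hasDerivAt_weight β h).continuousAt.continuousWithinAt

theorem continuousOn_weightDeriv (β : ℝ) : ContinuousOn (weightDeriv β) (Ioi 0) := by
  refine ContinuousOn.mul (continuousOn_const.div ?_ ?_) (continuousOn_phase β)
  · exact Continuous.continuousOn (by fun_prop)
  · intro τ hτ
    have : (τ : ℂ) ≠ 0 := by exact_mod_cast (ne_of_gt hτ)
    exact pow_ne_zero _ this

theorem norm_weightDeriv_le (β : ℝ) {τ : ℝ} :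
    ‖weightDeriv β τ‖ ≤ (1 + |β|) * (1 / τ ^ 2) := by
  rw [weightDeriv, norm_mul, norm_phase, mul_one, norm_div, norm_pow, Complex.norm_real,
    Real.norm_eq_abs, sq_abs, div_eq_mul_one_div]
  gcongr
  refine (norm_sub_le _ _).trans ?_
  rw [norm_mul, Complex.norm_real, Complex.norm_I, norm_one, Real.norm_eq_abs]
  linarith

section Weight

variable {X : Type*} [NormedAddCommGroup X] [NormedSpace ℂ X]

theorem norm_weightDeriv_smul_le (β : ℝ) {p : X} {C τ : ℝ} (hp : ‖p‖ ≤ C) :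
    ‖weightDeriv β τ • p‖ ≤ (1 + |β|) * C * (1 / τ ^ 2) := by
  rw [norm_smul]
  calc _ ≤ (1 + |β|) * (1 / τ ^ 2) * C := by gcongr; exact norm_weightDeriv_le β
    _ = _ := by ring

theorem integrableOn_weightDeriv_smul (β : ℝ) {p : ℝ → X} {C t : ℝ} (ht : 0 < t)
    (hc : ContinuousOn p (Ioi 0)) (hp : ∀ τ > 0, ‖p τ‖ ≤ C) :
    IntegrableOn (fun τ => weightDeriv β τ • p τ) (Ioi t) :=
  integrableOn_of_le_sq ht
    (((continuousOn_weightDeriv β).smul hc).mono (Ioi_subset_Ioi ht.le))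
    fun τ hτ => norm_weightDeriv_smul_le β (hp τ (ht.trans hτ))

variable [NormedSpace ℝ X]

/-- The boundary term and the remaining integral after an integration by parts. -/
def byParts (β : ℝ) (p : ℝ → X) (t : ℝ) : X :=
  -(weight β t • p t) - tail (fun τ => weightDeriv β τ • p τ) t

theorem norm_byParts_le (β : ℝ) {p : ℝ → X} {C t : ℝ} (ht : 0 < t) (hp : ∀ τ > 0, ‖p τ‖ ≤ C) :
    ‖byParts β p t‖ ≤ (2 + |β|) * C / t := by
  have h1 : ‖weight β t • p t‖ ≤ C / t := by
    rw [norm_smul, norm_weight β ht, one_div_mul_eq_div]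
    exact div_le_div_of_nonneg_right (hp t ht) ht.le
  have h2 := norm_tail_le_sq ht (H := fun τ => weightDeriv β τ • p τ)
    fun τ hτ => norm_weightDeriv_smul_le β (hp τ (ht.trans hτ))
  rw [byParts]
  refine (norm_sub_le _ _).trans ?_
  rw [norm_neg]
  refine (add_le_add h1 h2).trans (le_of_eq ?_)
  ring

variable [IsScalarTower ℝ ℂ X] [CompleteSpace X]

/-- The derivative is that of the integral over (t,∞) of `weight β τ • p'`, but only boundedness of
p is used, not integrability of this product. The expression thus gives a meaning to the integral of
the linear source, which does not converge absolutely. -/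
theorem hasDerivAt_byParts (β : ℝ) {p : ℝ → X} {p' : X} {C t : ℝ} (ht : 0 < t)
    (hc : ContinuousOn p (Ioi 0)) (hp : ∀ τ > 0, ‖p τ‖ ≤ C) (hd : HasDerivAt p p' t) :
    HasDerivAt (byParts β p) (-(weight β t • p')) t := by
  have h1 := ((hasDerivAt_weight β ht).smul hd).neg
  have h2 := hasDerivAt_tail (integrableOn_weightDeriv_smul β (half_pos ht) hc hp)
    (((continuousOn_weightDeriv β).smul hc).mono (Ioi_subset_Ioi (half_pos ht).le))
    (half_lt_self ht)
  refine HasDerivAt.congr_deriv (f := byParts β p) (h1.sub h2) ?_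
  rw [neg_add, sub_neg_eq_add, neg_add_cancel_right]

/-- Integration by parts against the weight. -/
theorem tail_eq_byParts (β : ℝ) {p p' : ℝ → X} {C t : ℝ} (ht : 0 < t)
    (hp : ∀ τ > 0, ‖p τ‖ ≤ C) (hd : ∀ τ > 0, HasDerivAt p (p' τ) τ)
    (hi : IntegrableOn (fun τ => weight β τ • p' τ) (Ioi t)) :
    tail (fun τ => weight β τ • p' τ) t = byParts β p t := by
  have hc : ContinuousOn p (Ioi 0) := fun τ hτ => (hd τ hτ).continuousAt.continuousWithinAt
  have hi2 := integrableOn_weightDeriv_smul β ht hc hp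
  have hz : Tendsto (fun τ => weight β τ • p τ) atTop (𝓝 0) := by
    have hb : Tendsto (fun τ : ℝ => C * τ⁻¹) atTop (𝓝 0) := by
      simpa using tendsto_inv_atTop_zero.const_mul C
    refine squeeze_zero_norm' ?_ hb
    filter_upwards [Ioi_mem_atTop 0] with τ hτ
    rw [norm_smul, norm_weight β hτ, one_div, mul_comm]
    have : 0 ≤ τ⁻¹ := inv_nonneg.2 (le_of_lt hτ)
    exact mul_le_mul_of_nonneg_right (hp τ hτ) this
  have h := integral_Ioi_of_hasDerivAt_of_tendsto' (a := t)
    (fun τ hτ => (hasDerivAt_weight β (ht.trans_le hτ)).smul (hd τ (ht.trans_le hτ)))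
    (hi.add hi2) hz
  rw [integral_add hi hi2] at h
  rw [byParts, tail, tail, eq_sub_iff_add_eq, h, zero_sub]
  rfl

end Weight

end ModifiedWave

/-! ### Normal forms for the quadratic terms. -/

namespace ModifiedWave

theorem mulL2_sub_right {C D : ℝ} {f g g' : L2} (h : AEBdd C f ∨ (AEBdd C g ∧ AEBdd D g')) :
    mulL2 f (g - g') = mulL2 f g - mulL2 f g' := by
  have e : mulL2 f ((-1 : ℂ) • g') = (-1 : ℂ) • mulL2 f g' := by
    rcases h with h | h
    · exact mulL2_smul_right _ (Or.inl h)
    · exact mulL2_smul_right _ (Or.inr h.2)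
  rw [sub_eq_add_neg, ← neg_one_smul ℂ g', mulL2_add_right (C := C) (D := ‖(-1 : ℂ)‖ * D), e,
    neg_one_smul, sub_eq_add_neg]
  rcases h with h | ⟨h1, h2⟩
  · exact Or.inl h
  · exact Or.inr ⟨h1, h2.smul _⟩

/-- For opposite time directions the second derivative of the first factor cancels, so one
derivative of it suffices. -/
theorem hasDerivAt_schr_neg_mulL2_neg {f f₁ g g₁ g₂ : L2} (hf : IsD f f₁)
    (hg : IsD g g₁) (hg₁ : IsD g₁ g₂) (t : ℝ) :
    HasDerivAt (fun τ => schr (-τ) (mulL2 (schr τ f) (schr (-1 * τ) g)))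
      (-(2 * Complex.I) • schr (-t) (mulL2 (schr t f₁) (schr (-1 * t) g₁) +
        mulL2 (schr t f) (schr (-1 * t) g₂))) t := by
  obtain ⟨φ, -, h0, h1⟩ := hf.exists_seq_test
  have hd : ∀ (k : ℕ) (x : ℝ), HasDerivAt
      (fun τ => schr (-τ) (mulL2 (schr τ ((φ k).toLp 2 volume)) (schr (-1 * τ) g)))
      (-(2 * Complex.I) • schr (-x)
        (mulL2 (schr x ((SchwartzMap.derivCLM ℂ ℂ (φ k)).toLp 2 volume)) (schr (-1 * x) g₁) +
        mulL2 (schr x ((φ k).toLp 2 volume)) (schr (-1 * x) g₂))) x := by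
    intro k x
    have h2 := isD_schwartz (φ k)
    have h3 := isD_schwartz (SchwartzMap.derivCLM ℂ ℂ (φ k))
    refine (hasDerivAt_schr_neg_mulL2 h2 h3 hg hg₁ (-1) x).congr_deriv ?_
    have e : (1 - ((-1 : ℝ) : ℂ)) = 2 := by push_cast; norm_num
    rw [e, ← smul_add, map_smul, smul_smul]
    congr 1; ring
  have n0 := tendsto_iff_norm_sub_tendsto_zero.1 h0
  have n1 := tendsto_iff_norm_sub_tendsto_zero.1 h1
  -- The formula is known for two derivatives on f. Approximating f by test functions in the graph
  -- norm, the time derivatives converge uniformly in time because the group is isometric and the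
  -- limit formula involves only f and f₁.
  refine hasDerivAt_of_tendstoUniformly (l := atTop) (f := fun k τ =>
    schr (-τ) (mulL2 (schr τ ((φ k).toLp 2 volume)) (schr (-1 * τ) g)))
    (f' := fun k x => -(2 * Complex.I) • schr (-x)
        (mulL2 (schr x ((SchwartzMap.derivCLM ℂ ℂ (φ k)).toLp 2 volume)) (schr (-1 * x) g₁) +
        mulL2 (schr x ((φ k).toLp 2 volume)) (schr (-1 * x) g₂)))
    (g' := fun x => -(2 * Complex.I) • schr (-x) (mulL2 (schr x f₁) (schr (-1 * x) g₁) +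
        mulL2 (schr x f) (schr (-1 * x) g₂))) ?_ (Eventually.of_forall hd) ?_ t
  · rw [Metric.tendstoUniformly_iff]
    intro ε hε
    have hz : Tendsto (fun k =>
        2 * (‖((SchwartzMap.derivCLM ℂ ℂ (φ k)).toLp 2 volume : L2) - f₁‖ * (‖g₁‖ + ‖g₂‖) +
          (‖((φ k).toLp 2 volume : L2) - f‖ +
            ‖((SchwartzMap.derivCLM ℂ ℂ (φ k)).toLp 2 volume : L2) - f₁‖) * ‖g₂‖)) atTop (𝓝 0) := by
      have := (((n1.mul_const (‖g₁‖ + ‖g₂‖)).add ((n0.add n1).mul_const ‖g₂‖))).const_mul 2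
      simpa using this
    filter_upwards [hz.eventually (gt_mem_nhds hε)] with k hk x
    refine lt_of_le_of_lt ?_ hk
    have bG : AEBdd (‖g₁‖ + ‖g₂‖) (schr (-1 * x) g₁) := by
      have := (hg₁.schr (-1 * x)).aebdd
      rwa [norm_schr, norm_schr] at this
    have bF : AEBdd (‖((φ k).toLp 2 volume : L2) - f‖ +
        ‖((SchwartzMap.derivCLM ℂ ℂ (φ k)).toLp 2 volume : L2) - f₁‖)
        (schr x ((φ k).toLp 2 volume) - schr x f) := by
      have := (((isD_schwartz (φ k)).sub hf).schr x).aebdd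
      rwa [norm_schr, norm_schr, map_sub] at this
    rw [dist_eq_norm, ← norm_neg, neg_sub, ← smul_sub, norm_smul, ← map_sub, norm_schr,
      add_sub_add_comm, mulL2_comm _ (schr (-1 * x) g₁), mulL2_comm _ (schr (-1 * x) g₁),
      ← mulL2_sub_right (D := 0) (Or.inl bG), mulL2_comm _ (schr (-1 * x) g₂),
      mulL2_comm _ (schr (-1 * x) g₂),
      ← mulL2_sub_right (Or.inr ⟨((isD_schwartz (φ k)).schr x).aebdd, (hf.schr x).aebdd⟩)]
    have hI : ‖-(2 * Complex.I)‖ = 2 := by simp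
    rw [hI]
    refine mul_le_mul_of_nonneg_left ((norm_add_le _ _).trans (add_le_add ?_ ?_)) (by norm_num)
    · refine (bG.norm_mulL2_le (by positivity) _).trans (le_of_eq ?_)
      rw [← map_sub, norm_schr, mul_comm]
    · rw [mulL2_comm]
      refine (bF.norm_mulL2_le (by positivity) _).trans (le_of_eq ?_)
      rw [norm_schr]
  · intro x
    have bG : AEBdd (‖g‖ + ‖g₁‖) (schr (-1 * x) g) := by
      have := (hg.schr (-1 * x)).aebdd
      rwa [norm_schr, norm_schr] at this
    simp_rw [mulL2_comm _ (schr (-1 * x) g), bG.mulL2_eq]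
    exact (((schr (-x)).continuous.comp (bmul _).continuous).comp (schr x).continuous).tendsto f
      |>.comp h0

variable {s : ℕ}

theorem comp_tail {H : ℝ → Hs s} {t : ℝ} (hi : IntegrableOn H (Ioi t)) (k : ℕ) :
    comp k (tail H t) = tail (fun τ => comp k (H τ)) t :=
  ((comp k).integral_comp_comm hi).symm

theorem comp_byParts (β : ℝ) {p : ℝ → Hs s} {C t : ℝ} (ht : 0 < t) (hc : ContinuousOn p (Ioi 0))
    (hp : ∀ τ > 0, ‖p τ‖ ≤ C) (k : ℕ) :
    comp k (byParts β p t) = byParts β (fun τ => comp k (p τ)) t := by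
  rw [byParts, byParts, map_sub, map_neg, (comp k).map_smul,
    comp_tail (integrableOn_weightDeriv_smul β ht hc hp)]
  simp_rw [(comp k).map_smul]

theorem norm_half_I_smul_le (x : Hs s) : ‖(Complex.I / 2) • x‖ ≤ ‖x‖ := by
  rw [norm_smul]
  refine mul_le_of_le_one_left (norm_nonneg _) ?_
  rw [norm_div, Complex.norm_I]; norm_num

variable [NeZero s]

/-- The product of two free waves in the interaction picture. -/
def quad (η : ℝ) (f g : Hs s) (τ : ℝ) : Hs s :=
  schrH (-τ) (mulH (schrH τ f) (schrH (η * τ) g))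

theorem norm_quad_le (η : ℝ) (f g : Hs s) (τ : ℝ) :
    ‖quad η f g τ‖ ≤ 2 ^ (s + 1) * ‖f‖ * ‖g‖ := by
  rw [quad, norm_schrH]
  refine (norm_mulH_le _ _).trans ?_
  rw [norm_schrH, norm_schrH]

theorem continuous_quad (η : ℝ) (f g : Hs s) : Continuous (quad η f g) :=
  continuous_schrH continuous_neg (continuous_mulH (continuous_schrH continuous_id continuous_const)
    (continuous_schrH (continuous_const.mul continuous_id) continuous_const))

theorem comp_zero_quad (η : ℝ) (f g : Hs s) (τ : ℝ) : comp 0 (quad η f g τ) =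
    schr (-τ) (mulL2 (schr τ (comp 0 f)) (schr (η * τ) (comp 0 g))) := by
  rw [quad, comp_schrH, comp_zero_mulH, comp_schrH, comp_schrH]

theorem comp_one_mulH (f g : Hs s) : comp 1 (mulH f g) =
    mulL2 (comp 1 f) (comp 0 g) + mulL2 (comp 0 f) (comp 1 g) := by
  have h := isD_comp (NeZero.pos s) (mulH f g)
  rw [comp_zero_mulH] at h
  exact h.unique_right ((isD_comp (NeZero.pos s) f).mulL2 (isD_comp (NeZero.pos s) g))

/-- The oscillation frequency of S(-τ)(S(τ)U)² is proportional to 2ξ₁ξ₂. Dividing by it means taking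
one primitive of each factor, so the integrand is the time derivative of (i/2) S(-τ)(S(τ)q)². -/
theorem tail_quad_one (β : ℝ) {U q : Hs s} (hq : IsD (comp 0 q) (comp 0 U)) {t : ℝ} (ht : 0 < t)
    (hi : IntegrableOn (fun τ => weight β τ • quad 1 U U τ) (Ioi t)) :
    tail (fun τ => weight β τ • quad 1 U U τ) t =
      byParts β (fun τ => (Complex.I / 2) • quad 1 q q τ) t := by
  have hb : ∀ τ > 0, ‖(Complex.I / 2) • quad 1 q q τ‖ ≤ 2 ^ (s + 1) * ‖q‖ * ‖q‖ := fun τ _ =>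
    (norm_half_I_smul_le _).trans (norm_quad_le 1 q q τ)
  have hc : Continuous fun τ => (Complex.I / 2) • quad 1 q q τ :=
    (continuous_const_smul (Complex.I / 2)).comp (continuous_quad 1 q q)
  refine Hs.ext_zero ?_
  rw [comp_tail hi, comp_byParts β ht hc.continuousOn hb]
  simp_rw [(comp 0).map_smul]
  refine tail_eq_byParts β ht (C := 2 ^ (s + 1) * ‖q‖ * ‖q‖) (fun τ hτ => ?_) (fun τ _ => ?_) ?_
  · rw [← (comp 0).map_smul]
    exact (norm_comp_le 0 _).trans (hb τ hτ)
  · have h := (hasDerivAt_schr_neg_mulL2 hq (isD_comp (NeZero.pos s) U) hq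
      (isD_comp (NeZero.pos s) U) 1 τ).const_smul (Complex.I / 2)
    refine (h.congr_of_eventuallyEq (Eventually.of_forall fun τ => ?_)).congr_deriv ?_
    · simp only [comp_zero_quad, Pi.smul_apply]
    · rw [comp_zero_quad, Complex.ofReal_one, sub_self, zero_smul, add_zero, map_smul, smul_smul,
        smul_smul]
      have : Complex.I / 2 * -Complex.I * 2 = 1 := by
        linear_combination -Complex.I_mul_I
      rw [this, one_smul]
  · have := (comp 0).integrable_comp hi
    refine this.congr (Eventually.of_forall fun τ => ?_)
    simp

/-- Here the oscillation frequency is proportional to 2ξξ₂, with ξ the output frequency. One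
primitive of the conjugate factor compensates ξ₂, while ξ is compensated by a derivative of the
whole term. Order zero therefore gains nothing, and order k + 1 is an integration by parts at order
k. -/
theorem comp_tail_quad_neg (β : ℝ) {U q : Hs s} (hq : IsD (comp 0 q) (comp 0 U)) {t : ℝ}
    (ht : 0 < t)
    (hi : IntegrableOn (fun τ => weight β τ • quad (-1) U (conjH U) τ) (Ioi t)) {k : ℕ}
    (hk : k < s) :
    comp (k + 1) (tail (fun τ => weight β τ • quad (-1) U (conjH U) τ) t) =
      comp k (byParts β (fun τ => (Complex.I / 2) • quad (-1) U (conjH q) τ) t) := by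
  have hb : ∀ τ > 0, ‖(Complex.I / 2) • quad (-1) U (conjH q) τ‖ ≤
      2 ^ (s + 1) * ‖U‖ * ‖conjH q‖ := fun τ _ =>
    (norm_half_I_smul_le _).trans (norm_quad_le (-1) U _ τ)
  have hc : Continuous fun τ => (Complex.I / 2) • quad (-1) U (conjH q) τ :=
    (continuous_const_smul (Complex.I / 2)).comp (continuous_quad (-1) U _)
  induction k with
  | zero =>
    rw [comp_tail hi, comp_byParts β ht hc.continuousOn hb]
    simp_rw [(comp _).map_smul]
    refine tail_eq_byParts β ht (C := 2 ^ (s + 1) * ‖U‖ * ‖conjH q‖) (fun τ hτ => ?_)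
      (fun τ _ => ?_) ?_
    · rw [← (comp 0).map_smul]
      exact (norm_comp_le 0 _).trans (hb τ hτ)
    · have hU := isD_comp (NeZero.pos s) U
      have h := (hasDerivAt_schr_neg_mulL2_neg hU hq.conj hU.conj τ).const_smul (Complex.I / 2)
      refine (h.congr_of_eventuallyEq (Eventually.of_forall fun τ => ?_)).congr_deriv ?_
      · simp only [comp_zero_quad, Pi.smul_apply, comp_conjH]
      · rw [quad, comp_schrH, comp_one_mulH]
        simp only [comp_schrH, comp_conjH, smul_smul, zero_add]
        have : Complex.I / 2 * (-(2 * Complex.I)) = 1 := by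
          linear_combination -Complex.I_mul_I
        rw [this, one_smul]
    · have := (comp (0 + 1)).integrable_comp hi
      refine this.congr (Eventually.of_forall fun τ => ?_)
      simp
  | succ k ih =>
    have h1 := isD_comp (k := k + 1) (by omega)
      (tail (fun τ => weight β τ • quad (-1) U (conjH U) τ) t)
    rw [ih (by omega)] at h1
    exact h1.unique_right (isD_comp (k := k) (by omega) _)

end ModifiedWave

/-! ### The source generated by the free wave and its Duhamel integral. -/

namespace ModifiedWave

variable {s : ℕ} {u : ℝ → ℂ} {δ : ℝ}

theorem tail_add {X : Type*} [NormedAddCommGroup X] [NormedSpace ℝ X] {H G : ℝ → X} {t : ℝ}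
    (hH : IntegrableOn H (Ioi t)) (hG : IntegrableOn G (Ioi t)) :
    tail (fun τ => H τ + G τ) t = tail H t + tail G t := integral_add hH hG

theorem tail_smul {X : Type*} [NormedAddCommGroup X] [NormedSpace ℂ X] (c : ℂ) (H : ℝ → X) (t : ℝ) :
    tail (fun τ => c • H τ) t = c • tail H t := integral_smul c H

/-- With x = E/√τ ≤ 1/100 and a ≤ 1 the left side is at most 7x, and 7/100 < 1/8; this fixes the
threshold √t₀/100 for all smallness conditions. -/
theorem coef_le {a E t₀ τ : ℝ} (ht₀ : 0 < t₀) (ha1 : a ≤ 1) (hE : 0 ≤ E)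
    (hE' : E ≤ √t₀ / 100) (hτ : t₀ ≤ τ) :
    6 * a * (E / √τ) + 3 * (E / √τ) ^ 2 ≤ √t₀ / 8 * (1 / √τ) := by
  have h0 : 0 < √t₀ := Real.sqrt_pos.2 ht₀
  have h1 : √t₀ ≤ √τ := Real.sqrt_le_sqrt hτ
  have h2 : 0 < √τ := h0.trans_le h1
  have h3 : E / √τ ≤ 1 / 100 := by rw [div_le_iff₀ h2]; linarith
  have h4 : 0 ≤ E / √τ := by positivity
  have h5 : E / √τ ≤ √t₀ / 100 * (1 / √τ) := by
    rw [div_eq_mul_one_div]; gcongr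
  nlinarith [mul_le_mul_of_nonneg_right ha1 h4]

theorem coef_le_eighth {a E t₀ τ : ℝ} (ht₀ : 0 < t₀) (ha1 : a ≤ 1) (hE : 0 ≤ E)
    (hE' : E ≤ √t₀ / 100) (hτ : t₀ ≤ τ) : 6 * a * (E / √τ) + 3 * (E / √τ) ^ 2 ≤ 1 / 8 := by
  refine (coef_le ht₀ ha1 hE hE' hτ).trans ?_
  have h0 : 0 < √t₀ := Real.sqrt_pos.2 ht₀
  have h1 : √t₀ ≤ √τ := Real.sqrt_le_sqrt hτ
  rw [mul_one_div, div_le_iff₀ (h0.trans_le h1)]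
  linarith

theorem continuousOn_inv_smul {X : Type*} [NormedAddCommGroup X] [NormedSpace ℂ X] {H : ℝ → X}
    {S : Set ℝ} (hS : ∀ τ ∈ S, 0 < τ) (hH : ContinuousOn H S) :
    ContinuousOn (fun τ : ℝ => (τ : ℂ)⁻¹ • H τ) S := by
  refine ContinuousOn.smul (ContinuousOn.inv₀ Complex.continuous_ofReal.continuousOn fun τ hτ => ?_)
    hH
  exact_mod_cast (hS τ hτ).ne'

theorem norm_inv_smul {X : Type*} [NormedAddCommGroup X] [NormedSpace ℂ X] {τ : ℝ} (hτ : 0 < τ)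
    (x : X) : ‖(τ : ℂ)⁻¹ • x‖ = 1 / τ * ‖x‖ := by
  rw [norm_smul, norm_inv, Complex.norm_real, Real.norm_of_nonneg hτ.le, one_div]

theorem mulH_smul_smul [NeZero s] (c d : ℂ) (f g : Hs s) :
    mulH (c • f) (d • g) = (c * d) • mulH f g := by
  rw [map_smul, map_smul, smul_apply, smul_smul, mul_comm]

namespace Data

variable (D : Data s u δ)

/-- The free wave with the phase correction. -/
def wave (β τ : ℝ) : Hs s := phase β τ • schrH τ D.U

theorem continuousOn_wave (β : ℝ) : ContinuousOn (D.wave β) (Ioi 0) :=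
  (continuousOn_phase β).smul (continuous_schrH continuous_id continuous_const).continuousOn

theorem norm_wave (β τ : ℝ) : ‖D.wave β τ‖ = ‖D.U‖ := by
  rw [wave, norm_smul, norm_phase, one_mul, norm_schrH]

theorem nonneg (D : Data s u δ) : 0 ≤ δ := (norm_nonneg _).trans D.norm_U

theorem conjH_wave (β τ : ℝ) :
    conjH (D.wave β τ) = phase (-β) τ • schrH (-τ) (conjH D.U) := by
  rw [wave, conjH_smul, conj_phase, conjH_schrH]

/-- The primitive in the time variable of the linear part of the source. -/
def linPrim (τ : ℝ) : Hs s := schrH (-2 * τ) ((Complex.I / 2) • conjH D.q₂)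

theorem norm_linPrim_le (τ : ℝ) : ‖D.linPrim τ‖ ≤ 8 * δ := by
  rw [linPrim, norm_schrH]
  exact (norm_half_I_smul_le _).trans ((norm_conjH _).le.trans D.norm_q₂)

theorem continuous_linPrim : Continuous D.linPrim :=
  continuous_schrH (continuous_const.mul continuous_id) continuous_const

/-- In the interaction picture the conjugate wave is S(-2τ)Ū, apart from its phase. It oscillates at
frequency proportional to 2ξ², so two primitives are needed; the factor i/2 normalizes since
(-2)·i·(i/2) = 1. -/
theorem hasDerivAt_linPrim (τ : ℝ) :
    HasDerivAt (fun τ => comp 0 (D.linPrim τ)) (schr (-2 * τ) (conjL2 (comp 0 D.U))) τ := by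
  have h1 := ((D.isD_q₂ 0 (Nat.zero_le s)).conj).smul (Complex.I / 2)
  have h2 := ((D.isD_q 0 (Nat.zero_le s)).conj).smul (Complex.I / 2)
  have h3 : HasDerivAt (fun τ : ℝ => -2 * τ) (-2) τ := by
    simpa using (hasDerivAt_id τ).const_mul (-2)
  have h4 := (hasDerivAt_schr h1 h2 (-2 * τ)).scomp τ h3
  refine (h4.congr_of_eventuallyEq (Eventually.of_forall fun τ => ?_)).congr_deriv ?_
  · simp only [linPrim, comp_schrH, (comp 0).map_smul, comp_conjH, Function.comp_apply]
  · have : ((-2 : ℝ) : ℂ) * (Complex.I * (Complex.I / 2)) = 1 := by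
      push_cast; linear_combination -Complex.I_mul_I
    conv_rhs => rw [← one_smul ℂ (schr (-2 * τ) (conjL2 (comp 0 D.U))), ← this, mul_smul,
      Complex.coe_smul, mul_smul]
    rw [map_smul]
    rfl

theorem norm_byParts_linPrim_le (β : ℝ) {t : ℝ} (ht : 0 < t) :
    ‖byParts (-β) D.linPrim t‖ ≤ (2 + |β|) * (8 * δ) / t := by
  have := norm_byParts_le (-β) ht fun τ _ => D.norm_linPrim_le τ
  rwa [abs_neg] at this

variable [NeZero s]

/-- The dispersive estimate, applied to every derivative of U up to order s, bounds all of them by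
δ/√τ; this is the role of W^{s,1}. The Leibniz formula supplies the factor 2^s. -/
theorem mulBdd_schrH {τ : ℝ} (hτ : 0 < τ) : MulBdd (2 ^ s * δ / √τ) (schrH τ D.U) := fun f => by
  have h0 := D.nonneg
  refine (norm_mulH_le_of_aebdd (ε := δ / √τ) (by positivity) (fun k hk => ?_) f).trans
    (le_of_eq (by ring))
  rw [comp_schrH]
  refine (aebdd_schr hτ (D.integrable k hk)).mono ?_
  gcongr
  exact D.integral_le k hk

theorem mulBdd_wave (β : ℝ) {τ : ℝ} (hτ : 0 < τ) : MulBdd (2 ^ s * δ / √τ) (D.wave β τ) :=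
  (D.mulBdd_schrH hτ).smul (norm_phase β τ).le

/-- The cubic part of the source. -/
def cubic (β τ : ℝ) : Hs s :=
  (τ : ℂ)⁻¹ • schrH (-τ) (mulH (D.wave β τ) (mulH (D.wave β τ) (conjH (D.wave β τ))))

/-- The source of the equation for the remainder, apart from its linear part. -/
def source (a β τ : ℝ) : Hs s := (τ : ℂ)⁻¹ • schrH (-τ) (nonlin a (D.wave β τ))

theorem source_eq (a β τ : ℝ) : D.source a β τ =
    (2 * a : ℂ) • (weight 0 τ • quad (-1) D.U (conjH D.U) τ) +
      (a : ℂ) • (weight (β + β) τ • quad 1 D.U D.U τ) + D.cubic β τ := by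
  have e1 : mulH (D.wave β τ) (conjH (D.wave β τ)) =
      mulH (schrH τ D.U) (schrH (-1 * τ) (conjH D.U)) := by
    rw [conjH_wave, wave, mulH_smul_smul, phase_mul, add_neg_cancel, phase_zero, one_smul,
      neg_one_mul]
  have e2 : mulH (D.wave β τ) (D.wave β τ) =
      phase (β + β) τ • mulH (schrH τ D.U) (schrH (1 * τ) D.U) := by
    rw [wave, mulH_smul_smul, phase_mul, one_mul]
  rw [source, nonlin, map_add, map_add, schrH_smul, schrH_smul, e2, e1, schrH_smul, smul_add,
    smul_add, cubic, quad, quad, weight, weight, phase_zero, mul_one, e1, smul_smul, smul_smul,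
    smul_smul, smul_smul, smul_smul]
  congr 3 <;> ring

theorem continuousOn_source (a β : ℝ) : ContinuousOn (D.source a β) (Ioi 0) :=
  continuousOn_inv_smul (fun _ h => h) (continuousOn_schrH continuous_neg.continuousOn
    ((continuous_nonlin a).comp_continuousOn (D.continuousOn_wave β)))

theorem continuousOn_cubic (β : ℝ) : ContinuousOn (D.cubic β) (Ioi 0) := by
  have h := D.continuousOn_wave β
  have h1 : Continuous fun y : Hs s => mulH y (mulH y (conjH y)) :=
    continuous_mulH continuous_id (continuous_mulH continuous_id conjH.continuous)
  exact continuousOn_inv_smul (fun _ h => h) (continuousOn_schrH continuous_neg.continuousOn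
    (h1.comp_continuousOn h))

/-- One factor decays as a multiplication operator while the other has constant H^s norm. The
resulting τ^{-3/2} is integrable and yields the rate t^{-1/2} of the full H^s norm. -/
theorem norm_weight_quad_le (β η : ℝ) (g : Hs s) {τ : ℝ} (hτ : 0 < τ) :
    ‖weight β τ • quad η D.U g τ‖ ≤ 2 ^ s * δ * ‖g‖ * (1 / (τ * √τ)) := by
  rw [norm_smul, norm_weight β hτ, quad, norm_schrH]
  have h := D.mulBdd_schrH hτ (schrH (η * τ) g)
  rw [norm_schrH] at h
  calc _ ≤ 1 / τ * (2 ^ s * δ / √τ * ‖g‖) := by gcongr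
    _ = _ := by field_simp

theorem integrableOn_weight_quad (β η : ℝ) (g : Hs s) {t : ℝ} (ht : 0 < t) :
    IntegrableOn (fun τ => weight β τ • quad η D.U g τ) (Ioi t) :=
  integrableOn_of_le_sqrt ht (((continuousOn_weight β).smul
    (continuous_quad η D.U g).continuousOn).mono (Ioi_subset_Ioi ht.le))
    fun _ hτ => D.norm_weight_quad_le β η g (ht.trans hτ)

theorem norm_cubic_le (β : ℝ) {τ : ℝ} (hτ : 0 < τ) :
    ‖D.cubic β τ‖ ≤ (2 ^ s * δ) ^ 2 * δ * (1 / τ ^ 2) := by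
  have h0 := D.nonneg
  rw [cubic, norm_inv_smul hτ, norm_schrH]
  have h1 := D.mulBdd_wave β hτ (mulH (D.wave β τ) (conjH (D.wave β τ)))
  have h2 := D.mulBdd_wave β hτ (conjH (D.wave β τ))
  rw [norm_conjH, norm_wave] at h2
  calc _ ≤ 1 / τ * (2 ^ s * δ / √τ * (2 ^ s * δ / √τ * δ)) := by
        gcongr
        refine h1.trans ?_
        gcongr
        refine h2.trans ?_
        gcongr
        exact D.norm_U
    _ = (2 ^ s * δ) ^ 2 * δ * (1 / (τ * (√τ) ^ 2)) := by field_simp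
    _ = _ := by rw [Real.sq_sqrt hτ.le, pow_two τ]

theorem integrableOn_cubic (β : ℝ) {t : ℝ} (ht : 0 < t) : IntegrableOn (D.cubic β) (Ioi t) :=
  integrableOn_of_le_sq ht ((D.continuousOn_cubic β).mono (Ioi_subset_Ioi ht.le))
    fun _ hτ => D.norm_cubic_le β (ht.trans hτ)

theorem norm_source_le {a β t₀ τ : ℝ} (ht₀ : 0 < t₀) (ha : 0 ≤ a) (ha1 : a ≤ 1)
    (hδ : 2 ^ s * δ ≤ √t₀ / 100) (hτ : t₀ ≤ τ) :
    ‖D.source a β τ‖ ≤ √t₀ / 8 * δ * (1 / (τ * √τ)) := by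
  have h0 := D.nonneg
  have hτ' := ht₀.trans_le hτ
  rw [source, norm_inv_smul hτ', norm_schrH]
  have h1 := norm_nonlin_le ha (by positivity) (D.mulBdd_wave β hτ')
  rw [norm_wave] at h1
  calc _ ≤ 1 / τ * (√t₀ / 8 * (1 / √τ) * δ) := by
        gcongr
        refine h1.trans ?_
        gcongr
        · exact coef_le ht₀ ha1 (by positivity) hδ hτ
        · exact D.norm_U
    _ = _ := by field_simp

theorem integrableOn_source (a β : ℝ) {t : ℝ} (ht : 0 < t) :
    IntegrableOn (D.source a β) (Ioi t) := by
  have h := ((((D.integrableOn_weight_quad 0 (-1) (conjH D.U) ht).smul (2 * a : ℂ)).add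
    ((D.integrableOn_weight_quad (β + β) 1 D.U ht).smul (a : ℂ))).add (D.integrableOn_cubic β ht))
  refine h.congr (Eventually.of_forall fun τ => ?_)
  rw [source_eq]
  rfl

/-- Once differentiated, both quadratic parts are O(1/t) by the normal forms, and the cubic part is
O(1/t) directly from its bound τ⁻². No smallness of C is needed: it enters only the bound on the
derivatives of the remainder. -/
theorem norm_comp_tail_source_le (a β : ℝ) (ha : 0 ≤ a) : ∃ C : ℝ, ∀ t > 0, ∀ k < s,
    ‖comp (k + 1) (tail (D.source a β) t)‖ ≤ C / t := by
  set CA : ℝ := (2 + |(0 : ℝ)|) * (2 ^ (s + 1) * ‖D.U‖ * ‖conjH D.q‖)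
  set CB : ℝ := (2 + |β + β|) * (2 ^ (s + 1) * ‖D.q‖ * ‖D.q‖)
  refine ⟨2 * a * CA + a * CB + (2 ^ s * δ) ^ 2 * δ, fun t ht k hk => ?_⟩
  have hq := D.isD_q 0 (Nat.zero_le s)
  have iA := D.integrableOn_weight_quad 0 (-1) (conjH D.U) ht
  have iB := D.integrableOn_weight_quad (β + β) 1 D.U ht
  have e : tail (D.source a β) t =
      (2 * a : ℂ) • tail (fun τ => weight 0 τ • quad (-1) D.U (conjH D.U) τ) t +
      (a : ℂ) • byParts (β + β) (fun τ => (Complex.I / 2) • quad 1 D.q D.q τ) t +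
        tail (D.cubic β) t := by
    have h1 := tail_add (iA.smul (2 * a : ℂ)) (iB.smul (a : ℂ))
    have h2 := tail_add ((iA.smul (2 * a : ℂ)).add (iB.smul (a : ℂ))) (D.integrableOn_cubic β ht)
    rw [← tail_quad_one (β + β) hq ht iB, ← tail_smul, ← tail_smul]
    refine Eq.trans ?_ (h2.trans (congrArg (· + _) h1))
    congr 1
    funext τ
    rw [source_eq]
    rfl
  have nA : ‖comp (k + 1) (tail (fun τ => weight 0 τ • quad (-1) D.U (conjH D.U) τ) t)‖ ≤
      CA / t := by
    rw [comp_tail_quad_neg 0 hq ht iA hk]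
    refine (norm_comp_le k _).trans (norm_byParts_le 0 ht fun τ _ => ?_)
    exact (norm_half_I_smul_le _).trans (norm_quad_le (-1) D.U _ τ)
  have nB : ‖comp (k + 1) (byParts (β + β) (fun τ => (Complex.I / 2) • quad 1 D.q D.q τ) t)‖ ≤
      CB / t := by
    refine (norm_comp_le _ _).trans (norm_byParts_le (β + β) ht fun τ _ => ?_)
    exact (norm_half_I_smul_le _).trans (norm_quad_le 1 D.q _ τ)
  have nC : ‖comp (k + 1) (tail (D.cubic β) t)‖ ≤ (2 ^ s * δ) ^ 2 * δ / t :=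
    (norm_comp_le _ _).trans (norm_tail_le_sq ht fun τ hτ => D.norm_cubic_le β (ht.trans hτ))
  have c1 : ‖(2 * a : ℂ)‖ = 2 * a := by
    rw [norm_mul, Complex.norm_real, Real.norm_of_nonneg ha]; simp
  have c2 : ‖(a : ℂ)‖ = a := by rw [Complex.norm_real, Real.norm_of_nonneg ha]
  rw [e, map_add, map_add, map_smul, map_smul]
  refine norm_add₃_le.trans ?_
  rw [norm_smul, norm_smul, c1, c2]
  calc _ ≤ 2 * a * (CA / t) + a * (CB / t) + (2 ^ s * δ) ^ 2 * δ / t := by gcongr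
    _ = _ := by ring

/-- The Duhamel integral of the source, in the interaction picture. -/
def duhamel (a β t : ℝ) : Hs s :=
  (a ^ 2 : ℂ) • byParts (-β) D.linPrim t + tail (D.source a β) t

theorem norm_duhamel_le {a β t₀ t : ℝ} (ht₀ : 0 < t₀) (ha : 0 ≤ a) (ha1 : a ≤ 1 / 4)
    (hβ : |β| ≤ 1) (hδ : 2 ^ s * δ ≤ √t₀ / 100) (ht : t₀ ≤ t) :
    ‖D.duhamel a β t‖ ≤ δ * (√t₀ / 4 + 2 / √t₀) / √t := by
  have h0 := D.nonneg
  have ht' := ht₀.trans_le ht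
  have h1 := D.norm_byParts_linPrim_le β ht'
  have h2 := norm_tail_le_sqrt ht' fun τ hτ =>
    D.norm_source_le (β := β) ht₀ ha (by linarith) hδ (ht.trans (le_of_lt hτ))
  have hs0 : 0 < √t₀ := Real.sqrt_pos.2 ht₀
  have hs : √t₀ ≤ √t := Real.sqrt_le_sqrt ht
  have hst : 0 < √t := hs0.trans_le hs
  -- The linear part decays like 1/t; the surplus t^{-1/2} is traded for a power of t₀ to share the
  -- weight of the nonlinear part. Its constant is a²·3·8δ ≤ 3δ/2 because a ≤ 1/4 and |β| ≤ 1.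
  have h3 : 1 / t ≤ 1 / (√t₀ * √t) := by
    refine one_div_le_one_div_of_le (by positivity) ?_
    calc √t₀ * √t ≤ √t * √t := by gcongr
      _ = t := Real.mul_self_sqrt ht'.le
  rw [duhamel]
  refine (norm_add_le _ _).trans ?_
  have h4 : ‖(a ^ 2 : ℂ) • byParts (-β) D.linPrim t‖ ≤ 2 * δ * (1 / (√t₀ * √t)) := by
    rw [norm_smul, norm_pow, Complex.norm_real, Real.norm_of_nonneg ha]
    calc _ ≤ a ^ 2 * ((2 + |β|) * (8 * δ) / t) := by gcongr
      _ ≤ (1 / 4) ^ 2 * ((2 + 1) * (8 * δ) / t) := by gcongr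
      _ ≤ 2 * δ * (1 / t) := by
        have : 0 ≤ δ * (1 / t) := by positivity
        calc _ = 3 / 2 * (δ * (1 / t)) := by ring
          _ ≤ 2 * (δ * (1 / t)) := by linarith
          _ = _ := by ring
      _ ≤ _ := by gcongr
  calc _ ≤ 2 * δ * (1 / (√t₀ * √t)) + 2 * (√t₀ / 8 * δ) / √t := add_le_add h4 h2
    _ = _ := by field_simp; ring

theorem norm_comp_duhamel_le (a β : ℝ) (ha : 0 ≤ a) : ∃ C : ℝ, ∀ t > 0, ∀ k < s,
    ‖comp (k + 1) (D.duhamel a β t)‖ ≤ C / t := by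
  obtain ⟨C, hC⟩ := D.norm_comp_tail_source_le a β ha
  refine ⟨a ^ 2 * ((2 + |β|) * (8 * δ)) + C, fun t ht k hk => ?_⟩
  rw [duhamel, map_add, map_smul]
  refine (norm_add_le _ _).trans ?_
  rw [norm_smul, norm_pow, Complex.norm_real, Real.norm_of_nonneg ha, add_div, ← mul_div]
  refine add_le_add ?_ (hC t ht k hk)
  gcongr
  exact (norm_comp_le _ _).trans (D.norm_byParts_linPrim_le β ht)

theorem continuousOn_duhamel (a β : ℝ) {t₀ : ℝ} (ht₀ : 0 < t₀) :
    ContinuousOn (D.duhamel a β) (Ici t₀) := by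
  have h1 : ContinuousOn (byParts (-β) D.linPrim) (Ici t₀) := by
    refine ContinuousOn.sub (ContinuousOn.neg ?_) (continuousOn_tail
      (integrableOn_weightDeriv_smul (-β) ht₀ D.continuous_linPrim.continuousOn
        fun τ _ => D.norm_linPrim_le τ))
    exact ((continuousOn_weight (-β)).mono (fun t ht => ht₀.trans_le ht)).smul
      D.continuous_linPrim.continuousOn
  have h2 : ContinuousOn (fun t => (a ^ 2 : ℂ) • byParts (-β) D.linPrim t) (Ici t₀) :=
    (continuous_const_smul (a ^ 2 : ℂ)).comp_continuousOn h1
  exact h2.add (continuousOn_tail (D.integrableOn_source a β ht₀))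

theorem hasDerivAt_duhamel (a β : ℝ) {t : ℝ} (ht : 0 < t) :
    HasDerivAt (fun τ => comp 0 (D.duhamel a β τ))
      (-comp 0 ((t : ℂ)⁻¹ • schrH (-t)
        ((a ^ 2 : ℂ) • conjH (D.wave β t) + nonlin a (D.wave β t)))) t := by
  have h1 := hasDerivAt_byParts (-β) (p := fun τ => comp 0 (D.linPrim τ)) (C := 8 * δ) ht
    ((comp 0).continuous.comp D.continuous_linPrim).continuousOn
    (fun τ _ => (norm_comp_le 0 _).trans (D.norm_linPrim_le τ)) (D.hasDerivAt_linPrim t)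
  have h2 := hasDerivAt_tail (D.integrableOn_source a β (half_pos ht))
    ((D.continuousOn_source a β).mono (Ioi_subset_Ioi (half_pos ht).le)) (half_lt_self ht)
  have h3 := ((comp 0).restrictScalars ℝ).hasFDerivAt.comp_hasDerivAt t h2
  have h4 := (h1.const_smul (a ^ 2 : ℂ)).add h3
  refine (h4.congr_of_eventuallyEq ?_).congr_deriv ?_
  · filter_upwards [Ioi_mem_nhds ht] with τ hτ
    rw [duhamel, map_add, map_smul, comp_byParts (-β) hτ D.continuous_linPrim.continuousOn
      (fun τ _ => D.norm_linPrim_le τ)]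
    rfl
  · rw [source, ContinuousLinearMap.coe_restrictScalars', map_neg, smul_neg, ← neg_add]
    congr 1
    rw [map_add, smul_add, map_add]
    congr 1
    rw [schrH_smul, conjH_wave, schrH_smul, ← schrH_add]
    simp only [(comp 0).map_smul, comp_schrH, comp_conjH, weight, smul_smul]
    congr 1
    · ring
    · congr 2; ring

end Data

end ModifiedWave

/-! ### The fixed-point argument for the remainder. -/

namespace ModifiedWave

variable {s : ℕ}

theorem norm_smul_schrH_le {κ : ℂ} (hκ : ‖κ‖ ≤ 1) (t : ℝ) (x : Hs s) :
    ‖κ • schrH t x‖ ≤ ‖x‖ := by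
  rw [norm_smul, norm_schrH]
  exact mul_le_of_le_one_left (norm_nonneg _) hκ

/-- Division by the weight `√t`. -/
def unscale (W : ℝ → Hs s) (t : ℝ) : Hs s := (√t)⁻¹ • W t

variable [NeZero s]

/-- The increment of the right-hand side caused by the remainder `w`, in the interaction
picture. -/
def increment (a : ℝ) (z w : ℝ → Hs s) (τ : ℝ) : Hs s :=
  (τ : ℂ)⁻¹ • schrH (-τ) (fullNonlin a (z τ + w τ) - fullNonlin a (z τ))

theorem continuousOn_increment (a : ℝ) {z w : ℝ → Hs s} {S : Set ℝ} (hS : ∀ τ ∈ S, 0 < τ)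
    (hz : ContinuousOn z S) (hw : ContinuousOn w S) : ContinuousOn (increment a z w) S :=
  continuousOn_inv_smul hS (continuousOn_schrH continuous_neg.continuousOn
    (((continuous_fullNonlin a).comp_continuousOn (hz.add hw)).sub
      ((continuous_fullNonlin a).comp_continuousOn hz)))

theorem fullNonlin_sub (a : ℝ) (z w : Hs s) : fullNonlin a (z + w) - fullNonlin a z =
    (a ^ 2 : ℂ) • (w + conjH w) + (nonlin a (z + w) - nonlin a z) := by
  rw [fullNonlin, fullNonlin, map_add, smul_add, smul_add, smul_add, smul_add, smul_add]
  abel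

/-- The data of the integral equation `w(t) = κ S(t) (K(t) + ∫_t^∞ increment)`. -/
structure Iteration (s : ℕ) [NeZero s] where
  (t₀ a ρ R S₁ : ℝ)
  κ : ℂ
  (z K : ℝ → Hs s)
  ht₀ : 0 < t₀
  ha : 0 ≤ a
  ha4 : a ≤ 1 / 4
  hκ : ‖κ‖ ≤ 1
  hρ : 0 ≤ ρ
  hR : 0 ≤ R
  hS₁ : 0 ≤ S₁
  small : ρ + 2 ^ (s + 1) * R ≤ √t₀ / 100
  continuousOn_z : ContinuousOn z (Ici t₀)
  continuousOn_K : ContinuousOn K (Ici t₀)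
  mulBdd_z : ∀ τ ≥ t₀, MulBdd (ρ / √τ) (z τ)
  norm_K : ∀ t ≥ t₀, ‖K t‖ ≤ R / 2 / √t
  norm_comp_K : ∀ t ≥ t₀, ∀ k < s, ‖comp (k + 1) (K t)‖ ≤ S₁ / t

namespace Iteration

variable (I : Iteration s)

/-- The bound for the derivatives of the remainder. -/
def R' : ℝ := 2 * (I.S₁ + √I.t₀ * I.R)

/-- The functions among which the remainder is sought. -/
structure Admissible (w : ℝ → Hs s) : Prop where
  continuousOn : ContinuousOn w (Ici I.t₀)
  norm_le : ∀ t ≥ I.t₀, ‖w t‖ ≤ I.R / √t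
  norm_comp_le : ∀ t ≥ I.t₀, ∀ k < s, ‖comp (k + 1) (w t)‖ ≤ I.R' / t

/-- The right-hand side of the integral equation. -/
def next (w : ℝ → Hs s) (t : ℝ) : Hs s :=
  I.κ • schrH t (I.K t + tail (increment I.a I.z w) t)

variable {I} {w w' : ℝ → Hs s}

theorem pos {τ : ℝ} (hτ : I.t₀ ≤ τ) : 0 < τ := I.ht₀.trans_le hτ

theorem Admissible.mulBdd (h : I.Admissible w) {τ : ℝ} (hτ : I.t₀ ≤ τ) :
    MulBdd ((I.ρ + 2 ^ (s + 1) * I.R) / √τ) (I.z τ + w τ) := by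
  refine ((I.mulBdd_z τ hτ).add (mulBdd_norm (w τ))).mono ?_
  rw [add_div, mul_div_assoc]
  gcongr
  exact h.norm_le τ hτ

theorem mulBdd_z' {τ : ℝ} (hτ : I.t₀ ≤ τ) : MulBdd ((I.ρ + 2 ^ (s + 1) * I.R) / √τ) (I.z τ) := by
  refine (I.mulBdd_z τ hτ).mono ?_
  have := I.hR
  gcongr
  exact le_add_of_nonneg_right (by positivity)

theorem nonneg_E : 0 ≤ I.ρ + 2 ^ (s + 1) * I.R := by
  have := I.hR; have := I.hρ; positivity

/-- The linear coefficient 2a² and the nonlinear one are each at most 1/8. Integrating τ^{-3/2}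
doubles the resulting 1/4, which makes the contraction constant 1/2. -/
theorem norm_increment_sub_le (h : I.Admissible w) (h' : I.Admissible w') {τ d : ℝ}
    (hτ : I.t₀ ≤ τ) (hd : ‖w τ - w' τ‖ ≤ d / √τ) :
    ‖increment I.a I.z w τ - increment I.a I.z w' τ‖ ≤ d / 4 * (1 / (τ * √τ)) := by
  have hp := pos hτ
  have hE := nonneg_E (I := I)
  rw [increment, increment, ← smul_sub, ← map_sub, norm_inv_smul hp, norm_schrH,
    sub_sub_sub_cancel_right]
  have h1 := norm_fullNonlin_sub_le I.ha (by positivity) (h.mulBdd hτ) (h'.mulBdd hτ)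
  rw [add_sub_add_left_eq_sub] at h1
  have h2 := coef_le_eighth I.ht₀ (by linarith [I.ha4] : I.a ≤ 1) hE I.small hτ
  have h3 : 2 * I.a ^ 2 ≤ 1 / 8 := by nlinarith [I.ha, I.ha4]
  calc _ ≤ 1 / τ * (1 / 4 * (d / √τ)) := by
        gcongr
        refine h1.trans ?_
        have hd0 := norm_nonneg (w τ - w' τ)
        gcongr
        linarith
    _ = _ := by field_simp

variable (I) in
theorem admissible_zero : I.Admissible (0 : ℝ → Hs s) where
  continuousOn := continuousOn_const
  norm_le t ht := by
    have := I.hR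
    rw [Pi.zero_apply, norm_zero]; positivity
  norm_comp_le t ht k _ := by
    have := I.hR; have := I.hS₁; have := pos ht
    rw [Pi.zero_apply, map_zero, norm_zero, R']; positivity

theorem increment_zero (a : ℝ) (z : ℝ → Hs s) (τ : ℝ) : increment a z 0 τ = 0 := by
  simp [increment]

theorem Admissible.norm_increment_le (h : I.Admissible w) {τ : ℝ} (hτ : I.t₀ ≤ τ) :
    ‖increment I.a I.z w τ‖ ≤ I.R / 4 * (1 / (τ * √τ)) := by
  have := norm_increment_sub_le h I.admissible_zero hτ
    (by simpa using h.norm_le τ hτ : ‖w τ - (0 : ℝ → Hs s) τ‖ ≤ I.R / √τ)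
  rwa [increment_zero, sub_zero] at this

theorem Admissible.continuousOn_increment (h : I.Admissible w) :
    ContinuousOn (increment I.a I.z w) (Ici I.t₀) :=
  ModifiedWave.continuousOn_increment I.a (fun _ h => pos h) I.continuousOn_z h.continuousOn

theorem Admissible.integrableOn (h : I.Admissible w) {t : ℝ} (ht : I.t₀ ≤ t) :
    IntegrableOn (increment I.a I.z w) (Ioi t) :=
  integrableOn_of_le_sqrt (pos ht) (h.continuousOn_increment.mono fun _ hτ => ht.trans (le_of_lt hτ))
    fun _ hτ => h.norm_increment_le (ht.trans (le_of_lt hτ))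

/-- The linear part a²(w + w̄) commutes with derivatives and inherits R'/τ with a small factor. In
the nonlinear part derivatives need not be tracked: its coefficient and w both carry τ^{-1/2} in
H^s, which already gives 1/τ. -/
theorem Admissible.norm_comp_increment_le (h : I.Admissible w) {τ : ℝ} (hτ : I.t₀ ≤ τ) {k : ℕ}
    (hk : k < s) : ‖comp (k + 1) (increment I.a I.z w τ)‖ ≤
      (I.R' / 8 + √I.t₀ / 8 * I.R) * (1 / τ ^ 2) := by
  have hp := pos hτ
  have hE := nonneg_E (I := I)
  have hR := I.hR
  rw [increment, map_smul, norm_inv_smul hp, comp_schrH, norm_schr, fullNonlin_sub, map_add,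
    map_smul, map_add, comp_conjH]
  have h1 := norm_nonlin_sub_le I.ha (by positivity) (h.mulBdd hτ) (mulBdd_z' hτ)
  rw [add_sub_cancel_left] at h1
  have h2 := coef_le I.ht₀ (by linarith [I.ha4] : I.a ≤ 1) hE I.small hτ
  have h3 : 2 * I.a ^ 2 ≤ 1 / 8 := by nlinarith [I.ha, I.ha4]
  have h4 := h.norm_comp_le τ hτ k hk
  have h5 : ‖(I.a ^ 2 : ℂ) • (comp (k + 1) (w τ) + conjL2 (comp (k + 1) (w τ)))‖ ≤
      I.R' / 8 * (1 / τ) := by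
    rw [norm_smul, norm_pow, Complex.norm_real, Real.norm_of_nonneg I.ha]
    calc _ ≤ I.a ^ 2 * (2 * (I.R' / τ)) := by
          gcongr
          refine (norm_add_le _ _).trans ?_
          rw [norm_conjL2]; linarith
      _ = 2 * I.a ^ 2 * (I.R' / τ) := by ring
      _ ≤ 1 / 8 * (I.R' / τ) :=
          mul_le_mul_of_nonneg_right h3 ((norm_nonneg _).trans h4)
      _ = _ := by ring
  have h6 : ‖comp (k + 1) (nonlin I.a (I.z τ + w τ) - nonlin I.a (I.z τ))‖ ≤
      √I.t₀ / 8 * I.R * (1 / τ) := by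
    refine (ModifiedWave.norm_comp_le _ _).trans (h1.trans ?_)
    calc _ ≤ √I.t₀ / 8 * (1 / √τ) * (I.R / √τ) := by
          gcongr
          exact h.norm_le τ hτ
      _ = √I.t₀ / 8 * I.R * (1 / (√τ * √τ)) := by field_simp
      _ = _ := by rw [Real.mul_self_sqrt hp.le]
  calc _ ≤ 1 / τ * (I.R' / 8 * (1 / τ) + √I.t₀ / 8 * I.R * (1 / τ)) := by
        gcongr
        exact (norm_add_le _ _).trans (add_le_add h5 h6)
    _ = _ := by ring

theorem Admissible.next (h : I.Admissible w) : I.Admissible (I.next w) where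
  continuousOn :=
    (continuous_const_smul I.κ).comp_continuousOn (continuousOn_schrH continuousOn_id
      (I.continuousOn_K.add (continuousOn_tail (h.integrableOn le_rfl))))
  norm_le t ht := by
    refine (norm_smul_schrH_le I.hκ _ _).trans ((norm_add_le _ _).trans ?_)
    have h1 := norm_tail_le_sqrt (pos ht)
      fun τ hτ => h.norm_increment_le (ht.trans (le_of_lt hτ))
    -- The budget is R/2 from K and 2·R/4 from the increment.
    refine (add_le_add (I.norm_K t ht) h1).trans (le_of_eq ?_)
    ring
  norm_comp_le t ht k hk := by
    have hp := pos ht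
    have hR := I.hR
    rw [Iteration.next, map_smul, comp_schrH, norm_smul, norm_schr]
    refine (mul_le_of_le_one_left (norm_nonneg _) I.hκ).trans ?_
    rw [map_add, comp_tail (h.integrableOn ht)]
    have h1 := norm_tail_le_sq hp
      fun τ hτ => h.norm_comp_increment_le (ht.trans (le_of_lt hτ)) hk
    refine (norm_add_le _ _).trans ((add_le_add (I.norm_comp_K t ht k hk) h1).trans ?_)
    rw [← add_div]
    gcongr
    have := I.hS₁
    have h0 : 0 ≤ √I.t₀ * I.R := by positivity
    -- The requirement is S₁ + R'/8 + √t₀R/8 ≤ R'. It is linear in R', so a large R' suffices and S₁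
    -- need not be small.
    rw [R']; linarith

theorem norm_next_sub_le (h : I.Admissible w) (h' : I.Admissible w') {d : ℝ}
    (hd : ∀ τ ≥ I.t₀, ‖w τ - w' τ‖ ≤ d / √τ) {t : ℝ} (ht : I.t₀ ≤ t) :
    ‖I.next w t - I.next w' t‖ ≤ d / 2 / √t := by
  have e : I.next w t - I.next w' t =
      I.κ • schrH t (tail (fun τ => increment I.a I.z w τ - increment I.a I.z w' τ) t) := by
    rw [next, next, ← smul_sub, ← map_sub, add_sub_add_left_eq_sub, tail, tail, tail,
      integral_sub (h.integrableOn ht) (h'.integrableOn ht)]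
  rw [e]
  refine (norm_smul_schrH_le I.hκ _ _).trans ?_
  have := norm_tail_le_sqrt (pos ht) fun τ hτ =>
    norm_increment_sub_le h h' (ht.trans (le_of_lt hτ)) (hd τ (ht.trans (le_of_lt hτ)))
  refine this.trans (le_of_eq ?_)
  ring

theorem Admissible.congr (h : I.Admissible w) (hw : ∀ t ≥ I.t₀, w' t = w t) :
    I.Admissible w' where
  continuousOn := h.continuousOn.congr hw
  norm_le t ht := by rw [hw t ht]; exact h.norm_le t ht
  norm_comp_le t ht k hk := by rw [hw t ht]; exact h.norm_comp_le t ht k hk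

/-- Every derivative is continuous on H^s, so its pointwise bound survives uniform limits. The bound
need not enter the metric, and the contraction need only be checked for the √t-weighted norm. -/
theorem isClosed_admissible :
    IsClosed {W : BoundedContinuousFunction ℝ (Hs s) | I.Admissible (unscale W)} := by
  have hcont : ∀ t, Continuous fun W : BoundedContinuousFunction ℝ (Hs s) => unscale W t :=
    fun t => (continuous_const_smul (√t)⁻¹).comp
      (continuous_eval_const t)
  have e : {W : BoundedContinuousFunction ℝ (Hs s) | I.Admissible (unscale W)} =
      (⋂ t, ⋂ (_ : t ≥ I.t₀), {W : BoundedContinuousFunction ℝ (Hs s) | ‖unscale W t‖ ≤ I.R / √t}) ∩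
      ⋂ t, ⋂ (_ : t ≥ I.t₀), ⋂ k, ⋂ (_ : k < s), {W : BoundedContinuousFunction ℝ (Hs s) |
        ‖comp (k + 1) (unscale W t)‖ ≤ I.R' / t} := by
    ext W
    simp only [mem_inter_iff, mem_iInter, Set.mem_ofPred_eq]
    refine ⟨fun h => ⟨h.norm_le, h.norm_comp_le⟩, fun h => ⟨?_, h.1, h.2⟩⟩
    have h1 : ContinuousOn (fun t : ℝ => (√t)⁻¹) (Ici I.t₀) :=
      ContinuousOn.inv₀ Real.continuous_sqrt.continuousOn fun t ht => (Real.sqrt_pos.2 (pos ht)).ne'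
    exact h1.smul W.continuous.continuousOn
  rw [e]
  refine IsClosed.inter ?_ ?_
  · exact isClosed_iInter fun t => isClosed_iInter fun _ =>
      isClosed_le (hcont t).norm continuous_const
  · exact isClosed_iInter fun t => isClosed_iInter fun _ => isClosed_iInter fun k =>
      isClosed_iInter fun _ => isClosed_le ((comp (k + 1)).continuous.comp (hcont t)).norm
        continuous_const

variable (I) in
/-- The rescaled right-hand side of the integral equation, constant for `t ≤ t₀`. -/
def scaledNext (w : ℝ → Hs s) (t : ℝ) : Hs s := √(max t I.t₀) • I.next w (max t I.t₀)

theorem Admissible.continuous_scaledNext (h : I.Admissible w) : Continuous (I.scaledNext w) := by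
  have hm : Continuous fun t : ℝ => max t I.t₀ := continuous_id.max continuous_const
  exact (Real.continuous_sqrt.comp hm).smul
    (h.next.continuousOn.comp_continuous hm fun t => le_max_right t I.t₀)

theorem sqrt_mul_div {t c : ℝ} (ht : I.t₀ ≤ t) : √t * (c / √t) = c :=
  mul_div_cancel₀ c (Real.sqrt_pos.2 (pos ht)).ne'

theorem Admissible.norm_scaledNext_le (h : I.Admissible w) (t : ℝ) :
    ‖I.scaledNext w t‖ ≤ I.R := by
  have hm := le_max_right t I.t₀
  rw [scaledNext, norm_smul, Real.norm_of_nonneg (Real.sqrt_nonneg _)]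
  refine (mul_le_mul_of_nonneg_left (h.next.norm_le _ hm) (Real.sqrt_nonneg _)).trans (le_of_eq ?_)
  exact sqrt_mul_div hm

theorem unscale_scaledNext (w : ℝ → Hs s) {t : ℝ} (ht : I.t₀ ≤ t) :
    unscale (I.scaledNext w) t = I.next w t := by
  rw [unscale, scaledNext, max_eq_left ht, smul_smul,
    inv_mul_cancel₀ (Real.sqrt_pos.2 (pos ht)).ne', one_smul]

variable (I) in
-- The unknown is √t w(t), extended as a constant to the left of t₀, so that the iteration acts on a
-- closed set of bounded continuous functions on ℝ.
theorem exists_solution : ∃ w, I.Admissible w ∧ ∀ t ≥ I.t₀, w t = I.next w t := by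
  let 𝒦 := {W : BoundedContinuousFunction ℝ (Hs s) // I.Admissible (unscale W)}
  have : CompleteSpace 𝒦 := (isClosed_admissible (I := I)).completeSpace_coe
  have h0 : I.Admissible (unscale (0 : BoundedContinuousFunction ℝ (Hs s))) :=
    I.admissible_zero.congr fun t _ => by simp [unscale]
  have : Nonempty 𝒦 := ⟨⟨0, h0⟩⟩
  let Φ : 𝒦 → 𝒦 := fun W =>
    ⟨BoundedContinuousFunction.ofNormedAddCommGroup (I.scaledNext (unscale W.1))
      W.2.continuous_scaledNext I.R W.2.norm_scaledNext_le,
      W.2.next.congr fun t ht => unscale_scaledNext _ ht⟩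
  have hΦ : ContractingWith (1 / 2) Φ := by
    refine ⟨by norm_num, LipschitzWith.of_dist_le_mul fun W W' => ?_⟩
    refine (BoundedContinuousFunction.dist_le (by positivity)).2 fun t => ?_
    have hm := le_max_right t I.t₀
    have hd : ∀ τ ≥ I.t₀, ‖unscale W.1 τ - unscale W'.1 τ‖ ≤ dist W W' / √τ := fun τ hτ => by
      rw [unscale, unscale, ← smul_sub, norm_smul, Real.norm_of_nonneg (by positivity),
        inv_mul_eq_div, ← dist_eq_norm]
      exact div_le_div_of_nonneg_right (BoundedContinuousFunction.dist_coe_le_dist τ)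
        (Real.sqrt_nonneg _)
    have h1 := norm_next_sub_le W.2 W'.2 hd hm
    change dist (I.scaledNext (unscale W.1) t) (I.scaledNext (unscale W'.1) t) ≤ _
    rw [dist_eq_norm, scaledNext, scaledNext, ← smul_sub, norm_smul,
      Real.norm_of_nonneg (Real.sqrt_nonneg _)]
    refine (mul_le_mul_of_nonneg_left h1 (Real.sqrt_nonneg _)).trans (le_of_eq ?_)
    rw [sqrt_mul_div hm]
    push_cast; ring
  refine ⟨unscale (ContractingWith.fixedPoint Φ hΦ).1, (ContractingWith.fixedPoint Φ hΦ).2,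
    fun t ht => ?_⟩
  have h := congrArg Subtype.val (hΦ.fixedPoint_isFixedPt (f := Φ)).eq
  rw [← unscale_scaledNext _ ht]
  conv_lhs => rw [← h]
  rfl

end Iteration

end ModifiedWave

/-! ### From the weak formulation to the equation in the interaction picture. -/

namespace ModifiedWave

theorem intervalIntegrable_of_continuousOn_Ioi {X : Type*} [NormedAddCommGroup X] {f : ℝ → X}
    {t₀ t₁ t : ℝ} (hf : ContinuousOn f (Ioi t₀)) (h₁ : t₀ < t₁) (h : t₀ < t) :
    IntervalIntegrable f volume t₁ t :=
  (hf.mono fun _ hx => lt_of_lt_of_le (lt_min h₁ h) hx.1).intervalIntegrable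

theorem hasDerivAt_primitive {X : Type*} [NormedAddCommGroup X] [NormedSpace ℝ X]
    [CompleteSpace X] {f : ℝ → X} {t₀ t₁ t : ℝ}
    (hf : ContinuousOn f (Ioi t₀)) (h₁ : t₀ < t₁) (h : t₀ < t) :
    HasDerivAt (fun τ => ∫ r in t₁..τ, f r) (f t) t :=
  intervalIntegral.integral_hasDerivAt_right (intervalIntegrable_of_continuousOn_Ioi hf h₁ h)
    (hf.stronglyMeasurableAtFilter isOpen_Ioi t h) (hf.continuousAt (Ioi_mem_nhds h))

/-- A test function as an element of `L²`. -/
def testL2 (φ : ℝ → ℝ) (hφ : ContDiff ℝ ∞ φ) (hc : HasCompactSupport φ) : L2 :=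
  (ofTest φ hφ hc).toLp 2 volume

theorem pairing_testL2 {φ : ℝ → ℝ} (hφ : ContDiff ℝ ∞ φ) (hc : HasCompactSupport φ) (f : L2) :
    pairing (testL2 φ hφ hc) f = ∫ x, φ x • f x := pairing_ofTest hφ hc f

theorem isD_testL2 {φ : ℝ → ℝ} (hφ : ContDiff ℝ ∞ φ) (hc : HasCompactSupport φ) :
    IsD (testL2 φ hφ hc) (testL2 (deriv φ) (contDiff_deriv hφ) hc.deriv) := by
  have := isD_schwartz (ofTest φ hφ hc)
  rwa [derivCLM_ofTest] at this

theorem iteratedDeriv_two_eq (φ : ℝ → ℝ) : iteratedDeriv 2 φ = deriv (deriv φ) := by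
  rw [iteratedDeriv_succ, iteratedDeriv_one]

theorem integral_iteratedDeriv_two {φ : ℝ → ℝ} (hφ : ContDiff ℝ ∞ φ) (hc : HasCompactSupport φ) :
    ∫ x, iteratedDeriv 2 φ x = 0 := by
  rw [iteratedDeriv_two_eq]
  have h1 := contDiff_deriv hφ
  have h2 := contDiff_deriv h1
  exact integral_eq_zero_of_hasDerivAt_of_integrable
    (fun x => ((h1.differentiable (by simp)) x).hasDerivAt)
    (h2.continuous.integrable_of_hasCompactSupport hc.deriv.deriv)
    (h1.continuous.integrable_of_hasCompactSupport hc.deriv)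

/-- The weak form of `i f_t + f_xx + i g = 0`, tested at time `t`. -/
def WeakEq (f : ℝ → L2) (g : L2) (t : ℝ) : Prop :=
  ∀ (φ : ℝ → ℝ) (hφ : ContDiff ℝ ∞ φ) (hc : HasCompactSupport φ),
    HasDerivAt (fun τ => pairing (testL2 φ hφ hc) (f τ))
      (Complex.I * pairing (testL2 (deriv (deriv φ)) (contDiff_deriv (contDiff_deriv hφ))
        hc.deriv.deriv) (f t) + pairing (testL2 φ hφ hc) g) t

theorem WeakEq.sub {f f' : ℝ → L2} {g g' : L2} {t : ℝ} (h : WeakEq f g t) (h' : WeakEq f' g' t) :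
    WeakEq (fun τ => f τ - f' τ) (g - g') t := fun φ hφ hc => by
  have := (h φ hφ hc).sub (h' φ hφ hc)
  simp only [map_sub]
  refine this.congr_deriv ?_
  ring

/-- Pairing f(τ) with φ equals pairing S(-τ)f(τ) with S(τ)φ. The second factor is differentiable
because φ is smooth, and the product rule yields the weak form. -/
theorem weakEq_of_hasDerivAt {f : ℝ → L2} {g : L2} {t : ℝ}
    (h : HasDerivAt (fun τ => schr (-τ) (f τ)) (schr (-t) g) t) : WeakEq f g t := by
  intro φ hφ hc
  have h1 := hasDerivAt_schr (isD_testL2 hφ hc) (isD_testL2 (contDiff_deriv hφ) hc.deriv) t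
  set T := testL2 φ hφ hc
  set T₂ := testL2 (deriv (deriv φ)) (contDiff_deriv (contDiff_deriv hφ)) hc.deriv.deriv
  have h2 := ((pairing.flip (schr (-t) (f t))).restrictScalars ℝ).hasFDerivAt.comp_hasDerivAt t h1
  have hp : ∀ x : L2, Continuous fun τ => pairing (schr τ T) x := fun x =>
    (pairing.flip x).continuous.comp (continuous_schr_apply T)
  have h3 := hasDerivAt_family (Φ := fun τ => (pairing (schr τ T)).restrictScalars ℝ)
    (C := ‖pairing‖ * ‖T‖)
    (Eventually.of_forall fun τ x => by
      refine (pairing.le_opNorm₂ (schr τ T) x).trans ?_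
      rw [norm_schr])
    ((hp (schr (-t) g)).tendsto t) h2 h
  refine (h3.congr_of_eventuallyEq (Eventually.of_forall fun τ => ?_)).congr_deriv ?_
  · simp only [ContinuousLinearMap.coe_restrictScalars']
    rw [pairing_schr, schr_schr_neg]
  · simp only [ContinuousLinearMap.coe_restrictScalars', ContinuousLinearMap.flip_apply]
    rw [pairing_schr, schr_schr_neg, map_smul, smul_apply, pairing_schr, schr_schr_neg, smul_eq_mul,
      add_comm]

theorem IsD.intervalIntegral {f f₁ : ℝ → L2} (h : ∀ t, IsD (f t) (f₁ t)) {a b : ℝ}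
    (hf : IntervalIntegrable f volume a b) (hf₁ : IntervalIntegrable f₁ volume a b) :
    IsD (∫ t in a..b, f t) (∫ t in a..b, f₁ t) := by
  rw [IsD, ← ContinuousLinearMap.intervalIntegral_comp_comm _ hf,
    ← ContinuousLinearMap.intervalIntegral_comp_comm _ hf₁]
  exact intervalIntegral.integral_congr fun t _ => h t

/-- Uniqueness for the free equation in its weak form. -/
theorem eq_zero_of_weakEq {h h₁ : ℝ → L2} {t₀ t₁ : ℝ} (h01 : t₀ < t₁)
    (hc : ContinuousOn h (Ioi t₀)) (hc₁ : ContinuousOn h₁ (Ioi t₀))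
    (hD : ∀ t, IsD (h t) (h₁ t)) (hw : ∀ t > t₀, WeakEq h 0 t) (hz : h t₁ = 0) {t : ℝ}
    (ht : t₁ ≤ t) : h t = 0 := by
  -- Integration in time gains two spatial derivatives: the weak equation gives ∂_x²D = -ih. Thus D
  -- is a strong solution of the free equation with D(t₁) = 0, S(-τ)D(τ) is constant, D vanishes and
  -- so does h = D'.
  let D : ℝ → L2 := fun τ => ∫ r in t₁..τ, h r
  let D₁ : ℝ → L2 := fun τ => ∫ r in t₁..τ, h₁ r
  have hint : ∀ τ > t₀, IntervalIntegrable h volume t₁ τ := fun τ hτ =>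
    intervalIntegrable_of_continuousOn_Ioi hc h01 hτ
  have d01 : ∀ τ > t₀, IsD (D τ) (D₁ τ) := fun τ hτ => IsD.intervalIntegral hD (hint τ hτ)
    (intervalIntegrable_of_continuousOn_Ioi hc₁ h01 hτ)
  have d12 : ∀ τ > t₀, IsD (D₁ τ) (-Complex.I • h τ) := fun τ hτ => by
    refine HasWeakDeriv.isD ⟨locallyIntegrable_L2 _, locallyIntegrable_L2 _, fun φ hφ hφc => ?_⟩
    rw [iteratedDeriv_one, ← pairing_testL2 (contDiff_deriv hφ) hφc.deriv,
      ← pairing_testL2 hφ hφc]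
    have e1 := (isD_testL2 (contDiff_deriv hφ) hφc.deriv).pairing_eq (d01 τ hτ)
    set T := testL2 φ hφ hφc
    set T₂ := testL2 (deriv (deriv φ)) (contDiff_deriv (contDiff_deriv hφ)) hφc.deriv.deriv with hT₂
    have hcp : ContinuousOn (fun r => Complex.I * pairing T₂ (h r)) (Ioi t₀) :=
      continuousOn_const.mul ((pairing T₂).continuous.comp_continuousOn hc)
    have e2 := intervalIntegral.integral_eq_sub_of_hasDerivAt (a := t₁) (b := τ)
      (f := fun r => pairing T (h r)) (f' := fun r => Complex.I * pairing T₂ (h r))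
      (fun r hr => by
        have hr' : t₀ < r := lt_of_lt_of_le (lt_min h01 hτ) hr.1
        simpa using hw r hr' φ hφ hφc)
      (intervalIntegrable_of_continuousOn_Ioi hcp h01 hτ)
    rw [intervalIntegral.integral_const_mul,
      ContinuousLinearMap.intervalIntegral_comp_comm (pairing T₂) (hint τ hτ), hz, map_zero,
      sub_zero] at e2
    rw [map_smul, ← e2, smul_eq_mul]
    have e3 : pairing T₂ (D τ) = -pairing (testL2 (deriv φ) (contDiff_deriv hφ) hφc.deriv) (D₁ τ) :=
      e1
    change _ = (-1) ^ 1 * (-Complex.I * (Complex.I * pairing T₂ (D τ)))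
    rw [e3]
    linear_combination pairing (testL2 (deriv φ) (contDiff_deriv hφ) hφc.deriv) (D₁ τ) *
      Complex.I_mul_I
  have hder : ∀ τ > t₀, HasDerivAt (fun τ => schr (-τ) (D τ)) 0 τ := fun τ hτ => by
    have := hasDerivAt_schr_neg_apply (hasDerivAt_primitive hc h01 hτ) (d01 τ hτ) (d12 τ hτ)
    refine this.congr_deriv ?_
    rw [smul_smul]
    have : Complex.I * -Complex.I = 1 := by linear_combination -Complex.I_mul_I
    rw [this, one_smul, sub_self, map_zero]
  have hDz : ∀ τ ≥ t₁, D τ = 0 := fun τ hτ => by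
    have := constant_of_has_deriv_right_zero (f := fun τ => schr (-τ) (D τ)) (a := t₁) (b := τ)
      (fun r hr => (hder r (h01.trans_le hr.1)).continuousAt.continuousWithinAt)
      (fun r hr => (hder r (h01.trans_le hr.1)).hasDerivWithinAt) τ (right_mem_Icc.2 hτ)
    simp only [D, intervalIntegral.integral_same, map_zero] at this
    rw [← norm_eq_zero, norm_schr, norm_eq_zero] at this
    exact this
  rcases ht.eq_or_lt with rfl | ht'
  · exact hz
  · have h1 := hasDerivAt_primitive hc h01 (h01.trans ht')
    have h2 : HasDerivAt D 0 t := by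
      refine (hasDerivAt_const t (0 : L2)).congr_of_eventuallyEq ?_
      filter_upwards [Ioi_mem_nhds ht'] with τ hτ
      exact hDz τ (le_of_lt hτ)
    exact h1.unique h2

variable {s : ℕ} [NeZero s]

/-- A weak solution which is continuous in `H^s` solves the equation in the interaction picture. -/
theorem hasDerivAt_of_weakEq {y g : ℝ → Hs s} {t₀ t : ℝ} (hy : ContinuousOn y (Ioi t₀))
    (hg : ContinuousOn g (Ioi t₀))
    (hw : ∀ t > t₀, WeakEq (fun τ => comp 0 (y τ)) (comp 0 (g t)) t) (ht : t₀ < t) :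
    HasDerivAt (fun τ => schrH (-τ) (y τ)) (schrH (-t) (g t)) t := by
  obtain ⟨t₁, h01, h1t⟩ := exists_between ht
  have hG : ContinuousOn (fun r => schrH (-r) (g r)) (Ioi t₀) :=
    continuousOn_schrH continuous_neg.continuousOn hg
  let Y : ℝ → Hs s := fun τ => schrH (-t₁) (y t₁) + ∫ r in t₁..τ, schrH (-r) (g r)
  have hY : ∀ τ > t₀, HasDerivAt Y (schrH (-τ) (g τ)) τ := fun τ hτ =>
    (hasDerivAt_primitive hG h01 hτ).const_add _
  have hYc : ContinuousOn Y (Ioi t₀) := fun τ hτ => (hY τ hτ).continuousAt.continuousWithinAt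
  -- The difference of y and the Duhamel solution with the same value at t₁ solves the free equation
  -- weakly. It vanishes on [t₁,∞), which is a neighbourhood of t since t₁ < t.
  let h : ℝ → Hs s := fun τ => y τ - schrH τ (Y τ)
  have hh : ContinuousOn h (Ioi t₀) := hy.sub (continuousOn_schrH continuousOn_id hYc)
  have hzero : ∀ τ ≥ t₁, h τ = 0 := fun τ hτ => by
    refine Hs.ext_zero ?_
    rw [map_zero]
    refine eq_zero_of_weakEq (h := fun τ => comp 0 (h τ)) (h₁ := fun τ => comp 1 (h τ)) h01
      ((comp 0).continuous.comp_continuousOn hh) ((comp 1).continuous.comp_continuousOn hh)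
      (fun r => isD_comp (NeZero.pos s) (h r)) (fun r hr => ?_) ?_ hτ
    · have h1 : WeakEq (fun τ => comp 0 (schrH τ (Y τ))) (comp 0 (g r)) r := by
        refine weakEq_of_hasDerivAt ?_
        have h2 := ((comp 0).restrictScalars ℝ).hasFDerivAt.comp_hasDerivAt r (hY r hr)
        refine (h2.congr_of_eventuallyEq (Eventually.of_forall fun τ => ?_)).congr_deriv ?_
        · rw [comp_schrH, schr_neg_schr]; rfl
        · rw [ContinuousLinearMap.coe_restrictScalars', comp_schrH]
      have h3 := (hw r hr).sub h1
      simp only [sub_self] at h3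
      simpa only [h, map_sub] using h3
    · simp only [h, Y, intervalIntegral.integral_same, add_zero, schrH_schrH_neg, sub_self, map_zero]
  refine (hY t ht).congr_of_eventuallyEq ?_
  filter_upwards [Ioi_mem_nhds h1t] with τ hτ
  have := hzero τ (le_of_lt hτ)
  rw [sub_eq_zero.1 this, schrH_neg_schrH]

/-- The weak formulation in terms of the perturbation `y = v - a`. -/
theorem isSolution_iff {σ a t₀ : ℝ} {v : ℝ → ℝ → ℂ} {y : ℝ → Hs s}
    (hv : ∀ t > t₀, v t =ᵐ[volume] fun x => (a : ℂ) + comp 0 (y t) x) :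
    IsSolution σ a t₀ v ↔ ∀ t > t₀, WeakEq (fun τ => comp 0 (y τ))
      (comp 0 ((Complex.I * (σ / t)) • fullNonlin a (y t))) t := by
  have key : ∀ (φ : ℝ → ℝ) (hφ : ContDiff ℝ ∞ φ) (hc : HasCompactSupport φ), ∀ t > t₀,
      ∫ x, φ x • v t x = (∫ x, φ x • (a : ℂ)) + pairing (testL2 φ hφ hc) (comp 0 (y t)) := by
    intro φ hφ hc t ht
    rw [pairing_testL2, ← integral_add]
    · refine integral_congr_ae ?_
      filter_upwards [hv t ht] with x hx
      rw [hx, smul_add]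
    · exact integrable_test_smul hφ.continuous hc continuous_const.locallyIntegrable
    · exact integrable_test_smul hφ.continuous hc (locallyIntegrable_L2 _)
  have key2 : ∀ (φ : ℝ → ℝ) (hφ : ContDiff ℝ ∞ φ) (hc : HasCompactSupport φ), ∀ t > t₀,
      ∫ x, iteratedDeriv 2 φ x • v t x = pairing (testL2 (deriv (deriv φ))
        (contDiff_deriv (contDiff_deriv hφ)) hc.deriv.deriv) (comp 0 (y t)) := by
    intro φ hφ hc t ht
    -- The constant a, which is not in L², disappears here because ∫φ'' = 0; on the left it adds a
    -- term independent of time.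
    have h0 := integral_iteratedDeriv_two hφ hc
    rw [iteratedDeriv_two_eq] at h0 ⊢
    rw [key _ (contDiff_deriv (contDiff_deriv hφ)) hc.deriv.deriv t ht, integral_smul_const, h0,
      zero_smul, zero_add]
  have key3 : ∀ (φ : ℝ → ℝ) (hφ : ContDiff ℝ ∞ φ) (hc : HasCompactSupport φ), ∀ t > t₀,
      ∫ x, φ x • (((‖v t x‖ ^ 2 - a ^ 2 : ℝ) : ℂ) * v t x) =
        pairing (testL2 φ hφ hc) (comp 0 (fullNonlin a (y t))) := by
    intro φ hφ hc t ht
    rw [pairing_testL2]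
    refine integral_congr_ae ?_
    filter_upwards [hv t ht, coeFn_fullNonlin a (y t)] with x h1 h2
    rw [h1, h2]
  have main : ∀ (φ : ℝ → ℝ) (hφ : ContDiff ℝ ∞ φ) (hc : HasCompactSupport φ), ∀ t > t₀,
      (HasDerivAt (fun τ : ℝ => ∫ x, φ x • v τ x)
        (Complex.I * ((∫ x, iteratedDeriv 2 φ x • v t x) +
        (σ / t : ℂ) * ∫ x, φ x • (((‖v t x‖ ^ 2 - a ^ 2 : ℝ) : ℂ) * v t x))) t ↔
      HasDerivAt (fun τ => pairing (testL2 φ hφ hc) (comp 0 (y τ)))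
      (Complex.I * pairing (testL2 (deriv (deriv φ)) (contDiff_deriv (contDiff_deriv hφ))
        hc.deriv.deriv) (comp 0 (y t)) + pairing (testL2 φ hφ hc)
          (comp 0 ((Complex.I * (σ / t)) • fullNonlin a (y t)))) t) := by
    intro φ hφ hc t ht
    rw [key2 φ hφ hc t ht, key3 φ hφ hc t ht, map_smul, map_smul, smul_eq_mul]
    have e : (fun τ : ℝ => ∫ x, φ x • v τ x) =ᶠ[𝓝 t] fun τ =>
        (∫ x, φ x • (a : ℂ)) + pairing (testL2 φ hφ hc) (comp 0 (y τ)) := by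
      filter_upwards [Ioi_mem_nhds ht] with τ hτ
      exact key φ hφ hc τ hτ
    rw [e.hasDerivAt_iff, hasDerivAt_const_add_iff, mul_add, mul_assoc]
  constructor
  · exact fun h t ht φ hφ hc => (main φ hφ hc t ht).1 (h φ hφ hc t ht)
  · exact fun h φ hφ hc t ht => (main φ hφ hc t ht).2 (h t ht φ hφ hc)

end ModifiedWave

/-! ### Norms and decay rates of the remainder; from the integral equation back to the weak
equation. -/

namespace ModifiedWave

section Remainder

variable {s : ℕ} {t₀ : ℝ} {r : ℝ → ℝ → ℂ} {w : ℝ → Hs s}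

theorem normW_sub_eq (h : ∀ t ≥ t₀, r t =ᵐ[volume] comp 0 (w t)) {τ t : ℝ} (hτ : t₀ ≤ τ)
    (ht : t₀ ≤ t) : normW s 2 (r τ - r t) =
      ENNReal.ofReal (∑ k ∈ Finset.range (s + 1), ‖comp k (w τ - w t)‖) := by
  refine Hs.normW_eq _ ?_
  rw [map_sub]
  exact ((h τ hτ).sub (h t ht)).trans (Lp.coeFn_sub _ _).symm

theorem isContinuousInH_iff (h : ∀ t ≥ t₀, r t =ᵐ[volume] comp 0 (w t)) :
    IsContinuousInH s t₀ r ↔ ContinuousOn w (Ici t₀) := by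
  have key : ∀ t ≥ t₀, (Tendsto (fun τ => normW s 2 (r τ - r t)) (𝓝[Ici t₀] t) (𝓝 0) ↔
      ContinuousWithinAt w (Ici t₀) t) := by
    intro t ht
    have e : (fun τ => normW s 2 (r τ - r t)) =ᶠ[𝓝[Ici t₀] t] fun τ =>
        ENNReal.ofReal (∑ k ∈ Finset.range (s + 1), ‖comp k (w τ - w t)‖) := by
      filter_upwards [self_mem_nhdsWithin] with τ hτ
      exact normW_sub_eq h hτ ht
    rw [tendsto_congr' e, ContinuousWithinAt, tendsto_iff_norm_sub_tendsto_zero]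
    constructor
    · intro h1
      have h2 := (ENNReal.tendsto_toReal ENNReal.zero_ne_top).comp h1
      rw [ENNReal.toReal_zero] at h2
      refine squeeze_zero (fun _ => norm_nonneg _) (fun τ => ?_) h2
      rw [Function.comp_apply, ENNReal.toReal_ofReal (Finset.sum_nonneg fun _ _ => norm_nonneg _)]
      exact Hs.norm_le_sum _
    · intro h1
      have h2 : Tendsto (fun τ => ∑ k ∈ Finset.range (s + 1), ‖comp k (w τ - w t)‖)
          (𝓝[Ici t₀] t) (𝓝 0) := by
        have h3 := h1.const_mul ((s : ℝ) + 1)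
        rw [mul_zero] at h3
        exact squeeze_zero (fun _ => Finset.sum_nonneg fun _ _ => norm_nonneg _)
          (fun τ => Hs.sum_le_norm _) h3
      have h3 := (ENNReal.continuous_ofReal.tendsto 0).comp h2
      rw [ENNReal.ofReal_zero] at h3
      exact h3
  exact ⟨fun h1 t ht => (key t ht).1 (h1 t ht).2,
    fun h1 t ht => ⟨Hs.memW (w t) (h t ht), (key t ht).2 (h1 t ht)⟩⟩

theorem inv_sqrt_eq_rpow {t : ℝ} (ht : 0 < t) : t ^ (-(1 / 2) : ℝ) = 1 / √t := by
  rw [Real.rpow_neg ht.le, Real.sqrt_eq_rpow, one_div (t ^ _)]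

theorem hasDecay_of_le (ht₀ : 0 < t₀) (h : ∀ t ≥ t₀, r t =ᵐ[volume] comp 0 (w t)) {R R' : ℝ}
    (h0 : ∀ t ≥ t₀, ‖w t‖ ≤ R / √t) (h1 : ∀ t ≥ t₀, ∀ k < s, ‖comp (k + 1) (w t)‖ ≤ R' / t) :
    HasDecay s r := by
  constructor
  · refine Asymptotics.IsBigO.of_bound R ?_
    filter_upwards [Ici_mem_atTop t₀] with t ht
    have hp : 0 < t := ht₀.trans_le ht
    rw [eLpNorm_congr_ae (h t ht), eLpNorm_L2, ENNReal.toReal_ofReal (norm_nonneg _),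
      inv_sqrt_eq_rpow hp, norm_norm, Real.norm_of_nonneg (by positivity), mul_one_div]
    exact (norm_comp_le 0 _).trans (h0 t ht)
  · intro k hk0 hks
    refine Asymptotics.IsBigO.of_bound R' ?_
    filter_upwards [Ici_mem_atTop t₀] with t ht
    have hp : 0 < t := ht₀.trans_le ht
    obtain ⟨j, rfl⟩ := Nat.exists_eq_succ_of_ne_zero hk0.ne'
    rw [Hs.eLpNorm_weakDeriv (w t) (h t ht) hks, ENNReal.toReal_ofReal (norm_nonneg _), norm_norm,
      Real.norm_of_nonneg (by positivity), ← div_eq_mul_inv]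
    exact h1 t ht j hks

/-- Of the two decay rates, uniqueness uses only that the full H^s norm is O(t^{-1/2}). -/
theorem HasDecay.exists_norm_le (hd : HasDecay s r) (h : ∀ t ≥ t₀, r t =ᵐ[volume] comp 0 (w t)) :
    ∃ C, 0 ≤ C ∧ ∀ᶠ t in atTop, ‖w t‖ ≤ C / √t := by
  have key : ∀ k ≤ s, (fun t => ‖comp k (w t)‖) =O[atTop] fun t : ℝ => t ^ (-(1 / 2) : ℝ) := by
    intro k hk
    rcases Nat.eq_zero_or_pos k with rfl | hk0
    · refine hd.1.congr' ?_ EventuallyEq.rfl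
      filter_upwards [Ici_mem_atTop t₀] with t ht
      rw [eLpNorm_congr_ae (h t ht), eLpNorm_L2, ENNReal.toReal_ofReal (norm_nonneg _)]
    · have h1 : (fun t => ‖comp k (w t)‖) =O[atTop] fun t : ℝ => t⁻¹ := by
        refine (hd.2 k hk0 hk).congr' ?_ EventuallyEq.rfl
        filter_upwards [Ici_mem_atTop t₀] with t ht
        rw [Hs.eLpNorm_weakDeriv (w t) (h t ht) hk, ENNReal.toReal_ofReal (norm_nonneg _)]
      refine h1.trans (Asymptotics.IsBigO.of_bound 1 ?_)
      filter_upwards [Ici_mem_atTop 1] with t ht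
      have hp : (0 : ℝ) < t := zero_lt_one.trans_le ht
      rw [← Real.rpow_neg_one, one_mul, Real.norm_of_nonneg (by positivity),
        Real.norm_of_nonneg (by positivity)]
      exact Real.rpow_le_rpow_of_exponent_le ht (by norm_num)
  have hsum : (fun t => ∑ k ∈ Finset.range (s + 1), ‖comp k (w t)‖) =O[atTop]
      fun t : ℝ => t ^ (-(1 / 2) : ℝ) := by
    refine (Asymptotics.IsBigO.sum (s := Finset.range (s + 1)) fun k hk =>
      key k (Nat.lt_succ_iff.1 (Finset.mem_range.1 hk))).congr_left fun t => ?_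
    rw [Finset.sum_apply]
  obtain ⟨C, hC, hb⟩ := hsum.exists_nonneg
  refine ⟨C, hC, ?_⟩
  filter_upwards [hb.bound, Ioi_mem_atTop 0] with t h1 h2
  have hp : (0 : ℝ) < t := h2
  rw [inv_sqrt_eq_rpow hp, Real.norm_of_nonneg (Finset.sum_nonneg fun _ _ => norm_nonneg _),
    Real.norm_of_nonneg (by positivity), mul_one_div] at h1
  exact (Hs.norm_le_sum _).trans h1

end Remainder

variable {s : ℕ} {u : ℝ → ℂ} {δ : ℝ}

theorem Data.hasDerivAt_wave (D : Data s u δ) (β : ℝ) {t : ℝ} (ht : 0 < t) :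
    HasDerivAt (fun τ => schr (-τ) (comp 0 (D.wave β τ)))
      ((β * Complex.I / t * phase β t) • comp 0 D.U) t := by
  refine ((hasDerivAt_phase β ht).smul_const (comp 0 D.U)).congr_of_eventuallyEq
    (Eventually.of_forall fun τ => ?_)
  simp only [Data.wave, map_smul, comp_schrH, schr_neg_schr]

variable [NeZero s]

theorem Data.profile_ae_eq (D : Data s u δ) (σ a t : ℝ) :
    profile σ a u t =ᵐ[volume] fun x => (a : ℂ) + comp 0 (D.wave (σ * a ^ 2) t) x := by
  have hU : classL2 u = comp 0 D.U := classL2_congr D.ae_eq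
  have hu2 : MemLp u 2 volume := (memLp_congr_ae D.ae_eq).2 (Lp.memLp _)
  have hD := isD_comp (NeZero.pos s) D.U
  rw [← hU] at hD
  have h := freeSchrodinger_ae_eq D.integrable_u hu2 hD t
  rw [hU] at h
  rw [Data.wave, map_smul, comp_schrH]
  filter_upwards [h, Lp.coeFn_smul (phase (σ * a ^ 2) t) (schr t (comp 0 D.U))] with x h1 h2
  rw [h2, Pi.smul_apply, profile, h1, phase, smul_eq_mul]
  congr 3
  push_cast; ring

/-- The time derivative in the interaction picture prescribed by the equation. -/
def rhs (σ a t : ℝ) (y : Hs s) : Hs s := (Complex.I * (σ / t)) • fullNonlin a y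

/-- The integral equation for the remainder implies the weak form of the equation. -/
theorem Data.weakEq (D : Data s u δ) {σ a : ℝ} {I : Iteration s} {w : ℝ → Hs s} (hIa : I.a = a)
    (hκ : I.κ = -(Complex.I * σ)) (hz : I.z = D.wave (σ * a ^ 2))
    (hK : I.K = D.duhamel a (σ * a ^ 2)) (hw : I.Admissible w)
    (hfix : ∀ t ≥ I.t₀, w t = I.next w t) {t : ℝ} (ht : I.t₀ < t) :
    WeakEq (fun τ => comp 0 (D.wave (σ * a ^ 2) τ + w τ))
      (comp 0 (rhs σ a t (D.wave (σ * a ^ 2) t + w t))) t := by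
  have hp : 0 < t := I.ht₀.trans ht
  have h0 : (t : ℂ) ≠ 0 := by exact_mod_cast hp.ne'
  set β := σ * a ^ 2 with hβ
  refine weakEq_of_hasDerivAt ?_
  have h1 := D.hasDerivAt_wave β hp
  have h2 := D.hasDerivAt_duhamel a β hp
  have h3 := ((comp 0).restrictScalars ℝ).hasFDerivAt.comp_hasDerivAt t
    (hasDerivAt_tail (hw.integrableOn le_rfl)
      (hw.continuousOn_increment.mono Ioi_subset_Ici_self) ht)
  have h4 := h1.add ((h2.add h3).const_smul I.κ)
  refine (h4.congr_of_eventuallyEq ?_).congr_deriv ?_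
  · filter_upwards [Ioi_mem_nhds ht] with τ hτ
    rw [hfix τ (le_of_lt hτ), Iteration.next, map_add, map_add, hK]
    simp only [map_smul, map_add, comp_schrH, schr_neg_schr]
    rfl
  · rw [ContinuousLinearMap.coe_restrictScalars', ← comp_schrH]
    set z := D.wave β t with hzt
    have e1 : (β * Complex.I / t * phase β t) • D.U =
        (Complex.I * (σ / t)) • schrH (-t) ((a ^ 2 : ℂ) • z) := by
      rw [hzt, Data.wave, schrH_smul, schrH_smul, schrH_neg_schrH, smul_smul, smul_smul, hβ]
      congr 1; push_cast; ring
    have e2 : increment I.a I.z w t =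
        (t : ℂ)⁻¹ • schrH (-t) (fullNonlin a (z + w t) - fullNonlin a z) := by
      rw [increment, hIa, hz]
    -- The three groups have three origins: a²z comes from differentiating the phase, a²z̄ + N(z)
    -- from the Duhamel term and the difference from the tail of the increment.
    have e3 : fullNonlin a (z + w t) = (a ^ 2 : ℂ) • z +
        ((a ^ 2 : ℂ) • conjH z + nonlin a z) + (fullNonlin a (z + w t) - fullNonlin a z) := by
      rw [fullNonlin, fullNonlin]; module
    rw [e2, hκ, rhs, ← (comp 0).map_smul, e1, ← map_neg, ← map_add, ← (comp 0).map_smul, ← map_add]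
    congr 1
    conv_rhs => rw [e3]
    generalize (a ^ 2 : ℂ) • z = A
    generalize (a ^ 2 : ℂ) • conjH z + nonlin a z = B
    generalize fullNonlin a (z + w t) - fullNonlin a z = C
    rw [schrH_smul, map_add, map_add, div_eq_mul_inv]
    module

end ModifiedWave

/-! ### Uniqueness: large times, then backward in time. -/

namespace ModifiedWave

variable {s : ℕ} [NeZero s]

theorem continuousOn_rhs (σ a : ℝ) {t₀ : ℝ} (ht₀ : 0 < t₀) {y : ℝ → Hs s}
    (hy : ContinuousOn y (Ioi t₀)) : ContinuousOn (fun t => rhs σ a t (y t)) (Ioi t₀) := by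
  have h1 : ContinuousOn (fun t : ℝ => Complex.I * ((σ : ℂ) / t)) (Ioi t₀) := by
    refine continuousOn_const.mul (continuousOn_const.div Complex.continuous_ofReal.continuousOn
      fun t ht => ?_)
    exact_mod_cast (ht₀.trans ht).ne'
  exact h1.smul ((continuous_fullNonlin a).comp_continuousOn hy)

theorem norm_rhs_sub_le {σ a ε t : ℝ} (hσ : |σ| ≤ 1) (ha : 0 ≤ a) (hε : 0 ≤ ε) (ht : 0 < t)
    {y y' : Hs s} (h : MulBdd ε y) (h' : MulBdd ε y') : ‖rhs σ a t y - rhs σ a t y'‖ ≤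
      1 / t * ((2 * a ^ 2 + (6 * a * ε + 3 * ε ^ 2)) * ‖y - y'‖) := by
  rw [rhs, rhs, ← smul_sub, norm_smul]
  refine mul_le_mul ?_ (norm_fullNonlin_sub_le ha hε h h') (norm_nonneg _) (by positivity)
  rw [norm_mul, Complex.norm_I, one_mul, norm_div, Complex.norm_real, Complex.norm_real,
    Real.norm_eq_abs, Real.norm_of_nonneg ht.le]
  gcongr

section Uniqueness

variable {σ a t₀ : ℝ} {y y' : ℝ → Hs s}

/-- Two solutions which approach each other like `t^{-1/2}` agree for large times. -/
theorem eventually_eq_of_hasDerivAt (hσ : |σ| ≤ 1) (ha : 0 ≤ a) (ha4 : a ≤ 1 / 4) (ht₀ : 0 < t₀)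
    (hy : ContinuousOn y (Ioi t₀)) (hy' : ContinuousOn y' (Ioi t₀))
    (hd : ∀ t > t₀, HasDerivAt (fun τ => schrH (-τ) (y τ - y' τ))
      (schrH (-t) (rhs σ a t (y t) - rhs σ a t (y' t))) t) {C E : ℝ} (hE0 : 0 ≤ E)
    (hC : ∀ᶠ t in atTop, ‖y t - y' t‖ ≤ C / √t) (hE : ∀ᶠ t in atTop, MulBdd (E / √t) (y t))
    (hE' : ∀ᶠ t in atTop, MulBdd (E / √t) (y' t)) : ∃ T > t₀, ∀ t ≥ T, y t = y' t := by
  -- Starting late replaces smallness: T ≥ (100E)² + 1 gives E ≤ √T/100, whatever the size of the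
  -- two remainders.
  obtain ⟨T, hT⟩ := eventually_atTop.1 ((hC.and (hE.and hE')).and
    ((eventually_gt_atTop t₀).and (eventually_ge_atTop ((100 * E) ^ 2 + 1))))
  have hT0 : t₀ < T := (hT T le_rfl).2.1
  have hTE := (hT T le_rfl).2.2
  have hTp : 0 < T := ht₀.trans hT0
  have hsq : E ≤ √T / 100 := by
    have : 100 * E ≤ √T := Real.le_sqrt_of_sq_le (by linarith)
    linarith
  have hder : ∀ τ ≥ T, ‖schrH (-τ) (rhs σ a τ (y τ) - rhs σ a τ (y' τ))‖ ≤
      1 / τ * (1 / 4 * ‖y τ - y' τ‖) := fun τ hτ => by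
    have hp : 0 < τ := hTp.trans_le hτ
    rw [norm_schrH]
    refine (norm_rhs_sub_le hσ ha (by positivity) hp (hT τ hτ).1.2.1 (hT τ hτ).1.2.2).trans ?_
    have h1 := coef_le_eighth hTp (by linarith : a ≤ 1) hE0 hsq hτ
    have h2 : 2 * a ^ 2 ≤ 1 / 8 := by nlinarith
    gcongr
    linarith
  -- The difference tends to 0 at infinity, so it equals minus the integral of its derivative over
  -- (t,∞). This integral is at most 2·(C/4)/√t, hence the bound is halved and can be iterated.
  have hstep : ∀ C : ℝ, (∀ τ ≥ T, ‖y τ - y' τ‖ ≤ C / √τ) →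
      ∀ τ ≥ T, ‖y τ - y' τ‖ ≤ C / 2 / √τ := by
    intro C hC t ht
    have htp : 0 < t := hTp.trans_le ht
    have hb : ∀ τ > t, ‖schrH (-τ) (rhs σ a τ (y τ) - rhs σ a τ (y' τ))‖ ≤
        C / 4 * (1 / (τ * √τ)) := fun τ hτ => by
      have hτ' : T ≤ τ := ht.trans (le_of_lt hτ)
      have hp : 0 < τ := hTp.trans_le hτ'
      refine (hder τ hτ').trans ?_
      calc _ ≤ 1 / τ * (1 / 4 * (C / √τ)) := by gcongr; exact hC τ hτ'
        _ = _ := by field_simp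
    have hcont : ContinuousOn (fun τ => schrH (-τ) (rhs σ a τ (y τ) - rhs σ a τ (y' τ))) (Ioi t) :=
      (continuousOn_schrH continuous_neg.continuousOn ((continuousOn_rhs σ a ht₀ hy).sub
        (continuousOn_rhs σ a ht₀ hy'))).mono (Ioi_subset_Ioi (hT0.le.trans ht))
    have hlim : Tendsto (fun τ => schrH (-τ) (y τ - y' τ)) atTop (𝓝 0) := by
      have h1 : Tendsto (fun τ => C / √τ) atTop (𝓝 0) :=
        tendsto_const_nhds.div_atTop Real.tendsto_sqrt_atTop
      refine squeeze_zero_norm' ?_ h1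
      filter_upwards [Ici_mem_atTop T] with τ hτ
      rw [norm_schrH]
      exact hC τ hτ
    have h1 := integral_Ioi_of_hasDerivAt_of_tendsto' (a := t)
      (fun τ hτ => hd τ (hT0.trans_le (ht.trans hτ))) (integrableOn_of_le_sqrt htp hcont hb) hlim
    have h2 := norm_tail_le_sqrt htp hb
    rw [tail, h1, zero_sub, norm_neg, norm_schrH] at h2
    exact h2.trans (le_of_eq (by ring))
  have hall : ∀ n : ℕ, ∀ τ ≥ T, ‖y τ - y' τ‖ ≤ C / 2 ^ n / √τ := by
    intro n
    induction n with
    | zero => simpa using fun τ hτ => (hT τ hτ).1.1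
    | succ n ih =>
      intro τ hτ
      refine (hstep _ ih τ hτ).trans (le_of_eq ?_)
      rw [pow_succ, div_div C]
  refine ⟨T, hT0, fun t ht => ?_⟩
  have h1 : Tendsto (fun n : ℕ => C / 2 ^ n / √t) atTop (𝓝 0) := by
    have h2 : Tendsto (fun n : ℕ => C / 2 ^ n) atTop (𝓝 0) :=
      tendsto_const_nhds.div_atTop (tendsto_pow_atTop_atTop_of_one_lt one_lt_two)
    simpa using h2.div_const (√t)
  have h3 := ge_of_tendsto' h1 fun n => hall n t ht
  exact sub_eq_zero.1 (norm_le_zero_iff.1 h3)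

/-- Backward uniqueness on bounded time intervals. -/
theorem eq_of_hasDerivAt_of_eq (hσ : |σ| ≤ 1) (ha : 0 ≤ a) (ht₀ : 0 < t₀)
    (hy : ContinuousOn y (Ioi t₀)) (hy' : ContinuousOn y' (Ioi t₀))
    (hd : ∀ t > t₀, HasDerivAt (fun τ => schrH (-τ) (y τ - y' τ))
      (schrH (-t) (rhs σ a t (y t) - rhs σ a t (y' t))) t) {t T : ℝ} (ht : t₀ < t) (htT : t ≤ T)
    (hT : y T = y' T) : y t = y' t := by
  have hsub : Icc t T ⊆ Ioi t₀ := fun x hx => ht.trans_le hx.1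
  obtain ⟨M, hM⟩ := isCompact_Icc.exists_bound_of_continuousOn (hy.mono hsub)
  obtain ⟨M', hM'⟩ := isCompact_Icc.exists_bound_of_continuousOn (hy'.mono hsub)
  have htp : 0 < t := ht₀.trans ht
  set ε : ℝ := 2 ^ (s + 1) * max M M'
  have hM0 : 0 ≤ max M M' :=
    (norm_nonneg _).trans ((hM t (left_mem_Icc.2 htT)).trans (le_max_left _ _))
  have hε : 0 ≤ ε := by positivity
  set L : ℝ := 1 / t * (2 * a ^ 2 + (6 * a * ε + 3 * ε ^ 2))
  -- The vanishing is known at the right end T, so time is reversed before Gronwall's inequality is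
  -- applied. On [t,T] both solutions are bounded, which provides a Lipschitz constant.
  have hder : ∀ x ∈ Ico (-T) (-t), HasDerivAt (fun x => schrH (- -x) (y (-x) - y' (-x)))
      (-schrH (- -x) (rhs σ a (-x) (y (-x)) - rhs σ a (-x) (y' (-x)))) x := fun x hx => by
    have h1 := (hd (-x) (ht.trans (by linarith [hx.2]))).scomp x (hasDerivAt_neg x)
    simpa [Function.comp_def] using h1
  have key := eq_zero_of_abs_deriv_le_mul_abs_self_of_eq_zero_right (K := L) (a := -T) (b := -t)
    (f := fun x => schrH (- -x) (y (-x) - y' (-x)))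
    (f' := fun x => -schrH (- -x) (rhs σ a (-x) (y (-x)) - rhs σ a (-x) (y' (-x))))
    ?_ (fun x hx => (hder x hx).hasDerivWithinAt) ?_ ?_ (-t) (right_mem_Icc.2 (by linarith))
  · have h2 := congrArg norm key
    simp only [norm_schrH, norm_zero, neg_neg] at h2
    exact sub_eq_zero.1 (norm_eq_zero.1 h2)
  · have hmaps : MapsTo (fun x : ℝ => -x) (Icc (-T) (-t)) (Ioi t₀) := fun x hx =>
      ht.trans_le (by linarith [hx.2])
    exact continuousOn_schrH continuous_neg.neg.continuousOn
      ((hy.comp continuous_neg.continuousOn hmaps).sub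
        (hy'.comp continuous_neg.continuousOn hmaps))
  · simp only [neg_neg, hT, sub_self, map_zero]
  · intro x hx
    have hx1 : t ≤ -x := by linarith [hx.2]
    have hmem : -x ∈ Icc t T := ⟨hx1, by linarith [hx.1]⟩
    rw [norm_neg, norm_schrH, norm_schrH]
    have b1 : MulBdd ε (y (-x)) := (mulBdd_norm _).mono
      (mul_le_mul_of_nonneg_left ((hM _ hmem).trans (le_max_left _ _)) (by positivity))
    have b2 : MulBdd ε (y' (-x)) := (mulBdd_norm _).mono
      (mul_le_mul_of_nonneg_left ((hM' _ hmem).trans (le_max_right _ _)) (by positivity))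
    refine (norm_rhs_sub_le hσ ha hε (htp.trans_le hx1) b1 b2).trans ?_
    rw [← mul_assoc]
    exact mul_le_mul_of_nonneg_right (mul_le_mul_of_nonneg_right
      (one_div_le_one_div_of_le htp hx1) (by positivity)) (norm_nonneg _)

/-- Agreement for large times is propagated backward to every t > t₀; at t₀ itself, where no
equation is assumed, it follows from continuity. -/
theorem eq_of_weakEq (hσ : |σ| ≤ 1) (ha : 0 ≤ a) (ha4 : a ≤ 1 / 4) (ht₀ : 0 < t₀)
    (hy : ContinuousOn y (Ici t₀)) (hy' : ContinuousOn y' (Ici t₀))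
    (hw : ∀ t > t₀, WeakEq (fun τ => comp 0 (y τ)) (comp 0 (rhs σ a t (y t))) t)
    (hw' : ∀ t > t₀, WeakEq (fun τ => comp 0 (y' τ)) (comp 0 (rhs σ a t (y' t))) t)
    {C E : ℝ} (hE0 : 0 ≤ E)
    (hC : ∀ᶠ t in atTop, ‖y t - y' t‖ ≤ C / √t) (hE : ∀ᶠ t in atTop, MulBdd (E / √t) (y t))
    (hE' : ∀ᶠ t in atTop, MulBdd (E / √t) (y' t)) {t : ℝ} (ht : t₀ ≤ t) : y t = y' t := by
  have hyo := hy.mono Ioi_subset_Ici_self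
  have hyo' := hy'.mono Ioi_subset_Ici_self
  have hd : ∀ t > t₀, HasDerivAt (fun τ => schrH (-τ) (y τ - y' τ))
      (schrH (-t) (rhs σ a t (y t) - rhs σ a t (y' t))) t := fun t ht => by
    have h1 := hasDerivAt_of_weakEq hyo (continuousOn_rhs σ a ht₀ hyo) hw ht
    have h2 := hasDerivAt_of_weakEq hyo' (continuousOn_rhs σ a ht₀ hyo') hw' ht
    simp only [map_sub]
    exact h1.sub h2
  obtain ⟨T, hT, hlarge⟩ :=
    eventually_eq_of_hasDerivAt hσ ha ha4 ht₀ hyo hyo' hd hE0 hC hE hE'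
  have hopen : ∀ t > t₀, y t = y' t := fun t ht => by
    rcases le_total T t with h | h
    · exact hlarge t h
    · exact eq_of_hasDerivAt_of_eq hσ ha ht₀ hyo hyo' hd ht h (hlarge T le_rfl)
  rcases ht.eq_or_lt with rfl | h
  · have h1 := (hy t₀ self_mem_Ici).mono Ioi_subset_Ici_self
    have h2 := (hy' t₀ self_mem_Ici).mono Ioi_subset_Ici_self
    refine tendsto_nhds_unique h1 (h2.congr' ?_)
    filter_upwards [self_mem_nhdsWithin] with τ hτ
    exact (hopen τ hτ).symm
  · exact hopen t h

end Uniqueness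

end ModifiedWave

/-! ### Existence and uniqueness of wave solutions, and the choice of constants. -/

namespace ModifiedWave

variable {s : ℕ} {u : ℝ → ℂ} {δ : ℝ}

theorem Data.continuousOn_wave_add (D : Data s u δ) (β : ℝ) {t₀ : ℝ} (ht₀ : 0 < t₀)
    {w : ℝ → Hs s} (hw : ContinuousOn w (Ici t₀)) :
    ContinuousOn (fun t => D.wave β t + w t) (Ici t₀) :=
  ((D.continuousOn_wave β).mono fun _ h => ht₀.trans_le h).add hw

variable [NeZero s]

theorem Data.ae_eq_wave_add (D : Data s u δ) (σ a t : ℝ) {v : ℝ → ℝ → ℂ} {w : Hs s}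
    (h : (fun x => v t x - profile σ a u t x) =ᵐ[volume] comp 0 w) :
    v t =ᵐ[volume] fun x => (a : ℂ) + comp 0 (D.wave (σ * a ^ 2) t + w) x := by
  rw [map_add]
  filter_upwards [h, D.profile_ae_eq σ a t,
    Lp.coeFn_add (comp 0 (D.wave (σ * a ^ 2) t)) (comp 0 w)] with x h1 h2 h3
  rw [h3, Pi.add_apply, ← add_assoc, ← h2, ← h1]
  ring

/-- A wave solution is the sum of the constant, the linear wave and a small continuous remainder
in `H^s`. -/
theorem Data.exists_remainder (D : Data s u δ) {σ a t₀ : ℝ} {v : ℝ → ℝ → ℂ}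
    (hv : IsWaveSolution σ a t₀ s u v) : ∃ (w : ℝ → Hs s) (C : ℝ), ContinuousOn w (Ici t₀) ∧
      (∀ t ≥ t₀, v t =ᵐ[volume] fun x => (a : ℂ) + comp 0 (D.wave (σ * a ^ 2) t + w t) x) ∧
      (∀ t > t₀, WeakEq (fun τ => comp 0 (D.wave (σ * a ^ 2) τ + w τ))
        (comp 0 (rhs σ a t (D.wave (σ * a ^ 2) t + w t))) t) ∧
      0 ≤ C ∧ ∀ᶠ t in atTop, ‖w t‖ ≤ C / √t := by
  have hr : ∀ t ≥ t₀, (fun x => v t x - profile σ a u t x) =ᵐ[volume]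
      comp 0 (toHs s fun x => v t x - profile σ a u t x) :=
    fun t ht => (hv.continuous_sub t ht).1.ae_eq_toHs
  obtain ⟨C, hC, hC'⟩ := hv.decay.exists_norm_le hr
  have hae := fun t ht => D.ae_eq_wave_add σ a t (hr t ht)
  exact ⟨_, C, (isContinuousInH_iff hr).1 hv.continuous_sub, hae,
    (isSolution_iff fun t ht => hae t ht.le).1 hv.isSolution, hC, hC'⟩

theorem Data.eventually_mulBdd_wave_add (D : Data s u δ) (β : ℝ) {w : ℝ → Hs s} {C C' : ℝ}
    (hC : C ≤ C') (hw : ∀ᶠ t in atTop, ‖w t‖ ≤ C / √t) :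
    ∀ᶠ t in atTop, MulBdd ((2 ^ s * δ + 2 ^ (s + 1) * C') / √t) (D.wave β t + w t) := by
  filter_upwards [hw, Ioi_mem_atTop 0] with t h1 h2
  refine ((D.mulBdd_wave β h2).add (mulBdd_norm (w t))).mono ?_
  rw [add_div, mul_div_assoc (2 ^ (s + 1))]
  gcongr
  exact h1.trans (by gcongr)

/-- Wave solutions are unique up to null sets. -/
theorem Data.isWaveSolution_unique (D : Data s u δ) {σ a t₀ : ℝ} (hσ : |σ| ≤ 1) (ha : 0 ≤ a)
    (ha4 : a ≤ 1 / 4) (ht₀ : 0 < t₀) {v v' : ℝ → ℝ → ℂ} (hv : IsWaveSolution σ a t₀ s u v)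
    (hv' : IsWaveSolution σ a t₀ s u v') {t : ℝ} (ht : t₀ ≤ t) : v' t =ᵐ[volume] v t := by
  obtain ⟨w, C, hw, hae, hweak, hC0, hC⟩ := D.exists_remainder hv
  obtain ⟨w', C', hw', hae', hweak', hC0', hC'⟩ := D.exists_remainder hv'
  have hδ := D.nonneg
  have hE : 0 ≤ 2 ^ s * δ + 2 ^ (s + 1) * (C + C') := by positivity
  have heq := eq_of_weakEq hσ ha ha4 ht₀ (D.continuousOn_wave_add (σ * a ^ 2) ht₀ hw)
    (D.continuousOn_wave_add (σ * a ^ 2) ht₀ hw') hweak hweak' (C := C + C') hE ?_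
    (D.eventually_mulBdd_wave_add _ (le_add_of_nonneg_right hC0') hC)
    (D.eventually_mulBdd_wave_add _ (le_add_of_nonneg_left hC0) hC') ht
  · refine (hae' t ht).trans ?_
    rw [← heq]
    exact (hae t ht).symm
  · filter_upwards [hC, hC'] with τ h1 h2
    rw [add_sub_add_left_eq_sub, add_div]
    exact (norm_sub_le _ _).trans (add_le_add h1 h2)

/-- Existence of a wave solution for small data. -/
theorem Data.exists_isWaveSolution (D : Data s u δ) {σ a t₀ R : ℝ} (hσ : |σ| = 1) (ha : 0 ≤ a)
    (ha4 : a ≤ 1 / 4) (ht₀ : 0 < t₀) (hR : 0 ≤ R) (hsmall : 2 ^ s * δ + 2 ^ (s + 1) * R ≤ √t₀ / 100)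
    (hδ : δ * (√t₀ / 4 + 2 / √t₀) ≤ R / 2) : ∃ v, IsWaveSolution σ a t₀ s u v := by
  have hβ : |σ * a ^ 2| ≤ 1 := by
    rw [abs_mul, hσ, one_mul, abs_of_nonneg (by positivity)]
    nlinarith
  have hδ0 := D.nonneg
  obtain ⟨S, hS⟩ := D.norm_comp_duhamel_le a (σ * a ^ 2) ha
  have hsub : Ici t₀ ⊆ Ioi 0 := fun _ h => ht₀.trans_le h
  -- The derivative constant comes without a sign, so its absolute value is used; no smallness is
  -- asked of it.
  let I : Iteration s :=
    { t₀ := t₀, a := a, ρ := 2 ^ s * δ, R := R, S₁ := |S|, κ := -(Complex.I * σ)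
      z := D.wave (σ * a ^ 2), K := D.duhamel a (σ * a ^ 2)
      ht₀ := ht₀, ha := ha, ha4 := ha4
      hκ := by simp [hσ]
      hρ := by positivity
      hR := hR
      hS₁ := abs_nonneg S
      small := hsmall
      continuousOn_z := (D.continuousOn_wave _).mono hsub
      continuousOn_K := D.continuousOn_duhamel _ _ ht₀
      mulBdd_z := fun τ hτ => D.mulBdd_wave _ (ht₀.trans_le hτ)
      norm_K := fun t ht => by
        refine (D.norm_duhamel_le ht₀ ha ha4 hβ ?_ ht).trans (by gcongr)
        exact (le_add_of_nonneg_right (by positivity)).trans hsmall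
      norm_comp_K := fun t ht k hk => by
        have := ht₀.trans_le ht
        exact (hS t this k hk).trans (by gcongr; exact le_abs_self S) }
  obtain ⟨w, hw, hfix⟩ := I.exists_solution
  let v : ℝ → ℝ → ℂ := fun t x => profile σ a u t x + comp 0 (w t) x
  have hr : ∀ t ≥ t₀, (fun x => v t x - profile σ a u t x) =ᵐ[volume] comp 0 (w t) :=
    fun t _ => Eventually.of_forall fun x => add_sub_cancel_left _ _
  exact ⟨v, (isSolution_iff fun t ht => D.ae_eq_wave_add σ a t (hr t ht.le)).2 fun t ht =>
      D.weakEq rfl rfl rfl rfl hw hfix ht,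
    (isContinuousInH_iff hr).2 hw.continuousOn, hasDecay_of_le ht₀ hr hw.norm_le hw.norm_comp_le⟩

end ModifiedWave

end

/-- Modified wave operators for `i v_t + v_xx + (σ/t) (|v|² - a²) v = 0`, `σ = ±1`, around the
constant solution `a`: existence, and uniqueness up to null sets in `x`, for small data. -/
theorem theorem1p4 (t₀ : ℝ) (ht₀ : 0 < t₀) (s : ℕ) (hs : 1 ≤ s) :
    ∃ a₀ : ℝ, 0 < a₀ ∧ ∃ δ : ℝ, 0 < δ ∧
      ∀ σ : ℝ, (σ = 1 ∨ σ = -1) → ∀ a : ℝ, 0 < a → a < a₀ →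
        ∀ u : ℝ → ℂ, ModifiedWave.MemData s u → ModifiedWave.dataNorm s u < ENNReal.ofReal δ →
          ∃ v : ℝ → ℝ → ℂ, ModifiedWave.IsWaveSolution σ a t₀ s u v ∧
            ∀ v' : ℝ → ℝ → ℂ, ModifiedWave.IsWaveSolution σ a t₀ s u v' →
              ∀ t : ℝ, t₀ ≤ t → v' t =ᵐ[MeasureTheory.volume] v t := by
  have : NeZero s := ⟨Nat.one_le_iff_ne_zero.1 hs⟩
  -- The smallness budget E is split evenly: 2^s δ ≤ E/2 for the free wave and 2^{s+1}R = E/2 for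
  -- the remainder. The second bound on δ makes the Duhamel term at most R/2 in the weighted norm.
  set E : ℝ := √t₀ / 100 with hE
  have hsq : 0 < √t₀ := Real.sqrt_pos.2 ht₀
  have hE0 : 0 < E := by positivity
  set R : ℝ := E / 2 / 2 ^ (s + 1) with hR
  set B : ℝ := √t₀ / 4 + 2 / √t₀ with hB
  have hB0 : 0 < B := by positivity
  set δ : ℝ := min (E / 2 / 2 ^ s) (R / 2 / B) with hδ
  have hδ0 : 0 < δ := by positivity
  refine ⟨1 / 4, by norm_num, δ, hδ0, fun σ hσ a ha ha4 u hu hn => ?_⟩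
  obtain ⟨D⟩ := hu.exists_data hδ0 hn
  have hσ1 : |σ| = 1 := by rcases hσ with rfl | rfl <;> simp
  have h1 : 2 ^ s * δ ≤ E / 2 := by
    rw [mul_comm, ← le_div_iff₀ (by positivity)]
    exact min_le_left _ _
  have h2 : 2 ^ (s + 1) * R = E / 2 := by
    rw [hR]; field_simp
  have h3 : δ * B ≤ R / 2 := by
    rw [← le_div_iff₀ hB0]
    exact min_le_right _ _
  obtain ⟨v, hv⟩ := D.exists_isWaveSolution hσ1 ha.le ha4.le ht₀ (R := R) (by positivity)
    (by linarith) h3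
  exact ⟨v, hv, fun v' hv' t ht => D.isWaveSolution_unique hσ1.le ha.le ha4.le ht₀ hv hv' ht⟩
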